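/- Let $n\ge 3$, let $\hat I=\mathbb Z/n\mathbb Z$, let $q,d\in\mathbb C^\times$, and put $q_1=d/q$, $q_2=q^2$, $q_3=1/(dq)$. Assume that $q_1,q_2,q_3$ are generic: $q_1^aq_2^bq_3^c=1$ with $a,b,c\in\mathbb Z$ implies $a=b=c$. Let $\mathcal E_n=\mathcal E_n(q,d)$ be the quantum toroidal algebra of type $\mathfrak{gl}_n$ with the central element $q^{c/2}$ set to $1$. It is generated by $E_{i,k},F_{i,k}$ ($k\in\mathbb Z$), $H_{i,l}$ ($l\neq0$) and $K_i^{\pm1}$ ($i\in\hat I$), with currents $E_i(z)=\sum_k E_{i,k}z^{-k}$, $F_i(z)=\sum_kF_{i,k}z^{-k}$, $K_i^\pm(z)=K_i^{\pm1}\exp\bigl(\pm(q-q^{-1})\sum_{k\ge1}H_{i,\pm k}z^{\mp k}\bigr)$ and the following relations for $i,j\in\hat I$. Here $a_{ii}=2$, $a_{i,i\pm1}=-1$, $m_{i,i+1}=-1$, $m_{i+1,i}=1$, all other $a_{ij},m_{ij}$ are $0$, and $\delta(x)=\sum_{r\in\mathbb Z}x^r$: $K_iK_i^{-1}=K_i^{-1}K_i=1$;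 all coefficients of the $K_i^\pm(z)$ commute; $$(q^{a_{ij}}w-d^{m_{ij}}z)K_i^\pm(z)E_j(w)=(w-d^{m_{ij}}q^{a_{ij}}z)E_j(w)K_i^\pm(z),$$ $$(w-d^{m_{ij}}q^{a_{ij}}z)K_i^\pm(z)F_j(w)=(q^{a_{ij}}w-d^{m_{ij}}z)F_j(w)K_i^\pm(z),$$ $$[E_i(z),F_j(w)]=\tfrac{\delta_{ij}}{q-q^{-1}}\bigl(\delta(w/z)K_i^+(w)-\delta(z/w)K_i^-(z)\bigr),$$ $$(d^{m_{ij}}z-q^{a_{ij}}w)E_i(z)E_j(w)=(d^{m_{ij}}q^{a_{ij}}z-w)E_j(w)E_i(z),$$ $$(d^{m_{ij}}z-q^{-a_{ij}}w)F_i(z)F_j(w)=(d^{m_{ij}}q^{-a_{ij}}z-w)F_j(w)F_i(z);$$ for $X=E$ and $X=F$, $[X_i(z),X_j(w)]=0$ if $j\not\equiv i,i\pm1$, and the sum over the two orderings of $z_1,z_2$ of $X_i(z_1)X_i(z_2)X_{i\pm1}(w)-(q+q^{-1})X_i(z_1)X_{i\pm1}(w)X_i(z_2)+X_{i\pm1}(w)X_i(z_1)X_i(z_2)$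 is $0$. For $k\in\hat I$ and $u\in\mathbb C^\times$ let $\mathcal F^{(k)}(u)$ be the Fock module with basis $|\lambda\rangle$, $\lambda=(\lambda_1\ge\lambda_2\ge\cdots)$ running over all partitions. With $\psi(w)=\frac{q-q^{-1}w}{1-w}$, its action is as follows. The series $K_i^{\pm}(z)$ act on $|\lambda\rangle$ by the expansions at $z^{\mp1}=0$, that is at $z=\infty$ for $K_i^+$ and at $z=0$ for $K_i^-$, of the rational function $$\prod_{s\ge1,\ \lambda_s+i\equiv s+k}\psi(q_1^{\lambda_s-1}q_3^{s-1}u/z)\prod_{s\ge1,\ \lambda_s+i+1\equiv s+k}\psi(q_1^{\lambda_s-1}q_3^{s-2}u/z)^{-1}.$$ For a partition $\lambda$ and $j\ge1$ with $i+\lambda_j+1\equiv j+k$ such that $\lambda+\mathbf 1_j$ is a partition, $\langle\lambda+\mathbf 1_j|E_i(z)|\lambda\rangle=\delta(q_1^{\lambda_j}q_3^{j-1}u/z)\prod_{1\le s<j}g_s$ and $\langle\lambda|F_i(z)|\lambda+\mathbf 1_j\rangle=\delta(q_1^{\lambda_j}q_3^{j-1}u/z)\prod_{s>j}g_s$, where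 $g_s=\psi(q_1^{\lambda_s-\lambda_j-1}q_3^{s-j})$ if $\lambda_s+i\equiv s+k$, $g_s=\psi(q_1^{\lambda_j-\lambda_s}q_3^{j-s})$ if $\lambda_s+i+1\equiv s+k$, and $g_s=1$ otherwise. All other matrix coefficients of $E_i(z),F_i(z)$ vanish. All congruences are modulo $n$. The infinite products are understood as finite ones: for any $r$ with $\lambda_r=0$ and $i\equiv r+k$ the product of all factors with $s\ge r$ is replaced by $1$, since these factors cancel in pairs by $\psi(q_2w)\psi(1/w)=1$. On $\mathcal F^{(k)}(u)\otimes\mathcal F^{(l)}(v)$, with basis $|\lambda\rangle\otimes|\mu\rangle$, let $\mathcal E_n$ act by $$\Delta K_i^\pm(z)=K_i^\pm(z)\otimes K_i^\pm(z),\quad \Delta E_i(z)=E_i(z)\otimes1+K_i^-(z)\otimes E_i(z),\quad \Delta F_i(z)=F_i(z)\otimes K_i^+(z)+1\otimes F_i(z),$$ where a product of a rational function $f(z)$ and $c\,\delta(x/z)$ with $c\ne0$ is well defined if and only if $f$ has no pole at $x$, and then equals $cf(x)\delta(x/z)$. The action is well defined on the span of a set of basis vectors if all matrix coefficients of $\Delta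 E_i(z)$, $\Delta F_i(z)$ on these vectors are well defined. A module is weighted if the $K_i^\pm(z)$ are simultaneously diagonalizable on it, and tame if moreover their joint spectrum is simple. It is a lowest weight module if it is generated by a nonzero joint eigenvector of the $K_i^\pm(z)$ that is killed by all $F_{i,r}$. It has level $c$ if $\prod_iK_i^{-1}$ acts by $c$. It is quasi-finite if it is weighted and has a $\mathbb Z^n$-grading, compatible with $\deg E_i(z)=1_i$, $\deg F_i(z)=-1_i$, $\deg K_i^\pm(z)=0$, with finite-dimensional homogeneous components. Let $k,l\in\hat I$ and $u,v\in\mathbb C^\times$, and consider for $a,b\in\mathbb Z$ the condition $$(*)\qquad uq_2^{b+1}q_1^{b-a}=v,\qquad b-a\equiv k-l \pmod n.$$ Then: 1. The action on $\mathcal F^{(k)}(u)\otimes\mathcal F^{(l)}(v)$ is not well defined if and only if $(*)$ holds for some $a,b\in\mathbb Z$. 2. If it is well defined, then it makes $\mathcal F^{(k)}(u)\otimes\mathcal F^{(l)}(v)$ an irreducible, quasi-finite, lowest weight $\mathcal E_n$-module of level $q^2$. 3. If $(*)$ holds with $a\ge0$ and $b\ge0$, then the action is well defined on the subspace with basis the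 vectors $|\lambda\rangle\otimes|\mu\rangle$ such that $\lambda_i\ge\mu_{i+b}-a$ for $i=1,2,\dots$, it preserves this subspace, and it makes it an irreducible, quasi-finite, tame, lowest weight $\mathcal E_n$-module of level $q^2$. -/

import Mathlib

noncomputable section

open scoped TensorProduct

/-! ## The quantum toroidal algebra of type gl_n with trivial central element q^c = 1 -/

/-- Generators `E_{i,k}`, `F_{i,k}`, `H_{i,l}` (`l ≠ 0`), `K_i`, `K_i⁻¹`; the colour `i` is cyclic
modulo `n`. -/
inductive ToroidalGen (n : ℕ) : Type
  | E (i : ZMod n) (k : ℤ)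
  | F (i : ZMod n) (k : ℤ)
  | H (i : ZMod n) (l : {l : ℤ // l ≠ 0})
  | K (i : ZMod n)
  | Kinv (i : ZMod n)

/-- The Cartan matrix of type `A^{(1)}_{n-1}` (for `n ≥ 3`). -/
def cartanA {n : ℕ} (i j : ZMod n) : ℤ :=
  if i = j then 2 else if j = i + 1 ∨ i = j + 1 then -1 else 0

/-- The skew matrix with `m_{i-1,i} = -1`, `m_{i,i-1} = 1` and zeros elsewhere. -/
def skewM {n : ℕ} (i j : ZMod n) : ℤ :=
  if j = i + 1 then -1 else if i = j + 1 then 1 else 0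

/-- The coefficient of `x^r` in `exp (∑_{k ≥ 1} h_k x^k)`; the value `h 0` is not used. -/
def expCoeff {A : Type*} [Ring A] [Algebra ℂ A] (h : ℕ → A) (r : ℕ) : A :=
  ∑ m ∈ Finset.range (r + 1),
    ((m.factorial : ℂ)⁻¹) • PowerSeries.coeff r ((PowerSeries.mk fun k => if k = 0 then 0 else h k) ^ m)

/-- Currents in the free algebra.  A family `X : ℤ → A` stands for `X(z) = ∑_k X_k z^{-k}`. -/
def freeE {n : ℕ} (i : ZMod n) (k : ℤ) : FreeAlgebra ℂ (ToroidalGen n) :=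
  FreeAlgebra.ι ℂ (ToroidalGen.E i k)

def freeF {n : ℕ} (i : ZMod n) (k : ℤ) : FreeAlgebra ℂ (ToroidalGen n) :=
  FreeAlgebra.ι ℂ (ToroidalGen.F i k)

def freeH {n : ℕ} (i : ZMod n) (l : ℤ) : FreeAlgebra ℂ (ToroidalGen n) :=
  if hl : l ≠ 0 then FreeAlgebra.ι ℂ (ToroidalGen.H i ⟨l, hl⟩) else 0

def freeK {n : ℕ} (i : ZMod n) : FreeAlgebra ℂ (ToroidalGen n) :=
  FreeAlgebra.ι ℂ (ToroidalGen.K i)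

def freeKinv {n : ℕ} (i : ZMod n) : FreeAlgebra ℂ (ToroidalGen n) :=
  FreeAlgebra.ι ℂ (ToroidalGen.Kinv i)

/-- The coefficient of `z^{-r}`, `r ∈ ℤ`, in
`K_i^±(z) = K_i^{±1} exp (± (q - q⁻¹) ∑_{k ≥ 1} H_{i,±k} z^{∓k})`; the sign is `+` for `true` and
`-` for `false`. -/
def freeKcur {n : ℕ} (q : ℂ) (ε : Bool) (i : ZMod n) (r : ℤ) : FreeAlgebra ℂ (ToroidalGen n) :=
  match ε with
  | true =>
      if 0 ≤ r then freeK i * expCoeff (fun k => (q - q⁻¹) • freeH i (k : ℤ)) r.toNat else 0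
  | false =>
      if r ≤ 0 then
        freeKinv i * expCoeff (fun k => (-(q - q⁻¹)) • freeH i (-(k : ℤ))) (-r).toNat
      else 0

/-- The defining relations, written coefficient by coefficient (the coefficient of
`z^{-r} w^{-s}` of each identity of formal series). -/
inductive ToroidalRel (n : ℕ) (q d : ℂ) :
    FreeAlgebra ℂ (ToroidalGen n) → FreeAlgebra ℂ (ToroidalGen n) → Prop
  | K_Kinv (i : ZMod n) : ToroidalRel n q d (freeK i * freeKinv i) 1
  | Kinv_K (i : ZMod n) : ToroidalRel n q d (freeKinv i * freeK i) 1
  | K_K (ε ε' : Bool) (i j : ZMod n) (r s : ℤ) : ToroidalRel n q d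
      (freeKcur q ε i r * freeKcur q ε' j s) (freeKcur q ε' j s * freeKcur q ε i r)
  | K_E (ε : Bool) (i j : ZMod n) (r s : ℤ) : ToroidalRel n q d
      (q ^ cartanA i j • (freeKcur q ε i r * freeE j (s + 1))
        - d ^ skewM i j • (freeKcur q ε i (r + 1) * freeE j s))
      (freeE j (s + 1) * freeKcur q ε i r
        - (d ^ skewM i j * q ^ cartanA i j) • (freeE j s * freeKcur q ε i (r + 1)))
  | K_F (ε : Bool) (i j : ZMod n) (r s : ℤ) : ToroidalRel n q d
      (freeKcur q ε i r * freeF j (s + 1)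
        - (d ^ skewM i j * q ^ cartanA i j) • (freeKcur q ε i (r + 1) * freeF j s))
      (q ^ cartanA i j • (freeF j (s + 1) * freeKcur q ε i r)
        - d ^ skewM i j • (freeF j s * freeKcur q ε i (r + 1)))
  | E_F (i j : ZMod n) (r s : ℤ) : ToroidalRel n q d
      (freeE i r * freeF j s - freeF j s * freeE i r)
      (if i = j then
        (q - q⁻¹)⁻¹ • (freeKcur q true i (r + s) - freeKcur q false i (r + s)) else 0)
  | E_E (i j : ZMod n) (r s : ℤ) : ToroidalRel n q d
      (d ^ skewM i j • (freeE i (r + 1) * freeE j s)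
        - q ^ cartanA i j • (freeE i r * freeE j (s + 1)))
      ((d ^ skewM i j * q ^ cartanA i j) • (freeE j s * freeE i (r + 1))
        - freeE j (s + 1) * freeE i r)
  | F_F (i j : ZMod n) (r s : ℤ) : ToroidalRel n q d
      (d ^ skewM i j • (freeF i (r + 1) * freeF j s)
        - q ^ (-cartanA i j) • (freeF i r * freeF j (s + 1)))
      ((d ^ skewM i j * q ^ (-cartanA i j)) • (freeF j s * freeF i (r + 1))
        - freeF j (s + 1) * freeF i r)
  | E_serre (i j : ZMod n) (hij : j = i + 1 ∨ i = j + 1) (r₁ r₂ s : ℤ) : ToroidalRel n q d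
      ((freeE i r₁ * freeE i r₂ * freeE j s
          - (q + q⁻¹) • (freeE i r₁ * freeE j s * freeE i r₂)
          + freeE j s * freeE i r₁ * freeE i r₂)
        + (freeE i r₂ * freeE i r₁ * freeE j s
          - (q + q⁻¹) • (freeE i r₂ * freeE j s * freeE i r₁)
          + freeE j s * freeE i r₂ * freeE i r₁)) 0
  | F_serre (i j : ZMod n) (hij : j = i + 1 ∨ i = j + 1) (r₁ r₂ s : ℤ) : ToroidalRel n q d
      ((freeF i r₁ * freeF i r₂ * freeF j s
          - (q + q⁻¹) • (freeF i r₁ * freeF j s * freeF i r₂)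
          + freeF j s * freeF i r₁ * freeF i r₂)
        + (freeF i r₂ * freeF i r₁ * freeF j s
          - (q + q⁻¹) • (freeF i r₂ * freeF j s * freeF i r₁)
          + freeF j s * freeF i r₂ * freeF i r₁)) 0
  | E_comm (i j : ZMod n) (h : i ≠ j) (h₁ : j ≠ i + 1) (h₂ : i ≠ j + 1) (r s : ℤ) :
      ToroidalRel n q d (freeE i r * freeE j s) (freeE j s * freeE i r)
  | F_comm (i j : ZMod n) (h : i ≠ j) (h₁ : j ≠ i + 1) (h₂ : i ≠ j + 1) (r s : ℤ) :
      ToroidalRel n q d (freeF i r * freeF j s) (freeF j s * freeF i r)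

/-- The quantum toroidal algebra `𝓔_n(q, d)`, i.e. the quotient by `q^{±c/2} = 1`. -/
abbrev QToroidal (n : ℕ) (q d : ℂ) : Type := RingQuot (ToroidalRel n q d)

namespace QToroidal

variable {n : ℕ} {q d : ℂ}

def E (i : ZMod n) (k : ℤ) : QToroidal n q d := RingQuot.mkAlgHom ℂ _ (freeE i k)

def F (i : ZMod n) (k : ℤ) : QToroidal n q d := RingQuot.mkAlgHom ℂ _ (freeF i k)

/-- The coefficient of `z^{-r}` in `K_i^±(z)`. -/
def Kcur (ε : Bool) (i : ZMod n) (r : ℤ) : QToroidal n q d :=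
  RingQuot.mkAlgHom ℂ _ (freeKcur q ε i r)

/-- `K_i^{-1}`. -/
def Kinv (i : ZMod n) : QToroidal n q d := RingQuot.mkAlgHom ℂ _ (freeKinv i)

/-- The element `κ⁻¹ = ∏_i K_i⁻¹` (the factors commute). -/
def kappaInv : QToroidal n q d :=
  ((List.range n).map fun i : ℕ => (Kinv (i : ZMod n) : QToroidal n q d)).prod

end QToroidal

/-- Genericity of `q₁ = d/q`, `q₂ = q²`, `q₃ = 1/(dq)`. -/
def GenericParams (q d : ℂ) : Prop :=
  ∀ a b c : ℤ, (d / q) ^ a * (q ^ 2) ^ b * (1 / (d * q)) ^ c = 1 → a = b ∧ b = c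

/-! ## Notions for modules over the quantum toroidal algebra, given as representations -/

section Modules

variable {n : ℕ} {q d : ℂ} {V : Type*} [AddCommMonoid V] [Module ℂ V]

def IsInvariantSubspace (ρ : QToroidal n q d →ₐ[ℂ] Module.End ℂ V) (W : Submodule ℂ V) : Prop :=
  ∀ x : QToroidal n q d, ∀ w ∈ W, ρ x w ∈ W

def IsIrreducibleRep (ρ : QToroidal n q d →ₐ[ℂ] Module.End ℂ V) : Prop :=
  Nontrivial V ∧ ∀ W : Submodule ℂ V, IsInvariantSubspace ρ W → W = ⊥ ∨ W = ⊤

/-- `v` has weight `φ`: `K_i^±(z) v = φ_i^±(z) v`, where `φ ε i r` is the coefficient of `z^{-r}`. -/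
def HasWeight (ρ : QToroidal n q d →ₐ[ℂ] Module.End ℂ V) (φ : Bool → ZMod n → ℤ → ℂ) (v : V) :
    Prop :=
  ∀ (ε : Bool) (i : ZMod n) (r : ℤ), ρ (QToroidal.Kcur ε i r) v = φ ε i r • v

/-- The commuting series `K_i^±(z)` are simultaneously diagonalizable. -/
def IsWeighted (ρ : QToroidal n q d →ₐ[ℂ] Module.End ℂ V) : Prop :=
  Submodule.span ℂ {v : V | ∃ φ, HasWeight ρ φ v} = ⊤

/-- Weighted, with simple joint spectrum. -/
def IsTame (ρ : QToroidal n q d →ₐ[ℂ] Module.End ℂ V) : Prop :=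
  IsWeighted ρ ∧ ∀ (φ : Bool → ZMod n → ℤ → ℂ) (v w : V),
    HasWeight ρ φ v → HasWeight ρ φ w → v ≠ 0 → ∃ c : ℂ, w = c • v

/-- Killed by all the coefficients of the `F_i(z)`. -/
def IsSingular (ρ : QToroidal n q d →ₐ[ℂ] Module.End ℂ V) (v : V) : Prop :=
  ∀ (i : ZMod n) (r : ℤ), ρ (QToroidal.F i r) v = 0

/-- Generated by a nonzero singular weight vector. -/
def IsLowestWeight (ρ : QToroidal n q d →ₐ[ℂ] Module.End ℂ V) : Prop :=
  ∃ v : V, v ≠ 0 ∧ IsSingular ρ v ∧ (∃ φ, HasWeight ρ φ v) ∧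
    ∀ W : Submodule ℂ V, IsInvariantSubspace ρ W → v ∈ W → W = ⊤

def HasLevel (ρ : QToroidal n q d →ₐ[ℂ] Module.End ℂ V) (c : ℂ) : Prop :=
  ∀ v : V, ρ QToroidal.kappaInv v = c • v

open Classical in
/-- Weighted, and `ℤ^n`-graded (compatibly with `deg E_i(z) = 1_i`, `deg F_i(z) = -1_i`,
`deg K_i^±(z) = 0`) with finite-dimensional homogeneous components. -/
def IsQuasiFinite (ρ : QToroidal n q d →ₐ[ℂ] Module.End ℂ V) : Prop :=
  IsWeighted ρ ∧ ∃ gr : (ZMod n → ℤ) → Submodule ℂ V,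
    DirectSum.IsInternal gr ∧
    (∀ δ, ∀ v ∈ gr δ, ∀ (i : ZMod n) (r : ℤ),
      ρ (QToroidal.E i r) v ∈ gr (δ + Pi.single i 1) ∧
      ρ (QToroidal.F i r) v ∈ gr (δ - Pi.single i 1) ∧
      ∀ ε : Bool, ρ (QToroidal.Kcur ε i r) v ∈ gr δ) ∧
    ∀ δ, Module.Finite ℂ (gr δ)

end Modules

/-! ## Finite sums of delta functions and their products with rational functions -/

/-- A finite sum `∑_x c_x δ(x/z)`, where `δ(x/z) = ∑_{r ∈ ℤ} x^r z^{-r}`, given by `x ↦ c_x`. -/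
abbrev DeltaSum : Type := ℂ →₀ ℂ

/-- The product `f(z) D(z)` is well defined if and only if the rational function `f` has no pole at
any of the points that occur in `D` with nonzero coefficient (`denom` is coprime to `num`). -/
def MulWellDefined (f : RatFunc ℂ) (D : DeltaSum) : Prop :=
  ∀ x ∈ D.support, f.denom.eval x ≠ 0

/-- The coefficient of `z^{-r}` in `f(z) D(z)`, by `f(z) δ(x/z) = f(x) δ(x/z)`. -/
def mulCoeff (f : RatFunc ℂ) (D : DeltaSum) (r : ℤ) : ℂ :=
  D.sum fun x c => f.eval (RingHom.id ℂ) x * c * x ^ r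

/-- The coefficient of `z^{-r}` in `D(z)`. -/
def deltaCoeff (D : DeltaSum) (r : ℤ) : ℂ := D.sum fun x c => c * x ^ r

/-! ## Fock modules -/

/-- Partitions `λ_1 ≥ λ_2 ≥ ⋯` with finitely many nonzero parts; the part `λ_s` is `lam.1 (s - 1)`. -/
abbrev Partn : Type := {f : ℕ →₀ ℕ // Antitone f}

/-- The number of nonzero parts. -/
def Partn.len (lam : Partn) : ℕ := lam.1.support.card

/-- `ψ(w) = (q - q⁻¹ w) / (1 - w)`, for numbers and for rational functions. -/
def psi {F : Type*} [Field F] (q w : F) : F := (q - q⁻¹ * w) / (1 - w)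

section Fock

variable {n : ℕ} (q d : ℂ) (k : ZMod n) (u : ℂ)

/-- A number `N` with `N > len λ` and `N + 1 ≡ i - k`.  Beyond the first `N` rows the factors of
the infinite products below cancel in pairs by `ψ(q₂ w) ψ(1/w) = 1`. -/
def rowCut (i : ZMod n) (lam : Partn) : ℕ := n * (lam.len + 1) + (i - k - 1).val

/-- The eigenvalue of `K_i(z)` on `|λ⟩` in `𝓕^{(k)}(u)`, with a rational function inserted for `z`:
`∏_{λ_s + i ≡ s + k} ψ(q₁^{λ_s-1} q₃^{s-1} u/z) ∏_{λ_s + i + 1 ≡ s + k} ψ(q₁^{λ_s-1} q₃^{s-2} u/z)⁻¹`.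
Row `s ≥ 1` has the index `s - 1` here. -/
def fockK (i : ZMod n) (lam : Partn) (z : RatFunc ℂ) : RatFunc ℂ :=
  ∏ s ∈ Finset.range (rowCut k i lam),
    ((if (lam.1 s : ZMod n) + i = ((s + 1 : ℕ) : ZMod n) + k then
        psi (RatFunc.C q)
          (RatFunc.C ((d / q) ^ ((lam.1 s : ℤ) - 1) * (1 / (d * q)) ^ (s : ℤ) * u) / z)
      else 1) *
     (if (lam.1 s : ZMod n) + i + 1 = ((s + 1 : ℕ) : ZMod n) + k then
        (psi (RatFunc.C q)
          (RatFunc.C ((d / q) ^ ((lam.1 s : ℤ) - 1) * (1 / (d * q)) ^ ((s : ℤ) - 1) * u) / z))⁻¹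
      else 1))

/-- The factor of row `s` in the matrix coefficients of `E_i(z)`, `F_i(z)` that add a box to,
respectively remove it from, row `j`; `lam` is the partition without the box. -/
def rowFactor (i : ZMod n) (lam : Partn) (j s : ℕ) : ℂ :=
  (if (lam.1 s : ZMod n) + i = ((s + 1 : ℕ) : ZMod n) + k then
      psi q ((d / q) ^ ((lam.1 s : ℤ) - lam.1 j - 1) * (1 / (d * q)) ^ ((s : ℤ) - j))
    else 1) *
  (if (lam.1 s : ZMod n) + i + 1 = ((s + 1 : ℕ) : ZMod n) + k then
      psi q ((d / q) ^ ((lam.1 j : ℤ) - lam.1 s) * (1 / (d * q)) ^ ((j : ℤ) - s))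
    else 1)

/-- `lam' = lam + 1_j`, where the added box has colour `i`. -/
def IsAddBox (i : ZMod n) (lam lam' : Partn) (j : ℕ) : Prop :=
  lam'.1 = lam.1 + Finsupp.single j 1 ∧ (lam.1 j : ZMod n) + i + 1 = ((j + 1 : ℕ) : ZMod n) + k

open Classical in
/-- The matrix coefficient `⟨lam'| E_i(z) |lam⟩`; at most one `j` contributes. -/
def fockE (i : ZMod n) (lam' lam : Partn) : DeltaSum :=
  ∑ j ∈ lam'.1.support,
    if IsAddBox k i lam lam' j then
      Finsupp.single ((d / q) ^ (lam.1 j : ℤ) * (1 / (d * q)) ^ (j : ℤ) * u)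
        (∏ s ∈ Finset.range j, rowFactor q d k i lam j s)
    else 0

open Classical in
/-- The matrix coefficient `⟨lam| F_i(z) |lam'⟩`; at most one `j` contributes. -/
def fockF (i : ZMod n) (lam lam' : Partn) : DeltaSum :=
  ∑ j ∈ lam'.1.support,
    if IsAddBox k i lam lam' j then
      Finsupp.single ((d / q) ^ (lam.1 j : ℤ) * (1 / (d * q)) ^ (j : ℤ) * u)
        (∏ s ∈ Finset.Ico (j + 1) (rowCut k i lam), rowFactor q d k i lam j s)
    else 0

end Fock

/-- The underlying vector space of a Fock module, with basis `|λ⟩`. -/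
abbrev FockSpace : Type := Partn →₀ ℂ

/-! ## Tensor products of two Fock modules -/

/-- `|λ⟩ ⊗ |μ⟩` for `p = (λ, μ)`. -/
def ket (p : Partn × Partn) : FockSpace ⊗[ℂ] FockSpace :=
  Finsupp.single p.1 1 ⊗ₜ[ℂ] Finsupp.single p.2 1

/-- The coefficient of a vector at `|λ'⟩ ⊗ |μ'⟩`. -/
def bra (p' : Partn × Partn) (x : FockSpace ⊗[ℂ] FockSpace) : ℂ :=
  finsuppTensorFinsupp' ℂ Partn Partn x p'

/-- The subspace with basis `|λ⟩ ⊗ |μ⟩`, `(λ, μ) ∈ S`. -/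
def ketSpan (S : Set (Partn × Partn)) : Submodule ℂ (FockSpace ⊗[ℂ] FockSpace) :=
  Submodule.span ℂ (ket '' S)

/-- For `S = Set.univ` this is the whole tensor product. -/
theorem ketSpan_univ : ketSpan Set.univ = ⊤ := by
  rw [eq_top_iff, ← TensorProduct.span_tmul_eq_top, Submodule.span_le]
  rintro _ ⟨x, y, rfl⟩
  induction x using Finsupp.induction_linear with
  | zero => simp
  | add f g hf hg => rw [TensorProduct.add_tmul]; exact Submodule.add_mem _ hf hg
  | single a r =>
    induction y using Finsupp.induction_linear with
    | zero => simp
    | add f g hf hg => rw [TensorProduct.tmul_add]; exact Submodule.add_mem _ hf hg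
    | single b s =>
      have h : (Finsupp.single a r ⊗ₜ[ℂ] Finsupp.single b s : FockSpace ⊗[ℂ] FockSpace)
          = (r * s) • ket (a, b) := by
        have h1 : (Finsupp.single a r : FockSpace) = r • Finsupp.single a 1 := by simp
        have h2 : (Finsupp.single b s : FockSpace) = s • Finsupp.single b 1 := by simp
        rw [h1, h2, TensorProduct.smul_tmul_smul, ket]
      rw [h]
      exact Submodule.smul_mem _ _ (Submodule.subset_span ⟨(a, b), Set.mem_univ _, rfl⟩)

def ketIn (S : Set (Partn × Partn)) (p : S) : ketSpan S :=
  ⟨ket p, Submodule.subset_span ⟨p, p.2, rfl⟩⟩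

section Tensor

variable {n : ℕ} (q d : ℂ) (k l : ZMod n) (u v : ℂ)

/-- The matrix coefficients of
`Δ(E_i(z)) = E_i(z) ⊗ 1 + K_i^-(z) ⊗ E_i(z)` and `Δ(F_i(z)) = F_i(z) ⊗ K_i^+(z) + 1 ⊗ F_i(z)`
on `|λ⟩ ⊗ |μ⟩`, `(λ, μ) ∈ S`, in `𝓕^{(k)}(u) ⊗ 𝓕^{(l)}(v)` are well defined. -/
def DeltaWellDefinedOn (S : Set (Partn × Partn)) : Prop :=
  ∀ p ∈ S, ∀ i : ZMod n,
    (∀ mu' : Partn, MulWellDefined (fockK q d k u i p.1 RatFunc.X) (fockE q d l v i mu' p.2)) ∧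
    (∀ lam' : Partn, MulWellDefined (fockK q d l v i p.2 RatFunc.X) (fockF q d k u i lam' p.1))

open Classical in
/-- The coefficient of `z^{-r}` in `⟨λ' ⊗ μ'| Δ(E_i(z)) |λ ⊗ μ⟩`. -/
def deltaE (i : ZMod n) (r : ℤ) (p' p : Partn × Partn) : ℂ :=
  (if p'.2 = p.2 then deltaCoeff (fockE q d k u i p'.1 p.1) r else 0) +
  (if p'.1 = p.1 then mulCoeff (fockK q d k u i p.1 RatFunc.X) (fockE q d l v i p'.2 p.2) r else 0)

open Classical in
/-- The coefficient of `z^{-r}` in `⟨λ' ⊗ μ'| Δ(F_i(z)) |λ ⊗ μ⟩`. -/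
def deltaF (i : ZMod n) (r : ℤ) (p' p : Partn × Partn) : ℂ :=
  (if p'.2 = p.2 then mulCoeff (fockK q d l v i p.2 RatFunc.X) (fockF q d k u i p'.1 p.1) r else 0) +
  (if p'.1 = p.1 then deltaCoeff (fockF q d l v i p'.2 p.2) r else 0)

/-- The coefficient of `z^{-r}` in the eigenvalue of `Δ(K_i^±(z)) = K_i^±(z) ⊗ K_i^±(z)` on
`|λ⟩ ⊗ |μ⟩`: the rational function is expanded at `z = ∞` for the sign `+` (in `X = 1/z`), and at
`z = 0` for the sign `-` (in `X = z`). -/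
def deltaK (ε : Bool) (i : ZMod n) (r : ℤ) (p : Partn × Partn) : ℂ :=
  match ε with
  | true =>
      ((fockK q d k u i p.1 (RatFunc.X⁻¹) * fockK q d l v i p.2 (RatFunc.X⁻¹) : RatFunc ℂ) :
        LaurentSeries ℂ).coeff r
  | false =>
      ((fockK q d k u i p.1 RatFunc.X * fockK q d l v i p.2 RatFunc.X : RatFunc ℂ) :
        LaurentSeries ℂ).coeff (-r)

/-- The currents act in the representation `ρ` on `ketSpan S` by the comultiplication. -/
def ActsByDelta (S : Set (Partn × Partn))
    (ρ : QToroidal n q d →ₐ[ℂ] Module.End ℂ (ketSpan S)) : Prop :=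
  ∀ p : S, ∀ (i : ZMod n) (r : ℤ),
    (∀ p' : Partn × Partn,
      bra p' (ρ (QToroidal.E i r) (ketIn S p)) = deltaE q d k l u v i r p' p ∧
      bra p' (ρ (QToroidal.F i r) (ketIn S p)) = deltaF q d k l u v i r p' p) ∧
    ∀ ε : Bool, ρ (QToroidal.Kcur ε i r) (ketIn S p) = deltaK q d k l u v ε i r p • ketIn S p

/-- `v = u q₂^{b+1} q₁^{b-a}` and `b - a ≡ k - l`. -/
def Resonance (a b : ℤ) : Prop :=
  u * (q ^ 2) ^ (b + 1) * (d / q) ^ (b - a) = v ∧ ((b - a : ℤ) : ZMod n) = k - l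

end Tensor

/-- The pairs of partitions with `λ_i ≥ μ_{i+b} - a` for `i = 1, 2, …`. -/
def interlacing (a b : ℕ) : Set (Partn × Partn) :=
  {p | ∀ i : ℕ, (p.2.1 (i + b) : ℤ) - a ≤ p.1.1 i}

end

noncomputable section

open scoped TensorProduct

/-! Pairs of partitions are read as finite sets of boxes in two layers. A box has a colour, and its
location is q₁^column q₃^row times the parameter of its layer. Since q₁q₂q₃ = 1, a resonance says
that the second layer, moved by (-a-1, -b-1), lies on the grid of the first (`resonance_iff`).
Genericity makes locations faithful coordinates, and boxes of different layers can be related only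
through a resonance (`TensorData.site_step`). The set of all pairs and the set of interlacing pairs
are both closed under unions and intersections. They are treated together in `pairSet`, where the
proposition `L` tells whether a resonance is present.

Abstract part. E_i(z) and F_i(z) are sums of delta functions times operators that add or remove one
box. The relation for [E, F] says that K⁺ - K⁻ has residues ±ef at the corners. Adding a box
multiplies K by a known factor, so comparing residues before and after (`BoxModel.res_cov`) relates
the products ef of different configurations. Adding one box commutes with removing another, and this
turns the comparison into exchange relations for e and f separately (`BoxModel.IsExchange.e_mul`).
Where only one order of adding two boxes is possible, the exchange factor in front of it vanishes.
The Serre relations follow from the exchange relations by linear algebra (`serre_of_exchange`),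
except for a wheel of three boxes, which can never be added to a configuration. The weights separate
the configurations, so an invariant subspace is spanned by basis vectors, and nonvanishing of e and
f connects each of them to the vacuum in both directions.

Concrete part. The product over rows defining K_i(z) telescopes to a product over corners
(`prod_rowFac_eq`). At a corner in row j only that row has a pole: the rows above give the
coefficient of E, those below the coefficient of F (`hasVal_fockK_residue`). In the tensor product
one of the two coefficients acquires the value of K on the other layer. This value is finite because
corners of different layers never share colour and location (`TensorData.corner_inj`), and it
vanishes exactly when the move leaves the set (`TensorData.first_zero_iff`,
`TensorData.second_zero_iff`). Partial fractions give K⁺ - K⁻ (`coeff_prod_linear`,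
`TensorData.exists_residues`). Distinct pairs have distinct weights because a first box in which
they differ can be detected in K (`TensorData.pairK_ne_of_min`).

Conversely, under a resonance with arbitrary integers a, b there are two partitions whose addable
boxes have the same location and colour, so a pole of K meets a delta function
(`not_wellDefined_of_resonance`). -/

/-! ## Distributive lattices of finite sets of boxes -/

/-- A family of finite sets of boxes that is closed under unions and intersections and in which
every member is reached from the empty set by adding boxes one by one. -/
structure BoxLattice (P β : Type*) [DecidableEq β] where
  cells : P → Finset β
  cells_injective : Function.Injective cells
  exists_union : ∀ p p', ∃ s, cells s = cells p ∪ cells p'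
  exists_inter : ∀ p p', ∃ s, cells s = cells p ∩ cells p'
  adds : P → Finset β
  mem_adds : ∀ p b, b ∈ adds p ↔ b ∉ cells p ∧ ∃ p', cells p' = insert b (cells p)
  vac : P
  cells_vac : cells vac = ∅
  exists_rem : ∀ p, p ≠ vac → ∃ p' b, b ∉ cells p' ∧ cells p = insert b (cells p')
  finite_card : ∀ N, {p | (cells p).card = N}.Finite

namespace BoxLattice

variable {P β : Type*} [DecidableEq β] (L : BoxLattice P β)

/-- `p'` is `p` with the box `b` added. -/
def Cov (p : P) (b : β) (p' : P) : Prop := b ∉ L.cells p ∧ L.cells p' = insert b (L.cells p)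

variable {L}

theorem Cov.unique_up {p p' p'' : P} {b : β} (h : L.Cov p b p') (h' : L.Cov p b p'') : p' = p'' :=
  L.cells_injective (h.2.trans h'.2.symm)

theorem Cov.cells_eq_erase {p p' : P} {b : β} (h : L.Cov p b p') :
    L.cells p = (L.cells p').erase b := by
  rw [h.2, Finset.erase_insert h.1]

theorem Cov.unique_down {p p' p'' : P} {b : β} (h : L.Cov p b p'') (h' : L.Cov p' b p'') :
    p = p' :=
  L.cells_injective (h.cells_eq_erase.trans h'.cells_eq_erase.symm)

theorem Cov.box_eq {p p' : P} {b b' : β} (h : L.Cov p b p') (h' : L.Cov p b' p') : b = b' := by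
  have h1 : b ∈ L.cells p' := by rw [h.2]; exact Finset.mem_insert_self _ _
  rw [h'.2, Finset.mem_insert] at h1
  exact h1.resolve_right h.1

/-- The top of the diamond is the union of its two sides. Together with its dual, which uses
intersections, this is the only way in which distributivity enters. -/
theorem diamond_up {p pa pb : P} {a b : β} (hab : a ≠ b) (ha : L.Cov p a pa) (hb : L.Cov p b pb) :
    ∃ s, L.Cov pa b s ∧ L.Cov pb a s := by
  obtain ⟨s, hs⟩ := L.exists_union pa pb
  refine ⟨s, ⟨?_, ?_⟩, ⟨?_, ?_⟩⟩
  · rw [ha.2, Finset.mem_insert]; exact fun h => h.elim (fun h => hab h.symm) hb.1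
  · rw [hs, ha.2, hb.2]; ext x; simp only [Finset.mem_union, Finset.mem_insert]; tauto
  · rw [hb.2, Finset.mem_insert]; exact fun h => h.elim hab ha.1
  · rw [hs, ha.2, hb.2]; ext x; simp only [Finset.mem_union, Finset.mem_insert]; tauto

theorem diamond_down {pa pb s : P} {a b : β} (hab : a ≠ b) (hb : L.Cov pa b s) (ha : L.Cov pb a s) :
    ∃ p, L.Cov p a pa ∧ L.Cov p b pb := by
  obtain ⟨p, hp⟩ := L.exists_inter pa pb
  have h1 := hb.cells_eq_erase
  have h2 := ha.cells_eq_erase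
  have hbs : b ∈ L.cells s := by rw [hb.2]; exact Finset.mem_insert_self _ _
  have has : a ∈ L.cells s := by rw [ha.2]; exact Finset.mem_insert_self _ _
  refine ⟨p, ⟨?_, ?_⟩, ⟨?_, ?_⟩⟩
  · rw [hp, h2]; simp
  · rw [hp, h1, h2]; ext x
    simp only [Finset.mem_inter, Finset.mem_insert, Finset.mem_erase]
    by_cases hx : x = a
    · subst hx; simp [hab, has]
    · simp [hx]
  · rw [hp, h1]; simp
  · rw [hp, h1, h2]; ext x
    simp only [Finset.mem_inter, Finset.mem_insert, Finset.mem_erase]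
    by_cases hx : x = b
    · subst hx; simp [hab.symm, hbs]
    · simp [hx]

variable (L)

theorem cov_of_mem_adds {p : P} {b : β} (h : b ∈ L.adds p) : ∃ p', L.Cov p b p' := by
  obtain ⟨h1, p', h2⟩ := (L.mem_adds p b).1 h
  exact ⟨p', h1, h2⟩

variable {L} in
theorem Cov.mem_adds {p p' : P} {b : β} (h : L.Cov p b p') : b ∈ L.adds p :=
  (L.mem_adds p b).2 ⟨h.1, p', h.2⟩

open Classical in
/-- The removable boxes. -/
def rems (p : P) : Finset β := (L.cells p).filter fun b => ∃ p', L.Cov p' b p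

theorem mem_rems {p : P} {b : β} : b ∈ L.rems p ↔ ∃ p', L.Cov p' b p := by
  classical
  rw [rems, Finset.mem_filter]
  refine ⟨fun h => h.2, fun h => ⟨?_, h⟩⟩
  obtain ⟨p', h'⟩ := h
  rw [h'.2]; exact Finset.mem_insert_self _ _

theorem not_mem_rems_of_mem_adds {p : P} {b : β} (h : b ∈ L.adds p) : b ∉ L.rems p := by
  rw [mem_rems]; rintro ⟨p', h'⟩
  exact ((L.mem_adds p b).1 h).1 (by rw [h'.2]; exact Finset.mem_insert_self _ _)

open Classical in
/-- Adding a box (the configuration itself if this is impossible). -/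
def up (p : P) (b : β) : P := if h : ∃ p', L.Cov p b p' then h.choose else p

open Classical in
/-- Removing a box (the configuration itself if this is impossible). -/
def dn (p : P) (b : β) : P := if h : ∃ p', L.Cov p' b p then h.choose else p

variable {L}

theorem Cov.up_eq {p p' : P} {b : β} (h : L.Cov p b p') : L.up p b = p' := by
  have hex : ∃ p', L.Cov p b p' := ⟨p', h⟩
  rw [up, dif_pos hex]
  exact hex.choose_spec.unique_up h

theorem Cov.dn_eq {p p' : P} {b : β} (h : L.Cov p b p') : L.dn p' b = p := by
  have hex : ∃ p, L.Cov p b p' := ⟨p, h⟩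
  rw [dn, dif_pos hex]
  exact hex.choose_spec.unique_down h

theorem Cov.card {p p' : P} {b : β} (h : L.Cov p b p') :
    (L.cells p').card = (L.cells p).card + 1 := by
  rw [h.2, Finset.card_insert_of_notMem h.1]

theorem vac_induction {motive : P → Prop} (h0 : motive L.vac)
    (hstep : ∀ p b p', L.Cov p b p' → motive p → motive p') (p : P) : motive p := by
  induction hN : (L.cells p).card generalizing p with
  | zero =>
    have : p = L.vac := L.cells_injective (by rw [Finset.card_eq_zero.1 hN, L.cells_vac])
    rw [this]; exact h0
  | succ N ih =>
    have hne : p ≠ L.vac := by rintro rfl; rw [L.cells_vac] at hN; simp at hN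
    obtain ⟨p', b, hb⟩ := L.exists_rem p hne
    have hc : L.Cov p' b p := hb
    refine hstep p' b p hc (ih p' ?_)
    have := hc.card; omega

end BoxLattice

/-- A lattice of box configurations with locations, colours, matrix coefficients `e p b` of adding
the box `b` to `p`, `f p b` of removing it again, and weights `Kc`. -/
structure BoxModel (n : ℕ) (q d : ℂ) (P β : Type*) [DecidableEq β] extends BoxLattice P β where
  loc : β → ℂ
  loc_ne : ∀ b, loc b ≠ 0
  col : β → ZMod n
  e : P → β → ℂ
  f : P → β → ℂ
  e_ne : ∀ {p b p'}, toBoxLattice.Cov p b p' → e p b ≠ 0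
  f_ne : ∀ {p b p'}, toBoxLattice.Cov p b p' → f p b ≠ 0
  -- This is [E, F] = 0 for two different boxes: adding `a` commutes with removing `b`.
  e_f_comm : ∀ {p pa pb s a b}, a ≠ b → toBoxLattice.Cov p a pa → toBoxLattice.Cov p b pb →
    toBoxLattice.Cov pa b s → toBoxLattice.Cov pb a s → e p a * f p b = f pa b * e pb a
  Kc : Bool → ZMod n → P → ℤ → ℂ
  Kc_true_neg : ∀ i p r, r < 0 → Kc true i p r = 0
  Kc_false_pos : ∀ i p r, 0 < r → Kc false i p r = 0
  Kc_zero_mul : ∀ i p, Kc true i p 0 * Kc false i p 0 = 1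
  Kc_cov : ∀ {p b p'}, toBoxLattice.Cov p b p' → ∀ ε i r,
    q ^ cartanA i (col b) * loc b * Kc ε i p' r - d ^ skewM i (col b) * Kc ε i p' (r + 1)
      = loc b * Kc ε i p r - d ^ skewM i (col b) * q ^ cartanA i (col b) * Kc ε i p (r + 1)
  Kc_cov_comm : ∀ {p b p'}, toBoxLattice.Cov p b p' → ∀ ε i r, cartanA i (col b) = 0 →
    Kc ε i p' r = Kc ε i p r
  Kc_sub : ∀ i p r, Kc true i p r - Kc false i p r = (q - q⁻¹) *
    ((∑ b ∈ toBoxLattice.rems p, if col b = i then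
        e (toBoxLattice.dn p b) b * f (toBoxLattice.dn p b) b * loc b ^ r else 0)
      - ∑ b ∈ toBoxLattice.adds p, if col b = i then e p b * f p b * loc b ^ r else 0)
  corner_inj : ∀ p b b', b ∈ adds p ∪ toBoxLattice.rems p → b' ∈ adds p ∪ toBoxLattice.rems p →
    col b = col b' → loc b = loc b' → b = b'
  -- If `b` becomes addable only after `a`, then K has no residue on `p` at the location and colour
  -- of `b`; this makes an exchange factor vanish.
  corner_forced : ∀ {p pa s a b}, toBoxLattice.Cov p a pa → toBoxLattice.Cov pa b s →
    b ∉ adds p → ∀ c ∈ adds p ∪ toBoxLattice.rems p, ¬ (col c = col b ∧ loc c = loc b)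
  -- Since q₂⁻¹ = q₁q₃, the box `a₂` is the diagonal successor of `a₁`, and `b` is one of the two
  -- boxes between them.
  wheel : ∀ p s a₁ a₂ b, col a₁ = col a₂ →
    (col b = col a₁ + 1 ∧ loc b = 1 / (d * q) * loc a₁ ∨
      col a₁ = col b + 1 ∧ loc b = d / q * loc a₁) →
    loc a₁ = q ^ 2 * loc a₂ → a₁ ∉ cells p → a₂ ∉ cells p → b ∉ cells p →
    cells s ≠ insert a₁ (insert a₂ (insert b (cells p)))
  weight_inj : ∀ p p', (∀ ε i r, Kc ε i p r = Kc ε i p' r) → p = p'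

/-! ### Independence of power sums; symmetry of the matrices a and m. -/

/-- By linearity the vanishing extends from powers to all polynomials, and the product of X - y'
over the other points isolates the coefficient at y. -/
theorem eq_zero_of_sum_mul_pow_eq_zero (Y : Finset ℂ) (c : ℂ → ℂ)
    (h : ∀ r : ℕ, ∑ y ∈ Y, c y * y ^ r = 0) : ∀ y ∈ Y, c y = 0 := by
  have hp : ∀ p : Polynomial ℂ, ∑ y ∈ Y, c y * p.eval y = 0 := by
    intro p
    induction p using Polynomial.induction_on' with
    | add p p' hp hp' => simp only [Polynomial.eval_add, mul_add, Finset.sum_add_distrib, hp, hp',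
        add_zero]
    | monomial r a =>
      simp only [Polynomial.eval_monomial]
      have := congrArg (a * ·) (h r)
      simp only [Finset.mul_sum, mul_zero] at this
      rw [← this]; exact Finset.sum_congr rfl fun y _ => by ring
  intro y hy
  have h1 := hp (∏ y' ∈ Y.erase y, (Polynomial.X - Polynomial.C y'))
  rw [Finset.sum_eq_single y] at h1
  · rw [Polynomial.eval_prod, mul_eq_zero] at h1
    refine h1.resolve_right (Finset.prod_ne_zero_iff.2 fun y' hy' => ?_)
    simp only [Polynomial.eval_sub, Polynomial.eval_X, Polynomial.eval_C]
    exact sub_ne_zero.2 (Finset.ne_of_mem_erase hy').symm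
  · intro z hz hzy
    rw [Polynomial.eval_prod, Finset.prod_eq_zero (Finset.mem_erase.2 ⟨hzy, hz⟩) (by simp), mul_zero]
  · exact fun h => absurd hy h

theorem cartanA_comm {n : ℕ} (i j : ZMod n) : cartanA i j = cartanA j i := by
  unfold cartanA; simp only [eq_comm (a := i) (b := j), or_comm]

/-- For n ≥ 3 one has 2 ≠ 0 modulo n, so the conditions j = i + 1 and i = j + 1 exclude each other.
-/
theorem skewM_comm {n : ℕ} (hn : 3 ≤ n) (i j : ZMod n) : skewM i j = - skewM j i := by
  have h2 : (2 : ZMod n) ≠ 0 := by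
    intro h
    have := (ZMod.natCast_eq_zero_iff 2 n).1 (by exact_mod_cast h)
    exact absurd (Nat.le_of_dvd (by norm_num) this) (by omega)
  unfold skewM
  by_cases h : j = i + 1
  · have : ¬ i = j + 1 := by
      intro h'; apply h2; linear_combination (-1 : ZMod n) * h - h'
    rw [if_pos h, if_neg this, if_pos h]
  · by_cases h' : i = j + 1 <;> simp [h, h']
    intro h''; exfalso; apply h; rw [h']; exact h''

theorem skewM_eq_zero {n : ℕ} {i j : ZMod n} (h : cartanA i j = 0) :
    skewM i j = 0 := by
  unfold cartanA at h; unfold skewM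
  split_ifs at h with _ h2
  · exact absurd h (by norm_num)
  · rw [if_neg fun h' => h2 (Or.inl h'), if_neg fun h' => h2 (Or.inr h')]

namespace BoxModel

open BoxLattice

variable {n : ℕ} {q d : ℂ} {P β : Type*} [DecidableEq β] (M : BoxModel n q d P β)

/-! ### Residues of the weights -/

/-- The coefficient of `δ(y/z)` in `(K_i^+(z) - K_i^-(z)) / (q - q⁻¹)` on `p`. -/
def res (p : P) (i : ZMod n) (y : ℂ) : ℂ :=
  (∑ b ∈ M.rems p, if M.col b = i ∧ M.loc b = y then M.e (M.dn p b) b * M.f (M.dn p b) b else 0)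
    - ∑ b ∈ M.adds p, if M.col b = i ∧ M.loc b = y then M.e p b * M.f p b else 0

theorem res_eq_zero {p : P} {i : ZMod n} {y : ℂ}
    (h : ∀ b ∈ M.adds p ∪ M.rems p, ¬ (M.col b = i ∧ M.loc b = y)) : M.res p i y = 0 := by
  rw [res, Finset.sum_eq_zero, Finset.sum_eq_zero, sub_zero]
  · intro b hb; rw [if_neg (h b (Finset.mem_union_left _ hb))]
  · intro b hb; rw [if_neg (h b (Finset.mem_union_right _ hb))]

/-- A corner is determined by its colour and location, so no other corner contributes; being
addable, `b` is not removable, and only the negative term is left. -/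
theorem res_of_cov {p p' : P} {b : β} (h : M.Cov p b p') :
    M.res p (M.col b) (M.loc b) = - (M.e p b * M.f p b) := by
  have hb := h.mem_adds
  rw [res, Finset.sum_eq_zero, Finset.sum_eq_single_of_mem b hb, if_pos ⟨rfl, rfl⟩, zero_sub]
  · intro c hc hcb
    rw [if_neg]
    rintro ⟨h1, h2⟩
    exact hcb (M.corner_inj p c b (Finset.mem_union_left _ hc) (Finset.mem_union_left _ hb) h1 h2)
  · intro c hc
    rw [if_neg]
    rintro ⟨h1, h2⟩
    have := M.corner_inj p c b (Finset.mem_union_right _ hc) (Finset.mem_union_left _ hb) h1 h2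
    subst this
    exact M.not_mem_rems_of_mem_adds hb hc

/-- The corners are grouped by location. The set `Y` is allowed to be too large so that two
configurations can be compared over the same points. -/
theorem Kc_sub_eq (p : P) (i : ZMod n) (r : ℤ) (Y : Finset ℂ)
    (hY : (M.adds p ∪ M.rems p).image M.loc ⊆ Y) :
    M.Kc true i p r - M.Kc false i p r = (q - q⁻¹) * ∑ y ∈ Y, M.res p i y * y ^ r := by
  rw [M.Kc_sub]
  congr 1
  have key : ∀ (s : Finset β) (g : β → ℂ), s.image M.loc ⊆ Y →
      ∑ b ∈ s, (if M.col b = i then g b * M.loc b ^ r else 0)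
        = ∑ y ∈ Y, (∑ b ∈ s, if M.col b = i ∧ M.loc b = y then g b else 0) * y ^ r := by
    intro s g hs
    simp only [Finset.sum_mul]
    rw [Finset.sum_comm]
    refine Finset.sum_congr rfl fun b hb => ?_
    rw [Finset.sum_eq_single_of_mem (M.loc b) (hs (Finset.mem_image_of_mem _ hb))]
    · by_cases h : M.col b = i <;> simp [h]
    · intro y _ hy
      rw [if_neg fun h => hy h.2.symm, zero_mul]
  rw [Finset.image_union, Finset.union_subset_iff] at hY
  rw [key _ (fun b => M.e (M.dn p b) b * M.f (M.dn p b) b) hY.2,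
    key _ (fun b => M.e p b * M.f p b) hY.1, ← Finset.sum_sub_distrib]
  refine Finset.sum_congr rfl fun y _ => ?_
  rw [res, sub_mul]

variable (hq : q - q⁻¹ ≠ 0)
include hq

/-- Equality of all nonnegative moments of two finite sums of delta functions is equality point by
point. -/
theorem res_relation {p p' : P} (A B : ℂ → ℂ) (i : ZMod n)
    (hAB : ∀ r : ℕ, ∀ Y : Finset ℂ, (M.adds p ∪ M.rems p).image M.loc ⊆ Y →
      (M.adds p' ∪ M.rems p').image M.loc ⊆ Y →
      (q - q⁻¹) * ∑ y ∈ Y, A y * M.res p' i y * y ^ r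
        = (q - q⁻¹) * ∑ y ∈ Y, B y * M.res p i y * y ^ r) (y : ℂ) :
    A y * M.res p' i y = B y * M.res p i y := by
  -- The point `y` is adjoined because it need not be the location of any corner.
  set Y : Finset ℂ := insert y ((M.adds p ∪ M.rems p).image M.loc ∪
    (M.adds p' ∪ M.rems p').image M.loc) with hYdef
  have h1 := eq_zero_of_sum_mul_pow_eq_zero Y
    (fun y => A y * M.res p' i y - B y * M.res p i y) (fun r => by
      have := hAB r Y (fun z hz => by simp only [hYdef, Finset.mem_insert, Finset.mem_union]; tauto)
        (fun z hz => by simp only [hYdef, Finset.mem_insert, Finset.mem_union]; tauto)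
      have := mul_left_cancel₀ hq this
      simp only [sub_mul, Finset.sum_sub_distrib]
      rw [this, sub_self]) y (Finset.mem_insert_self _ _)
  exact sub_eq_zero.1 h1

/-- On a delta function at `y`, a shift of the mode is multiplication by `y`. The recursion
`Kc_cov`, taken for the difference of the two expansions, thus becomes an identity of residues. -/
theorem res_cov {p p' : P} {a : β} (h : M.Cov p a p') (i : ZMod n) (y : ℂ) :
    (q ^ cartanA i (M.col a) * M.loc a - d ^ skewM i (M.col a) * y) * M.res p' i y
      = (M.loc a - d ^ skewM i (M.col a) * q ^ cartanA i (M.col a) * y) * M.res p i y := by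
  refine M.res_relation hq (fun y => q ^ cartanA i (M.col a) * M.loc a - d ^ skewM i (M.col a) * y)
    (fun y => M.loc a - d ^ skewM i (M.col a) * q ^ cartanA i (M.col a) * y) i ?_ y
  intro r Y hY hY'
  have h1 := M.Kc_cov h true i r
  have h2 := M.Kc_cov h false i r
  have e1 := M.Kc_sub_eq p i r Y hY
  have e2 := M.Kc_sub_eq p i (r + 1) Y hY
  have e3 := M.Kc_sub_eq p' i r Y hY'
  have e4 := M.Kc_sub_eq p' i (r + 1) Y hY'
  have h3 : q ^ cartanA i (M.col a) * M.loc a * ((q - q⁻¹) * ∑ y ∈ Y, M.res p' i y * y ^ (r : ℤ))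
      - d ^ skewM i (M.col a) * ((q - q⁻¹) * ∑ y ∈ Y, M.res p' i y * y ^ ((r : ℤ) + 1))
      = M.loc a * ((q - q⁻¹) * ∑ y ∈ Y, M.res p i y * y ^ (r : ℤ))
        - d ^ skewM i (M.col a) * q ^ cartanA i (M.col a)
          * ((q - q⁻¹) * ∑ y ∈ Y, M.res p i y * y ^ ((r : ℤ) + 1)) := by
    rw [← e1, ← e2, ← e3, ← e4]; linear_combination h1 - h2
  have key : ∀ (g : ℂ → ℂ) (s t : ℂ), ∑ y ∈ Y, (s - t * y) * g y * y ^ r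
      = s * ∑ y ∈ Y, g y * y ^ (r : ℤ) - t * ∑ y ∈ Y, g y * y ^ ((r : ℤ) + 1) := by
    intro g s t
    rw [Finset.mul_sum, Finset.mul_sum, ← Finset.sum_sub_distrib]
    refine Finset.sum_congr rfl fun y _ => ?_
    rw [← Nat.cast_succ, zpow_natCast, zpow_natCast, pow_succ]; ring
  rw [key, key]
  linear_combination h3

theorem res_cov_comm {p p' : P} {a : β} (h : M.Cov p a p') (i : ZMod n)
    (hi : cartanA i (M.col a) = 0) (y : ℂ) : M.res p' i y = M.res p i y := by
  have := M.res_relation hq (p := p) (p' := p') (fun _ => 1) (fun _ => 1) i ?_ y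
  · simpa using this
  intro r Y hY hY'
  simp only [one_mul]
  have e1 := M.Kc_sub_eq p i r Y hY
  have e2 := M.Kc_sub_eq p' i r Y hY'
  simp only [zpow_natCast] at e1 e2
  rw [← e1, ← e2, M.Kc_cov_comm h _ _ _ hi, M.Kc_cov_comm h _ _ _ hi]

omit hq

/-! ### Exchange of two boxes -/

/-- The factors `D`, `N` by which two operators that add the boxes `a`, `b` may be exchanged. -/
structure IsExchange (a b : β) (D N : ℂ) : Prop where
  left : ∀ {p pa}, M.Cov p a pa →
    D * M.res pa (M.col b) (M.loc b) = N * M.res p (M.col b) (M.loc b)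
  right : ∀ {p pb}, M.Cov p b pb →
    N * M.res pb (M.col a) (M.loc a) = D * M.res p (M.col a) (M.loc a)

variable {M}

theorem IsExchange.symm {a b : β} {D N : ℂ} (h : M.IsExchange a b D N) : M.IsExchange b a N D :=
  ⟨h.right, h.left⟩

/-- The residue at `b` is zero before `a` is added, by `corner_forced`, and afterwards it is -ef ≠
0; hence `D` has to vanish. -/
theorem IsExchange.eq_zero {a b : β} {D N : ℂ} (h : M.IsExchange a b D N) {p pa s : P}
    (ha : M.Cov p a pa) (hs : M.Cov pa b s) (hb : ∀ pb, ¬ M.Cov p b pb) : D = 0 := by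
  have h1 := h.left ha
  have hb' : b ∉ M.adds p := fun h => by
    obtain ⟨pb, hpb⟩ := M.cov_of_mem_adds h; exact hb pb hpb
  rw [M.res_eq_zero (M.corner_forced ha hs hb'), mul_zero, M.res_of_cov hs] at h1
  rcases mul_eq_zero.1 h1 with h1 | h1
  · exact h1
  · exact absurd h1 (neg_ne_zero.2 (mul_ne_zero (M.e_ne hs) (M.f_ne hs)))

/-- Residues see only the products ef. The factors f are eliminated by commuting the addition of `a`
with the removal of `b`, which leaves a common nonzero factor f to cancel. -/
theorem IsExchange.e_mul {a b : β} {D N : ℂ} (h : M.IsExchange a b D N) (hab : a ≠ b)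
    {p pa pb s : P} (ha : M.Cov p a pa) (hb : M.Cov p b pb) (has : M.Cov pa b s)
    (hbs : M.Cov pb a s) : D * (M.e p a * M.e pa b) = N * (M.e p b * M.e pb a) := by
  have h1 := h.left ha
  rw [M.res_of_cov has, M.res_of_cov hb] at h1
  have h2 := M.e_f_comm hab ha hb has hbs
  refine mul_right_cancel₀ (M.f_ne hb) ?_
  linear_combination (-M.e pb a) * h1 + D * M.e pa b * h2

theorem IsExchange.f_mul {a b : β} {D N : ℂ} (h : M.IsExchange a b D N) (hab : a ≠ b)
    {p pa pb s : P} (ha : M.Cov p a pa) (hb : M.Cov p b pb) (has : M.Cov pa b s)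
    (hbs : M.Cov pb a s) : D * (M.f p a * M.f pa b) = N * (M.f p b * M.f pb a) := by
  have h1 := h.left ha
  rw [M.res_of_cov has, M.res_of_cov hb] at h1
  have h2 := M.e_f_comm hab.symm hb ha hbs has
  refine mul_right_cancel₀ (M.e_ne hb) ?_
  linear_combination (-M.f pb a) * h1 + D * M.f pa b * h2

variable (M)
include hq

/-- Both halves are `res_cov`. In the second one the boxes are interchanged, and skew-symmetry of m
requires multiplication by a power of d to reach the same factors. -/
theorem isExchange (hn : 3 ≤ n) (hd : d ≠ 0) (a b : β) :
    M.IsExchange a b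
      (d ^ skewM (M.col b) (M.col a) * M.loc b - q ^ cartanA (M.col b) (M.col a) * M.loc a)
      (d ^ skewM (M.col b) (M.col a) * q ^ cartanA (M.col b) (M.col a) * M.loc b - M.loc a) := by
  refine ⟨fun {p pa} h => ?_, fun {p pb} h => ?_⟩
  · have := M.res_cov hq h (M.col b) (M.loc b)
    linear_combination -this
  · have := M.res_cov hq h (M.col a) (M.loc a)
    rw [cartanA_comm, skewM_comm hn (M.col a), zpow_neg] at this
    have hd' : d ^ skewM (M.col b) (M.col a) ≠ 0 := zpow_ne_zero _ hd
    have h2 := congrArg (d ^ skewM (M.col b) (M.col a) * ·) this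
    simp only [← mul_assoc, mul_sub, mul_inv_cancel₀ hd', one_mul] at h2
    linear_combination h2

theorem isExchange_one (a b : β) (h : cartanA (M.col b) (M.col a) = 0) :
    M.IsExchange a b 1 1 := by
  refine ⟨fun {p pa} h' => ?_, fun {p pb} h' => ?_⟩
  · rw [M.res_cov_comm hq h' _ h]
  · rw [M.res_cov_comm hq h' _ (by rw [cartanA_comm]; exact h)]

omit hq

/-! ### Operators that add and remove one box -/

variable {V : Type*} [AddCommGroup V] [Module ℂ V] (B : Module.Basis P ℂ V)

open Classical in
/-- Adding the box `b`. -/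
def eps (b : β) : Module.End ℂ V :=
  B.constr ℂ fun p => if b ∈ M.adds p then M.e p b • B (M.up p b) else 0

open Classical in
/-- Removing the box `b`. -/
def phi (b : β) : Module.End ℂ V :=
  B.constr ℂ fun p => if b ∈ M.rems p then M.f (M.dn p b) b • B (M.dn p b) else 0

theorem eps_apply (b : β) (p : P) :
    M.eps B b (B p) = open Classical in if b ∈ M.adds p then M.e p b • B (M.up p b) else 0 := by
  rw [eps, Module.Basis.constr_basis]

theorem phi_apply (b : β) (p : P) : M.phi B b (B p)
    = open Classical in if b ∈ M.rems p then M.f (M.dn p b) b • B (M.dn p b) else 0 := by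
  rw [phi, Module.Basis.constr_basis]

variable {M}

theorem eps_cov {b : β} {p p' : P} (h : M.Cov p b p') : M.eps B b (B p) = M.e p b • B p' := by
  rw [eps_apply, if_pos h.mem_adds, h.up_eq]

theorem phi_cov {b : β} {p p' : P} (h : M.Cov p b p') : M.phi B b (B p') = M.f p b • B p := by
  rw [phi_apply, if_pos (M.mem_rems.2 ⟨p, h⟩), h.dn_eq]

theorem eps_not_cov {b : β} {p : P} (h : ∀ p', ¬ M.Cov p b p') : M.eps B b (B p) = 0 := by
  rw [eps_apply, if_neg fun hb => by obtain ⟨p', h'⟩ := M.cov_of_mem_adds hb; exact h p' h']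

theorem phi_not_cov {b : β} {p : P} (h : ∀ p', ¬ M.Cov p' b p) : M.phi B b (B p) = 0 := by
  rw [phi_apply, if_neg fun hb => by obtain ⟨p', h'⟩ := M.mem_rems.1 hb; exact h p' h']

theorem eps_mul_self (b : β) : M.eps B b * M.eps B b = 0 := by
  refine B.ext fun p => ?_
  rw [Module.End.mul_apply, LinearMap.zero_apply]
  by_cases h : ∃ p', M.Cov p b p'
  · obtain ⟨p', h⟩ := h
    rw [eps_cov B h, map_smul, eps_not_cov B, smul_zero]
    intro s hs
    exact hs.1 (by rw [h.2]; exact Finset.mem_insert_self _ _)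
  · rw [eps_not_cov B (not_exists.1 h), map_zero]

theorem phi_mul_self (b : β) : M.phi B b * M.phi B b = 0 := by
  refine B.ext fun p => ?_
  rw [Module.End.mul_apply, LinearMap.zero_apply]
  by_cases h : ∃ p', M.Cov p' b p
  · obtain ⟨p', h⟩ := h
    rw [phi_cov B h, map_smul, phi_not_cov B, smul_zero]
    intro s hs
    exact h.1 (by rw [hs.2]; exact Finset.mem_insert_self _ _)
  · rw [phi_not_cov B (not_exists.1 h), map_zero]

/-- By the two diamonds, for a ≠ b one order of the moves is possible exactly when the other is; in
that case the scalars agree by `e_f_comm`. -/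
theorem eps_phi_comm {a b : β} (hab : a ≠ b) :
    M.eps B a * M.phi B b = M.phi B b * M.eps B a := by
  refine B.ext fun p => ?_
  simp only [Module.End.mul_apply]
  by_cases hb : ∃ m, M.Cov m b p
  · obtain ⟨m, hb⟩ := hb
    rw [phi_cov B hb, map_smul]
    by_cases ha : ∃ r, M.Cov m a r
    · obtain ⟨r, ha⟩ := ha
      obtain ⟨s, hs1, hs2⟩ := diamond_up hab ha hb
      rw [eps_cov B ha, eps_cov B hs2, map_smul, phi_cov B hs1, smul_smul, smul_smul,
        mul_comm (M.f m b), M.e_f_comm hab ha hb hs1 hs2, mul_comm]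
    · rw [eps_not_cov B (not_exists.1 ha), smul_zero]
      by_cases ha' : ∃ s, M.Cov p a s
      · obtain ⟨s, hs⟩ := ha'
        rw [eps_cov B hs, map_smul, phi_not_cov B, smul_zero]
        intro r hr
        obtain ⟨m', hm1, hm2⟩ := diamond_down hab hr hs
        rw [hm2.unique_down hb] at hm1
        exact ha ⟨r, hm1⟩
      · rw [eps_not_cov B (not_exists.1 ha'), map_zero]
  · rw [phi_not_cov B (not_exists.1 hb), map_zero]
    by_cases ha' : ∃ s, M.Cov p a s
    · obtain ⟨s, hs⟩ := ha'
      rw [eps_cov B hs, map_smul, phi_not_cov B, smul_zero]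
      intro r hr
      obtain ⟨m', hm1, hm2⟩ := diamond_down hab hr hs
      exact hb ⟨m', hm2⟩
    · rw [eps_not_cov B (not_exists.1 ha'), map_zero]

theorem eps_mul_apply_not {a b : β} {p : P}
    (h : ∀ pa s, M.Cov p a pa → M.Cov pa b s → False) : M.eps B b (M.eps B a (B p)) = 0 := by
  by_cases ha : ∃ pa, M.Cov p a pa
  · obtain ⟨pa, ha⟩ := ha
    rw [eps_cov B ha, map_smul, eps_not_cov B (fun s hs => h pa s ha hs), smul_zero]
  · rw [eps_not_cov B (not_exists.1 ha), map_zero]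

theorem phi_mul_apply_not {a b : β} {s : P}
    (h : ∀ p pa, M.Cov p a pa → M.Cov pa b s → False) : M.phi B a (M.phi B b (B s)) = 0 := by
  by_cases hb : ∃ pa, M.Cov pa b s
  · obtain ⟨pa, hb⟩ := hb
    rw [phi_cov B hb, map_smul, phi_not_cov B (fun p hp => h p pa hp hb), smul_zero]
  · rw [phi_not_cov B (not_exists.1 hb), map_zero]

/-- If both orders are possible this is the scalar identity `e_mul`. If only one order is possible,
the factor in front of it is zero; otherwise both sides vanish. -/
theorem IsExchange.eps_mul {a b : β} {D N : ℂ} (h : M.IsExchange a b D N) :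
    D • (M.eps B b * M.eps B a) = N • (M.eps B a * M.eps B b) := by
  by_cases hab : a = b
  · subst hab; rw [eps_mul_self, smul_zero, smul_zero]
  refine B.ext fun p => ?_
  simp only [LinearMap.smul_apply, Module.End.mul_apply]
  by_cases h1 : ∃ pa s, M.Cov p a pa ∧ M.Cov pa b s
  · obtain ⟨pa, s, ha, has⟩ := h1
    by_cases h2 : ∃ pb, M.Cov p b pb
    · obtain ⟨pb, hb⟩ := h2
      obtain ⟨s', hs1, hs2⟩ := diamond_up hab ha hb
      rw [eps_cov B ha, eps_cov B hb, map_smul, map_smul, eps_cov B hs1, eps_cov B hs2,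
        smul_smul, smul_smul, smul_smul, smul_smul]
      congr 1
      linear_combination h.e_mul hab ha hb hs1 hs2
    · rw [h.eq_zero ha has (not_exists.1 h2), zero_smul, eps_not_cov B (not_exists.1 h2), map_zero,
        smul_zero]
  · rw [eps_mul_apply_not B fun pa s ha hs => h1 ⟨pa, s, ha, hs⟩, smul_zero]
    by_cases h2 : ∃ pb s, M.Cov p b pb ∧ M.Cov pb a s
    · obtain ⟨pb, s, hb, hbs⟩ := h2
      rw [h.symm.eq_zero hb hbs, zero_smul]
      intro pa ha
      obtain ⟨s', hs1, hs2⟩ := diamond_up hab ha hb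
      exact h1 ⟨pa, s', ha, hs1⟩
    · rw [eps_mul_apply_not B fun pa s ha hs => h2 ⟨pa, s, ha, hs⟩, smul_zero]

theorem IsExchange.phi_mul {a b : β} {D N : ℂ} (h : M.IsExchange a b D N) :
    D • (M.phi B a * M.phi B b) = N • (M.phi B b * M.phi B a) := by
  by_cases hab : a = b
  · subst hab; rw [phi_mul_self, smul_zero, smul_zero]
  refine B.ext fun s => ?_
  simp only [LinearMap.smul_apply, Module.End.mul_apply]
  by_cases h1 : ∃ p pa, M.Cov p a pa ∧ M.Cov pa b s
  · obtain ⟨p, pa, ha, has⟩ := h1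
    by_cases h2 : ∃ pb, M.Cov p b pb
    · obtain ⟨pb, hb⟩ := h2
      obtain ⟨s', hs1, hs2⟩ := diamond_up hab ha hb
      obtain rfl := has.unique_up hs1
      rw [phi_cov B hs1, phi_cov B hs2, map_smul, map_smul, phi_cov B ha, phi_cov B hb,
        smul_smul, smul_smul, smul_smul, smul_smul]
      congr 1
      linear_combination h.f_mul hab ha hb hs1 hs2
    · rw [h.eq_zero ha has (not_exists.1 h2), zero_smul, phi_mul_apply_not B, smul_zero]
      intro p' pb hb hbs
      obtain ⟨m, hm1, hm2⟩ := diamond_down hab has hbs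
      rw [hm1.unique_down ha] at hm2
      exact h2 ⟨pb, hm2⟩
  · rw [phi_mul_apply_not B fun p pa ha hs => h1 ⟨p, pa, ha, hs⟩, smul_zero]
    by_cases h2 : ∃ p pb, M.Cov p b pb ∧ M.Cov pb a s
    · obtain ⟨p, pb, hb, hbs⟩ := h2
      rw [h.symm.eq_zero hb hbs, zero_smul]
      intro pa ha
      obtain ⟨s', hs1, hs2⟩ := diamond_up hab ha hb
      obtain rfl := hbs.unique_up hs2
      exact h1 ⟨p, pa, ha, hs1⟩
    · rw [phi_mul_apply_not B fun p pa ha hs => h2 ⟨p, pa, ha, hs⟩, smul_zero]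

theorem eps_triple_eq_zero {x y z : β}
    (h : ∀ p s, x ≠ y → x ≠ z → y ≠ z → x ∉ M.cells p → y ∉ M.cells p → z ∉ M.cells p →
      M.cells s ≠ insert x (insert y (insert z (M.cells p)))) :
    M.eps B x * M.eps B y * M.eps B z = 0 := by
  refine B.ext fun p => ?_
  simp only [Module.End.mul_apply, LinearMap.zero_apply]
  by_cases h1 : ∃ pz, M.Cov p z pz
  · obtain ⟨pz, hz⟩ := h1
    rw [eps_cov B hz, map_smul, map_smul, eps_mul_apply_not B, smul_zero]
    intro py s hy hx
    have hz1 := hz.1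
    have hy1 := hy.1
    have hx1 := hx.1
    rw [hy.2, hz.2] at hx1
    rw [hz.2] at hy1
    simp only [Finset.mem_insert, not_or] at hx1 hy1
    exact h p s hx1.1 hx1.2.1 hy1.1 hx1.2.2 hy1.2 hz1 (by rw [hx.2, hy.2, hz.2])
  · rw [eps_not_cov B (not_exists.1 h1), map_zero, map_zero]

theorem phi_triple_eq_zero {x y z : β}
    (h : ∀ p s, x ≠ y → x ≠ z → y ≠ z → x ∉ M.cells p → y ∉ M.cells p → z ∉ M.cells p →
      M.cells s ≠ insert x (insert y (insert z (M.cells p)))) :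
    M.phi B z * M.phi B y * M.phi B x = 0 := by
  refine B.ext fun s => ?_
  simp only [Module.End.mul_apply, LinearMap.zero_apply]
  by_cases h1 : ∃ py, M.Cov py x s
  · obtain ⟨py, hx⟩ := h1
    rw [phi_cov B hx, map_smul, map_smul, phi_mul_apply_not B, smul_zero]
    intro p pz hz hy
    have hz1 := hz.1
    have hy1 := hy.1
    have hx1 := hx.1
    rw [hy.2, hz.2] at hx1
    rw [hz.2] at hy1
    simp only [Finset.mem_insert, not_or] at hx1 hy1
    exact h p s hx1.1 hx1.2.1 hy1.1 hx1.2.2 hy1.2 hz1 (by rw [hx.2, hy.2, hz.2])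
  · rw [phi_not_cov B (not_exists.1 h1), map_zero, map_zero]

end BoxModel

/-! ## The Serre relation from the exchange relations -/

theorem eq_smul_of_smul_eq {V : Type*} [AddCommGroup V] [Module ℂ V] {c e : ℂ} {a b : V}
    (h : c • a = e • b) (he : e ≠ 0) : b = (c / e) • a := by
  rw [div_eq_inv_mul, mul_smul, h, smul_smul, inv_mul_cancel₀ he, one_smul]

/-- The vectors a₁, …, a₆ stand for XYZ, YXZ, XZY, YZX, ZXY, ZYX. Depending on which factors can be
divided by, the exchange relations express all six through a₁, a₃ or a₅, and the Serre combination
becomes an identity of rational functions. The last hypothesis is needed only when x = qw. -/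
theorem serre_of_exchange_aux {V : Type*} [AddCommGroup V] [Module ℂ V] {q x y w : ℂ} (hq : q ≠ 0)
    {a₁ a₂ a₃ a₄ a₅ a₆ : V} (hxy : q ^ 2 * x - y ≠ 0)
    (h1 : (x - q ^ 2 * y) • a₁ = (q ^ 2 * x - y) • a₂)
    (h2 : (x - q ^ 2 * y) • a₅ = (q ^ 2 * x - y) • a₆)
    (h3 : (q * x - w) • a₃ = (x - q * w) • a₅)
    (h4 : (q * x - w) • a₂ = (x - q * w) • a₄)
    (h6 : (q * y - w) • a₁ = (y - q * w) • a₃)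
    (h : (x - q * w ≠ 0 ∧ y - q * w ≠ 0) ∨ (x - q * w ≠ 0 ∧ q * y - w ≠ 0) ∨
      (q * x - w ≠ 0 ∧ q * y - w ≠ 0))
    (h4' : x - q * w = 0 → (q * y - w) • a₄ = (y - q * w) • a₆) :
    (a₁ - (q + q⁻¹) • a₃ + a₅) + (a₂ - (q + q⁻¹) • a₄ + a₆) = 0 := by
  have e2 := eq_smul_of_smul_eq h1 hxy
  have e6 := eq_smul_of_smul_eq h2 hxy
  by_cases hx : x - q * w = 0
  · have hx' : q * x - w ≠ 0 := by
      rcases h with h | h | h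
      · exact absurd hx h.1
      · exact absurd hx h.1
      · exact h.1
    have hy : q * y - w ≠ 0 := by
      rcases h with h | h | h
      · exact absurd hx h.1
      · exact absurd hx h.1
      · exact h.2
    have e3 := eq_smul_of_smul_eq h3.symm hx'
    have e1 := eq_smul_of_smul_eq h6.symm hy
    have e4 := eq_smul_of_smul_eq (h4' hx).symm hy
    rw [e4, e6, e2, e1, e3]
    match_scalars
    generalize hD₁ : q ^ 2 * x - y = D₁ at hxy ⊢
    generalize hD₂ : q * y - w = D₂ at hy ⊢
    generalize hD₃ : q * x - w = D₃ at hx' ⊢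
    field_simp
    rw [← hD₁, ← hD₂, ← hD₃]
    ring
  · have e5 := eq_smul_of_smul_eq h3 hx
    have e4 := eq_smul_of_smul_eq h4 hx
    by_cases hy : y - q * w = 0
    · have hy' : q * y - w ≠ 0 := by
        rcases h with h | h | h
        · exact absurd hy h.2
        · exact h.2
        · exact h.2
      have e1 := eq_smul_of_smul_eq h6.symm hy'
      rw [e6, e5, e4, e2, e1]
      match_scalars
      generalize hD₁ : q ^ 2 * x - y = D₁ at hxy ⊢
      generalize hD₂ : q * y - w = D₂ at hy' ⊢
      generalize hD₃ : x - q * w = D₃ at hx ⊢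
      field_simp
      rw [← hD₁, ← hD₂, ← hD₃]
      ring
    · have e3 := eq_smul_of_smul_eq h6 hy
      rw [e6, e5, e4, e3, e2]
      match_scalars
      field_simp
      ring

/-- The exchange relations determine the six words up to one scalar unless two of the factors vanish
at once. This happens only in the two excluded coincidences, which are those of a wheel. -/
theorem serre_of_exchange {A : Type*} [Ring A] [Algebra ℂ A] {q x y w : ℂ} (hq : q ≠ 0)
    (hq4 : q ^ 4 ≠ 1) (hx : x ≠ 0) (hw : w ≠ 0) {X Y Z : A}
    (hXY : (x - q ^ 2 * y) • (X * Y) = (q ^ 2 * x - y) • (Y * X))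
    (hXZ : (q * x - w) • (X * Z) = (x - q * w) • (Z * X))
    (hYZ : (q * y - w) • (Y * Z) = (y - q * w) • (Z * Y))
    (h₁ : ¬ (x = q ^ 2 * y ∧ x = q * w)) (h₂ : ¬ (y = q ^ 2 * x ∧ y = q * w)) :
    (X * Y * Z - (q + q⁻¹) • (X * Z * Y) + Z * X * Y)
      + (Y * X * Z - (q + q⁻¹) • (Y * Z * X) + Z * Y * X) = 0 := by
  have r1 := congrArg (· * Z) hXY
  have r2 := congrArg (Z * ·) hXY
  have r3 := congrArg (· * Y) hXZ
  have r4 := congrArg (Y * ·) hXZ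
  have r5 := congrArg (· * X) hYZ
  have r6 := congrArg (X * ·) hYZ
  simp only [smul_mul_assoc, mul_smul_comm, ← mul_assoc] at r1 r2 r3 r4 r5 r6
  have hq2 : ∀ z : ℂ, z ≠ 0 → q ^ 2 * z ≠ z := fun z hz h => hq4 (by
    have := mul_right_cancel₀ hz (h.trans (one_mul z).symm)
    rw [show (4 : ℕ) = 2 * 2 from rfl, pow_mul, this, one_pow])
  -- If x = qw, then qx = w would give q²w = w, and qy = w would give x = q²y; so the factors on the
  -- other side may be inverted.
  have alt : ∀ x y : ℂ, ¬ (x = q ^ 2 * y ∧ x = q * w) →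
      (x - q * w ≠ 0 ∧ y - q * w ≠ 0) ∨ (x - q * w ≠ 0 ∧ q * y - w ≠ 0) ∨
      (q * x - w ≠ 0 ∧ q * y - w ≠ 0) := by
    intro x y h
    by_cases hx : x - q * w = 0
    · refine Or.inr (Or.inr ⟨fun h' => hq2 w hw ?_, fun h' => h ⟨?_, sub_eq_zero.1 hx⟩⟩)
      · linear_combination h' - q * hx
      · linear_combination hx - q * h'
    · by_cases hy : y - q * w = 0
      · refine Or.inr (Or.inl ⟨hx, fun h' => hq2 w hw ?_⟩)
        linear_combination h' - q * hy
      · exact Or.inl ⟨hx, hy⟩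
  -- Since q⁴ ≠ 1, the equalities y = q²x and x = q²y cannot both hold, and the claim is symmetric
  -- in X and Y.
  by_cases hxy : q ^ 2 * x - y = 0
  · have hyx : q ^ 2 * y - x ≠ 0 := fun h => hq4 (mul_right_cancel₀ hx
      (by linear_combination q ^ 2 * hxy + h))
    rw [add_comm]
    refine serre_of_exchange_aux hq hyx ?_ ?_ r5 r6 r4 (alt y x h₂) fun _ => r3
    · rw [← neg_sub, neg_smul, ← r1, ← neg_smul, neg_sub]
    · rw [← neg_sub, neg_smul, ← r2, ← neg_smul, neg_sub]
  · exact serre_of_exchange_aux hq hxy r1 r2 r3 r4 r6 (alt x y h₁) fun _ => r5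

namespace BoxModel

open BoxLattice

variable {n : ℕ} {q d : ℂ} {P β : Type*} [DecidableEq β] (M : BoxModel n q d P β)
variable {V : Type*} [AddCommGroup V] [Module ℂ V] (B : Module.Basis P ℂ V)

/-! ### Locally finite sums of operators -/

/-- `T = ∑ b, c b • t b`, a sum over all boxes with finitely many nonzero terms on each vector. -/
def IsLocalSum (T : Module.End ℂ V) (c : β → ℂ) (t : β → Module.End ℂ V) : Prop :=
  ∀ v : V, ∀ᶠ U : Finset β in Filter.atTop, T v = ∑ b ∈ U, c b • t b v

omit [DecidableEq β] in
theorem isLocalSum_of_basis {T : Module.End ℂ V} {c : β → ℂ} {t : β → Module.End ℂ V}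
    (h : ∀ p, ∀ᶠ U : Finset β in Filter.atTop, T (B p) = ∑ b ∈ U, c b • t b (B p)) :
    IsLocalSum T c t := by
  intro v
  have hv := B.mem_span v
  induction hv using Submodule.span_induction with
  | mem x hx => obtain ⟨p, rfl⟩ := hx; exact h p
  | zero => simp
  | add x y _ _ hx hy =>
    filter_upwards [hx, hy] with U h1 h2
    simp only [map_add, smul_add, Finset.sum_add_distrib, h1, h2]
  | smul a x _ hx =>
    filter_upwards [hx] with U h1
    simp only [map_smul, h1, Finset.smul_sum]
    exact Finset.sum_congr rfl fun b _ => smul_comm _ _ _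

omit [DecidableEq β] in
-- The outer sum is finite on T'v and the inner one on v. Stating this for all large `U` allows one
-- finite set to serve for all words of a relation.
theorem IsLocalSum.mul {T T' : Module.End ℂ V} {c c' : β → ℂ} {t t' : β → Module.End ℂ V}
    (h : IsLocalSum T c t) (h' : IsLocalSum T' c' t') (v : V) :
    ∀ᶠ U : Finset β in Filter.atTop,
      T (T' v) = ∑ b ∈ U, ∑ a ∈ U, (c b * c' a) • t b (t' a v) := by
  filter_upwards [h (T' v), h' v] with U h1 h2
  rw [h1]
  refine Finset.sum_congr rfl fun b _ => ?_
  rw [h2, map_sum, Finset.smul_sum]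
  refine Finset.sum_congr rfl fun a _ => ?_
  rw [map_smul, smul_smul]

omit [DecidableEq β] in
theorem IsLocalSum.mul_mul {T T' T'' : Module.End ℂ V} {c c' c'' : β → ℂ}
    {t t' t'' : β → Module.End ℂ V}
    (h : IsLocalSum T c t) (h' : IsLocalSum T' c' t') (h'' : IsLocalSum T'' c'' t'') (v : V) :
    ∀ᶠ U : Finset β in Filter.atTop, T (T' (T'' v))
      = ∑ x ∈ U, ∑ y ∈ U, ∑ z ∈ U, (c x * c' y * c'' z) • t x (t' y (t'' z v)) := by
  filter_upwards [h (T' (T'' v)), h'.mul h'' v] with U h1 h2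
  rw [h1]
  refine Finset.sum_congr rfl fun b _ => ?_
  rw [h2, map_sum, Finset.smul_sum]
  refine Finset.sum_congr rfl fun a _ => ?_
  rw [map_sum, Finset.smul_sum]
  refine Finset.sum_congr rfl fun z _ => ?_
  rw [map_smul, smul_smul, mul_assoc]

/-- The coefficient of the box `b` in the mode `r` of the currents of colour `i`. -/
def mode (i : ZMod n) (r : ℤ) (b : β) : ℂ := if M.col b = i then M.loc b ^ r else 0

theorem mode_succ (i : ZMod n) (r : ℤ) (b : β) :
    M.mode i (r + 1) b = M.mode i r b * M.loc b := by
  unfold mode; split_ifs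
  · rw [zpow_add_one₀ (M.loc_ne b)]
  · rw [zero_mul]

theorem mode_eq_zero {i : ZMod n} {b : β} (h : M.col b ≠ i) (r : ℤ) : M.mode i r b = 0 := if_neg h

section Relations

variable {M}
variable {T : ZMod n → ℤ → Module.End ℂ V} {t : β → Module.End ℂ V}
  (hT : ∀ i r, IsLocalSum (T i r) (M.mode i r) t)
include hT

/-- Raising a mode by one multiplies the term of a box by its location, so the relation of currents
is the exchange relation summed over pairs of boxes. -/
theorem quadratic_relation {i j : ZMod n} {D Q : ℂ}
    (h : ∀ b a, M.col b = i → M.col a = j →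
      (D * M.loc b - Q * M.loc a) • (t b * t a) = (D * Q * M.loc b - M.loc a) • (t a * t b))
    (r s : ℤ) :
    D • (T i (r + 1) * T j s) - Q • (T i r * T j (s + 1))
      = (D * Q) • (T j s * T i (r + 1)) - T j (s + 1) * T i r := by
  ext v
  obtain ⟨U, h1, h2, h3, h4⟩ := (((hT i (r + 1)).mul (hT j s) v).and
    (((hT i r).mul (hT j (s + 1)) v).and
    (((hT j s).mul (hT i (r + 1)) v).and ((hT j (s + 1)).mul (hT i r) v)))).exists
  simp only [LinearMap.sub_apply, LinearMap.smul_apply, Module.End.mul_apply, h1, h2, h3, h4]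
  rw [Finset.sum_comm (f := fun b a => (M.mode j s b * M.mode i (r + 1) a) • t b (t a v)),
    Finset.sum_comm (f := fun b a => (M.mode j (s + 1) b * M.mode i r a) • t b (t a v))]
  simp only [Finset.smul_sum, ← Finset.sum_sub_distrib]
  refine Finset.sum_congr rfl fun b _ => Finset.sum_congr rfl fun a _ => ?_
  by_cases hb : M.col b = i
  · by_cases ha : M.col a = j
    · have := LinearMap.congr_fun (h b a hb ha) v
      simp only [LinearMap.smul_apply, Module.End.mul_apply] at this
      simp only [mode_succ]
      linear_combination (norm := module) (M.mode i r b * M.mode j s a) • this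
    · simp only [M.mode_eq_zero ha]; simp
  · simp only [M.mode_eq_zero hb]; simp

theorem comm_relation {i j : ZMod n}
    (h : ∀ b a, M.col b = i → M.col a = j → t b * t a = t a * t b) (r s : ℤ) :
    T i r * T j s = T j s * T i r := by
  ext v
  obtain ⟨U, h1, h2⟩ := (((hT i r).mul (hT j s) v).and ((hT j s).mul (hT i r) v)).exists
  simp only [Module.End.mul_apply, h1, h2]
  rw [Finset.sum_comm (f := fun b a => (M.mode j s b * M.mode i r a) • t b (t a v))]
  refine Finset.sum_congr rfl fun b _ => Finset.sum_congr rfl fun a _ => ?_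
  by_cases hb : M.col b = i
  · by_cases ha : M.col a = j
    · have := LinearMap.congr_fun (h b a hb ha) v
      simp only [Module.End.mul_apply] at this
      rw [this, mul_comm]
    · simp [M.mode_eq_zero ha]
  · simp [M.mode_eq_zero hb]

theorem serre_relation {i j : ZMod n} {c : ℂ}
    (h : ∀ x y z, M.col x = i → M.col y = i → M.col z = j →
      (t x * t y * t z - c • (t x * t z * t y) + t z * t x * t y)
        + (t y * t x * t z - c • (t y * t z * t x) + t z * t y * t x) = 0) (r₁ r₂ s : ℤ) :
    (T i r₁ * T i r₂ * T j s - c • (T i r₁ * T j s * T i r₂) + T j s * T i r₁ * T i r₂)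
      + (T i r₂ * T i r₁ * T j s - c • (T i r₂ * T j s * T i r₁) + T j s * T i r₂ * T i r₁)
      = 0 := by
  ext v
  obtain ⟨U, h1, h2, h3, h4, h5, h6⟩ := (((hT i r₁).mul_mul (hT i r₂) (hT j s) v).and
    (((hT i r₁).mul_mul (hT j s) (hT i r₂) v).and
    (((hT j s).mul_mul (hT i r₁) (hT i r₂) v).and
    (((hT i r₂).mul_mul (hT i r₁) (hT j s) v).and
    (((hT i r₂).mul_mul (hT j s) (hT i r₁) v).and
    ((hT j s).mul_mul (hT i r₂) (hT i r₁) v)))))).exists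
  simp only [LinearMap.add_apply, LinearMap.sub_apply, LinearMap.smul_apply, Module.End.mul_apply,
    h1, h2, h3, h4, h5, h6, LinearMap.zero_apply]
  have e2 : ∀ g : β → β → β → V, ∑ x ∈ U, ∑ z ∈ U, ∑ y ∈ U, g x z y
      = ∑ x ∈ U, ∑ y ∈ U, ∑ z ∈ U, g x z y := fun g =>
    Finset.sum_congr rfl fun x _ => Finset.sum_comm
  have e3 : ∀ g : β → β → β → V, ∑ y ∈ U, ∑ x ∈ U, ∑ z ∈ U, g y x z
      = ∑ x ∈ U, ∑ y ∈ U, ∑ z ∈ U, g y x z := fun g => Finset.sum_comm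
  have e4 : ∀ g : β → β → β → V, ∑ z ∈ U, ∑ x ∈ U, ∑ y ∈ U, g z x y
      = ∑ x ∈ U, ∑ y ∈ U, ∑ z ∈ U, g z x y := fun g => by
    rw [Finset.sum_comm]; exact Finset.sum_congr rfl fun x _ => Finset.sum_comm
  -- Every word is summed in the order of its factors; the sums are reordered so that x, y, z carry
  -- the modes r₁, r₂, s in all six words.
  rw [e2 (fun x z y => (M.mode i r₁ x * M.mode j s z * M.mode i r₂ y) • t x (t z (t y v))),
    e4 (fun z x y => (M.mode j s z * M.mode i r₁ x * M.mode i r₂ y) • t z (t x (t y v))),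
    e3 (fun y x z => (M.mode i r₂ y * M.mode i r₁ x * M.mode j s z) • t y (t x (t z v))),
    e3 (fun y z x => (M.mode i r₂ y * M.mode j s z * M.mode i r₁ x) • t y (t z (t x v))),
    e2 (fun z y x => (M.mode i r₂ y * M.mode j s z * M.mode i r₁ x) • t y (t z (t x v))),
    e4 (fun z y x => (M.mode j s z * M.mode i r₂ y * M.mode i r₁ x) • t z (t y (t x v))),
    e3 (fun y x z => (M.mode j s z * M.mode i r₂ y * M.mode i r₁ x) • t z (t y (t x v)))]
  rw [e3 (fun z x y => (M.mode i r₂ y * M.mode j s z * M.mode i r₁ x) • t y (t z (t x v))),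
    e2 (fun x z y => (M.mode i r₂ y * M.mode j s z * M.mode i r₁ x) • t y (t z (t x v)))]
  simp only [Finset.smul_sum, ← Finset.sum_sub_distrib, ← Finset.sum_add_distrib]
  refine Finset.sum_eq_zero fun x _ => Finset.sum_eq_zero fun y _ => Finset.sum_eq_zero fun z _ => ?_
  by_cases hx : M.col x = i
  · by_cases hy : M.col y = i
    · by_cases hz : M.col z = j
      · have := LinearMap.congr_fun (h x y z hx hy hz) v
        simp only [LinearMap.add_apply, LinearMap.sub_apply, LinearMap.smul_apply,
          Module.End.mul_apply, LinearMap.zero_apply] at this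
        linear_combination (norm := module) (M.mode i r₁ x * M.mode i r₂ y * M.mode j s z) • this
      · simp [M.mode_eq_zero hz]
    · simp [M.mode_eq_zero hy]
  · simp [M.mode_eq_zero hx]

end Relations

/-! ### Diagonal operators and the logarithm of the weights -/

/-- Diagonal operators. -/
def diag : (P → ℂ) →ₐ[ℂ] Module.End ℂ V :=
  AlgHom.ofLinearMap
    { toFun := fun g => B.constr ℂ fun p => g p • B p
      map_add' := fun g h => B.ext fun p => by simp [Module.Basis.constr_basis, add_smul]
      map_smul' := fun c g => B.ext fun p => by simp [Module.Basis.constr_basis, smul_smul] }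
    (B.ext fun p => by simp [Module.Basis.constr_basis])
    (fun g h => B.ext fun p => by simp [Module.Basis.constr_basis, smul_smul, mul_comm])

theorem diag_apply (g : P → ℂ) (p : P) : diag B g (B p) = g p • B p :=
  B.constr_basis ℂ _ p

end BoxModel

theorem expCoeff_map {A A' : Type*} [Ring A] [Algebra ℂ A] [Ring A'] [Algebra ℂ A']
    (φ : A →ₐ[ℂ] A') (h : ℕ → A) (r : ℕ) : φ (expCoeff h r) = expCoeff (fun k => φ (h k)) r := by
  have key : (PowerSeries.mk fun k => if k = 0 then 0 else φ (h k))
      = PowerSeries.map (φ : A →+* A') (PowerSeries.mk fun k => if k = 0 then 0 else h k) := by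
    ext k; simp only [PowerSeries.coeff_mk, PowerSeries.coeff_map]; split_ifs <;> simp
  simp only [expCoeff, map_sum, map_smul, key, ← map_pow, PowerSeries.coeff_map]
  rfl

theorem expCoeff_congr {A : Type*} [Ring A] [Algebra ℂ A] {h h' : ℕ → A} {r : ℕ}
    (hh : ∀ k, k ≠ 0 → h k = h' k) : expCoeff h r = expCoeff h' r := by
  have : (PowerSeries.mk fun k => if k = 0 then 0 else h k)
      = PowerSeries.mk fun k => if k = 0 then 0 else h' k := by
    ext k; simp only [PowerSeries.coeff_mk]; split_ifs with hk
    · rfl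
    · exact hh k hk
  simp only [expCoeff, this]

theorem expCoeff_zero {A : Type*} [Ring A] [Algebra ℂ A] (h : ℕ → A) : expCoeff h 0 = 1 := by
  simp [expCoeff]

/-- Changing the coefficient of degree `r` changes the exponential in degree `r` linearly. -/
theorem expCoeff_update (h h' : ℕ → ℂ) (r : ℕ) (hr : r ≠ 0) (hh : ∀ k < r, h k = h' k) :
    expCoeff h r - h r = expCoeff h' r - h' r := by
  -- The term m = 1 of the exponential series is the coefficient g r itself.
  have hsplit : ∀ g : ℕ → ℂ, expCoeff g r - g r = ∑ m ∈ (Finset.range (r + 1)).erase 1,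
      ((m.factorial : ℂ)⁻¹) • PowerSeries.coeff r
        ((PowerSeries.mk fun k => if k = 0 then 0 else g k) ^ m) := by
    intro g
    have h1 : 1 ∈ Finset.range (r + 1) := Finset.mem_range.2 (by omega)
    rw [expCoeff, ← Finset.add_sum_erase _ _ h1]
    simp [hr]
  rw [hsplit, hsplit]
  refine Finset.sum_congr rfl fun m hm => ?_
  congr 1
  rw [PowerSeries.coeff_pow, PowerSeries.coeff_pow]
  refine Finset.sum_congr rfl fun l hl => ?_
  rw [Finset.mem_finsuppAntidiag] at hl
  have hm1 : m ≠ 1 := Finset.ne_of_mem_erase hm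
  by_cases hz : ∃ i ∈ Finset.range m, l i = 0
  · obtain ⟨i, hi, hli⟩ := hz
    rw [Finset.prod_eq_zero hi (by simp [hli]), Finset.prod_eq_zero hi (by simp [hli])]
  · push Not at hz
    refine Finset.prod_congr rfl fun i hi => ?_
    have hlt : l i < r := by
      have him := Finset.mem_range.1 hi
      obtain ⟨j, hj, hji⟩ : ∃ j ∈ Finset.range m, j ≠ i := by
        rcases Nat.eq_zero_or_pos i with h0 | h0
        · exact ⟨1, Finset.mem_range.2 (by omega), by omega⟩
        · exact ⟨0, Finset.mem_range.2 (by omega), by omega⟩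
      have h2 : l i + l j ≤ (Finset.range m).sum l := by
        rw [← Finset.sum_pair hji.symm]
        refine Finset.sum_le_sum_of_subset fun a ha => ?_
        simp only [Finset.mem_insert, Finset.mem_singleton] at ha
        rcases ha with rfl | rfl
        · exact hi
        · exact hj
      have := hz j hj
      have := hl.1
      omega
    simp only [PowerSeries.coeff_mk, hh _ hlt]

/-- The coefficients of the logarithm of `∑ r, g r x^r`. -/
def logCoeff (g : ℕ → ℂ) (r : ℕ) : ℂ :=
  g r - expCoeff (fun k => if k < r then logCoeff g k else 0) r
termination_by r

/-- By `expCoeff_update` the coefficient of degree r depends on the logarithm in degree r only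
through a linear term, and the recursion solves for it. -/
theorem expCoeff_logCoeff (g : ℕ → ℂ) (hg : g 0 = 1) (r : ℕ) : expCoeff (logCoeff g) r = g r := by
  rcases eq_or_ne r 0 with rfl | hr
  · rw [expCoeff_zero, hg]
  · have h1 := expCoeff_update (logCoeff g) (fun k => if k < r then logCoeff g k else 0) r hr
      (fun k hk => by simp [hk])
    have h2 : logCoeff g r = g r - expCoeff (fun k => if k < r then logCoeff g k else 0) r := by
      rw [logCoeff]
    simp only [lt_irrefl, if_false, sub_zero] at h1
    linear_combination h1 + h2

namespace BoxModel

open BoxLattice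

variable {n : ℕ} {q d : ℂ} {P β : Type*} [DecidableEq β] (M : BoxModel n q d P β)
variable {V : Type*} [AddCommGroup V] [Module ℂ V] (B : Module.Basis P ℂ V)

/-! ### The currents -/

/-- The modes of `E_i(z)`. -/
def opE (i : ZMod n) (r : ℤ) : Module.End ℂ V :=
  B.constr ℂ fun p => ∑ b ∈ M.adds p, M.mode i r b • M.eps B b (B p)

/-- The modes of `F_i(z)`. -/
def opF (i : ZMod n) (r : ℤ) : Module.End ℂ V :=
  B.constr ℂ fun p => ∑ b ∈ M.rems p, M.mode i r b • M.phi B b (B p)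

theorem opE_apply (i : ZMod n) (r : ℤ) (p : P) :
    M.opE B i r (B p) = ∑ b ∈ M.adds p, M.mode i r b • M.eps B b (B p) :=
  B.constr_basis ℂ _ p

theorem opF_apply (i : ZMod n) (r : ℤ) (p : P) :
    M.opF B i r (B p) = ∑ b ∈ M.rems p, M.mode i r b • M.phi B b (B p) :=
  B.constr_basis ℂ _ p

theorem opE_isLocalSum (i : ZMod n) (r : ℤ) :
    IsLocalSum (M.opE B i r) (M.mode i r) (M.eps B) := by
  refine isLocalSum_of_basis B fun p => ?_
  filter_upwards [Filter.eventually_ge_atTop (M.adds p)] with U hU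
  rw [opE_apply]
  refine Finset.sum_subset hU fun b _ hb => ?_
  rw [eps_apply, if_neg hb, smul_zero]

theorem opF_isLocalSum (i : ZMod n) (r : ℤ) :
    IsLocalSum (M.opF B i r) (M.mode i r) (M.phi B) := by
  refine isLocalSum_of_basis B fun p => ?_
  filter_upwards [Filter.eventually_ge_atTop (M.rems p)] with U hU
  rw [opF_apply]
  refine Finset.sum_subset hU fun b _ hb => ?_
  rw [phi_apply, if_neg hb, smul_zero]

theorem Kc_zero_ne (ε : Bool) (i : ZMod n) (p : P) : M.Kc ε i p 0 ≠ 0 := by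
  have := M.Kc_zero_mul i p
  cases ε
  · exact right_ne_zero_of_mul_eq_one this
  · exact left_ne_zero_of_mul_eq_one this

/-- The logarithm of the normalized weight. -/
def logK (ε : Bool) (i : ZMod n) (p : P) : ℕ → ℂ :=
  logCoeff fun r => (M.Kc ε i p 0)⁻¹ * M.Kc ε i p (if ε then (r : ℤ) else -(r : ℤ))

theorem Kc_zero_mul_expCoeff (ε : Bool) (i : ZMod n) (p : P) (r : ℕ) :
    M.Kc ε i p 0 * expCoeff (M.logK ε i p) r = M.Kc ε i p (if ε then (r : ℤ) else -(r : ℤ)) := by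
  rw [logK, expCoeff_logCoeff, ← mul_assoc, mul_inv_cancel₀ (M.Kc_zero_ne ε i p), one_mul]
  simp [M.Kc_zero_ne ε i p]

/-- The eigenvalue of `H_{i,l}`. -/
def hval (i : ZMod n) (l : ℤ) (p : P) : ℂ :=
  if 0 < l then (q - q⁻¹)⁻¹ * M.logK true i p l.toNat
  else -((q - q⁻¹)⁻¹ * M.logK false i p (-l).toNat)

/-- The operators by which the generators act. -/
def genAction : ToroidalGen n → Module.End ℂ V
  | .E i k => M.opE B i k
  | .F i k => M.opF B i k
  | .H i l => diag B (M.hval i l)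
  | .K i => diag B fun p => M.Kc true i p 0
  | .Kinv i => diag B fun p => M.Kc false i p 0

/-- The action of the free algebra. -/
def freeAction : FreeAlgebra ℂ (ToroidalGen n) →ₐ[ℂ] Module.End ℂ V :=
  FreeAlgebra.lift ℂ (M.genAction B)

theorem freeAction_E (i : ZMod n) (r : ℤ) : M.freeAction B (freeE i r) = M.opE B i r := by
  simp [freeAction, freeE, genAction]

theorem freeAction_F (i : ZMod n) (r : ℤ) : M.freeAction B (freeF i r) = M.opF B i r := by
  simp [freeAction, freeF, genAction]

theorem freeAction_K (i : ZMod n) :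
    M.freeAction B (freeK i) = diag B fun p => M.Kc true i p 0 := by
  simp [freeAction, freeK, genAction]

theorem freeAction_Kinv (i : ZMod n) :
    M.freeAction B (freeKinv i) = diag B fun p => M.Kc false i p 0 := by
  simp [freeAction, freeKinv, genAction]

theorem freeAction_H (i : ZMod n) (l : ℤ) (hl : l ≠ 0) :
    M.freeAction B (freeH i l) = diag B (M.hval i l) := by
  simp [freeAction, freeH, genAction, hl]

theorem expCoeff_diag (h : ℕ → P → ℂ) (r : ℕ) :
    expCoeff (fun k => diag B (h k)) r = diag B fun p => expCoeff (fun k => h k p) r := by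
  rw [← expCoeff_map]
  congr 1
  funext p
  exact expCoeff_map (Pi.evalAlgHom ℂ (fun _ : P => ℂ) p) h r

/-- The eigenvalues of H_{i,l} are chosen as the coefficients of the logarithm divided by ±(q -
q⁻¹), so exponentiation returns the given weights; outside the range of the expansion both sides are
zero. -/
theorem freeAction_Kcur (hq : q - q⁻¹ ≠ 0) (ε : Bool) (i : ZMod n) (r : ℤ) :
    M.freeAction B (freeKcur q ε i r) = diag B fun p => M.Kc ε i p r := by
  cases ε
  · simp only [freeKcur]
    split_ifs with hr
    · rw [map_mul, freeAction_Kinv, expCoeff_map]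
      rw [expCoeff_congr (h' := fun k => diag B fun p => M.logK false i p k), expCoeff_diag,
        ← map_mul]
      · congr 1
        funext p
        simp only [Pi.mul_apply]
        rw [M.Kc_zero_mul_expCoeff false i p]
        congr 1
        simp; omega
      · intro k hk
        rw [map_smul, freeAction_H _ _ _ _ (by omega), ← map_smul]
        congr 1
        funext p
        have : ¬ (0 : ℤ) < -(k : ℤ) := by omega
        simp only [Pi.smul_apply, hval, this, if_false, smul_eq_mul]
        rw [neg_mul_neg, ← mul_assoc, mul_inv_cancel₀ hq, one_mul]
        simp
    · rw [map_zero, eq_comm]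
      convert map_zero (diag B) using 2
      funext p
      exact M.Kc_false_pos i p r (by omega)
  · simp only [freeKcur]
    split_ifs with hr
    · rw [map_mul, freeAction_K, expCoeff_map]
      rw [expCoeff_congr (h' := fun k => diag B fun p => M.logK true i p k), expCoeff_diag,
        ← map_mul]
      · congr 1
        funext p
        simp only [Pi.mul_apply]
        rw [M.Kc_zero_mul_expCoeff true i p]
        congr 1
        simp; omega
      · intro k hk
        rw [map_smul, freeAction_H _ _ _ _ (by omega), ← map_smul]
        congr 1
        funext p
        have : (0 : ℤ) < (k : ℤ) := by omega
        simp only [Pi.smul_apply, hval, this, if_true, smul_eq_mul]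
        rw [← mul_assoc, mul_inv_cancel₀ hq, one_mul]
        simp
    · rw [map_zero, eq_comm]
      convert map_zero (diag B) using 2
      funext p
      exact M.Kc_true_neg i p r (by omega)

end BoxModel

namespace BoxModel

open BoxLattice

variable {n : ℕ} {q d : ℂ} {P β : Type*} [DecidableEq β] (M : BoxModel n q d P β)
variable {V : Type*} [AddCommGroup V] [Module ℂ V] (B : Module.Basis P ℂ V)

/-! ### The defining relations -/

theorem K_E_relation (ε : Bool) (i j : ZMod n) (r s : ℤ) :
    q ^ cartanA i j • (diag B (fun p => M.Kc ε i p r) * M.opE B j (s + 1))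
        - d ^ skewM i j • (diag B (fun p => M.Kc ε i p (r + 1)) * M.opE B j s)
      = M.opE B j (s + 1) * diag B (fun p => M.Kc ε i p r)
        - (d ^ skewM i j * q ^ cartanA i j) •
          (M.opE B j s * diag B (fun p => M.Kc ε i p (r + 1))) := by
  refine B.ext fun p => ?_
  simp only [LinearMap.sub_apply, LinearMap.smul_apply, Module.End.mul_apply, diag_apply, map_smul,
    opE_apply, map_sum, Finset.smul_sum, ← Finset.sum_sub_distrib]
  refine Finset.sum_congr rfl fun b hb => ?_
  obtain ⟨p', h⟩ := M.cov_of_mem_adds hb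
  rw [eps_cov B h, mode_succ]
  simp only [map_smul, diag_apply]
  by_cases hj : M.col b = j
  · subst hj
    have := M.Kc_cov h ε i r
    linear_combination (norm := module) (M.mode (M.col b) s b * M.e p b) • congrArg (· • B p') this
  · simp [M.mode_eq_zero hj]

theorem K_F_relation (ε : Bool) (i j : ZMod n) (r s : ℤ) :
    diag B (fun p => M.Kc ε i p r) * M.opF B j (s + 1)
        - (d ^ skewM i j * q ^ cartanA i j) •
          (diag B (fun p => M.Kc ε i p (r + 1)) * M.opF B j s)
      = q ^ cartanA i j • (M.opF B j (s + 1) * diag B (fun p => M.Kc ε i p r))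
        - d ^ skewM i j • (M.opF B j s * diag B (fun p => M.Kc ε i p (r + 1))) := by
  refine B.ext fun p => ?_
  simp only [LinearMap.sub_apply, LinearMap.smul_apply, Module.End.mul_apply, diag_apply, map_smul,
    opF_apply, map_sum, Finset.smul_sum, ← Finset.sum_sub_distrib]
  refine Finset.sum_congr rfl fun b hb => ?_
  obtain ⟨p', h⟩ := M.mem_rems.1 hb
  rw [phi_cov B h, mode_succ]
  simp only [map_smul, diag_apply]
  by_cases hj : M.col b = j
  · subst hj
    have := M.Kc_cov h ε i r
    linear_combination (norm := module)
      (-(M.mode (M.col b) s b * M.f p' b)) • congrArg (· • B p') this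
  · simp [M.mode_eq_zero hj]

/-- Different boxes drop out by `eps_phi_comm`. A single box contributes ef when removable and -ef
when addable, which is `Kc_sub`; for i ≠ j no box has both colours. -/
theorem E_F_relation (hq : q - q⁻¹ ≠ 0) (i j : ZMod n) (r s : ℤ) :
    M.opE B i r * M.opF B j s - M.opF B j s * M.opE B i r
      = if i = j then (q - q⁻¹)⁻¹ •
          (diag B (fun p => M.Kc true i p (r + s)) - diag B (fun p => M.Kc false i p (r + s)))
        else 0 := by
  refine B.ext fun p => ?_
  obtain ⟨U, h1, h2, hU⟩ := ((((M.opE_isLocalSum B i r).mul (M.opF_isLocalSum B j s) (B p)).and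
    (((M.opF_isLocalSum B j s).mul (M.opE_isLocalSum B i r) (B p)).and
    (Filter.eventually_ge_atTop (M.adds p ∪ M.rems p))))).exists
  simp only [LinearMap.sub_apply, Module.End.mul_apply, h1, h2]
  rw [Finset.sum_comm (f := fun b a => (M.mode j s b * M.mode i r a) • M.phi B b (M.eps B a (B p)))]
  simp only [← Finset.sum_sub_distrib]
  have hdiag : ∀ b ∈ U, ∑ a ∈ U, ((M.mode i r b * M.mode j s a) • M.eps B b (M.phi B a (B p))
      - (M.mode j s a * M.mode i r b) • M.phi B a (M.eps B b (B p)))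
      = (M.mode i r b * M.mode j s b) • (M.eps B b (M.phi B b (B p)) - M.phi B b (M.eps B b (B p)))
      := by
    intro b hb
    rw [Finset.sum_eq_single_of_mem b hb]
    · rw [smul_sub, mul_comm (M.mode j s b)]
    · intro a _ hab
      have := LinearMap.congr_fun (eps_phi_comm (M := M) B hab.symm) (B p)
      simp only [Module.End.mul_apply] at this
      rw [this, mul_comm (M.mode j s a), sub_self]
  rw [Finset.sum_congr rfl hdiag]
  by_cases hij : i = j
  · subst hij
    rw [if_pos rfl]
    simp only [LinearMap.smul_apply, LinearMap.sub_apply, diag_apply]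
    rw [← sub_smul, M.Kc_sub, smul_smul, ← mul_assoc, inv_mul_cancel₀ hq, one_mul, sub_smul]
    have hU' := Finset.union_subset_iff.1 hU
    simp only [smul_sub, Finset.sum_sub_distrib, Finset.sum_smul]
    congr 1
    · symm
      rw [Finset.sum_subset_zero_on_sdiff hU'.2]
      · intro b hb
        rw [phi_apply, if_neg (Finset.mem_sdiff.1 hb).2, map_zero, smul_zero]
      · intro b hb
        obtain ⟨p', h⟩ := M.mem_rems.1 hb
        rw [phi_cov B h, map_smul, eps_cov B h, h.dn_eq, smul_smul, smul_smul]
        congr 1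
        by_cases hc : M.col b = i
        · simp only [mode, hc, if_true]
          rw [zpow_add₀ (M.loc_ne b)]; ring
        · simp [M.mode_eq_zero hc, hc]
    · symm
      rw [Finset.sum_subset_zero_on_sdiff hU'.1]
      · intro b hb
        rw [eps_apply, if_neg (Finset.mem_sdiff.1 hb).2, map_zero, smul_zero]
      · intro b hb
        obtain ⟨p', h⟩ := M.cov_of_mem_adds hb
        rw [eps_cov B h, map_smul, phi_cov B h, smul_smul, smul_smul]
        congr 1
        by_cases hc : M.col b = i
        · simp only [mode, hc, if_true]
          rw [zpow_add₀ (M.loc_ne b)]; ring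
        · simp [M.mode_eq_zero hc, hc]
  · rw [if_neg hij, LinearMap.zero_apply]
    refine Finset.sum_eq_zero fun b _ => ?_
    by_cases hc : M.col b = i
    · rw [M.mode_eq_zero (i := j) (fun h => hij (hc.symm.trans h)), mul_zero, zero_smul]
    · rw [M.mode_eq_zero hc, zero_mul, zero_smul]

theorem cartanA_self (i : ZMod n) : cartanA i i = 2 := if_pos rfl

theorem skewM_self (hn : 3 ≤ n) (i : ZMod n) : skewM i i = 0 := by
  have := skewM_comm hn i i; omega

theorem two_ne_zero_zmod (hn : 3 ≤ n) : (2 : ZMod n) ≠ 0 := by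
  intro h
  have := (ZMod.natCast_eq_zero_iff 2 n).1 (by exact_mod_cast h)
  exact absurd (Nat.le_of_dvd (by norm_num) this) (by omega)

theorem one_ne_zero_zmod (hn : 3 ≤ n) : (1 : ZMod n) ≠ 0 := by
  intro h
  have := (ZMod.natCast_eq_zero_iff 1 n).1 (by exact_mod_cast h)
  exact absurd (Nat.le_of_dvd (by norm_num) this) (by omega)

theorem cartanA_adj (hn : 3 ≤ n) {i j : ZMod n} (h : j = i + 1 ∨ i = j + 1) :
    cartanA i j = -1 := by
  have h1 := one_ne_zero_zmod hn
  unfold cartanA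
  rw [if_neg, if_pos h]
  rintro rfl
  rcases h with h | h <;> exact h1 (by linear_combination -h)

theorem skewM_succ {i j : ZMod n} (h : j = i + 1) : skewM i j = -1 := if_pos h

theorem skewM_pred (hn : 3 ≤ n) {i j : ZMod n} (h : i = j + 1) : skewM i j = 1 := by
  rw [skewM_comm hn, skewM_succ h, neg_neg]

/-- The exchange relation with an adjacent colour, in the form used for the Serre relations. -/
theorem exchange_adj (hn : 3 ≤ n) (hq : q ≠ 0) (hd : d ≠ 0) {A : Type*} [AddCommGroup A]
    [Module ℂ A] {i j : ZMod n} (h : j = i + 1 ∨ i = j + 1) {x w : ℂ} {X Y : A}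
    (hXY : (d ^ skewM i j * x - q ^ cartanA i j * w) • X
      = (d ^ skewM i j * q ^ cartanA i j * x - w) • Y) :
    (q * x - (d ^ skewM i j)⁻¹ * w) • X = (x - q * ((d ^ skewM i j)⁻¹ * w)) • Y := by
  rw [cartanA_adj hn h, zpow_neg_one] at hXY
  have hD : d ^ skewM i j ≠ 0 := zpow_ne_zero _ hd
  have := congrArg ((q * (d ^ skewM i j)⁻¹) • ·) hXY
  simp only [smul_smul] at this
  convert this using 2 <;> field_simp

/-- This coincidence places the third box at the q₃-neighbour or the q₁-neighbour of the box at x,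
which is the position of the middle box of a wheel. -/
theorem not_wheel_of_ne (hn : 3 ≤ n) (hq : q ≠ 0) (hd : d ≠ 0) {i j : ZMod n}
    (h : j = i + 1 ∨ i = j + 1) {x w : ℂ} (hx : x = q * ((d ^ skewM i j)⁻¹ * w)) :
    (j = i + 1 ∧ w = 1 / (d * q) * x) ∨ (i = j + 1 ∧ w = d / q * x) := by
  rcases h with h | h
  · refine Or.inl ⟨h, ?_⟩
    rw [hx, skewM_succ h]; field_simp
  · refine Or.inr ⟨h, ?_⟩
    rw [hx, skewM_pred hn h]; field_simp

theorem sum_eq_zero_of_six {A : Type*} [AddCommGroup A] [Module ℂ A] {c : ℂ}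
    {a₁ a₂ a₃ a₄ a₅ a₆ : A} (h1 : a₁ = 0) (h2 : a₂ = 0) (h3 : a₃ = 0) (h4 : a₄ = 0) (h5 : a₅ = 0)
    (h6 : a₆ = 0) : (a₁ - c • a₂ + a₃) + (a₄ - c • a₅ + a₆) = 0 := by
  simp [h1, h2, h3, h4, h5, h6]

theorem q_sub_inv_ne {q : ℂ} (hq : q ≠ 0) (hq4 : q ^ 4 ≠ 1) : q - q⁻¹ ≠ 0 := by
  intro h
  apply hq4
  have : q * q = 1 := by
    have := congrArg (q * ·) h
    simp only [mul_sub, mul_inv_cancel₀ hq, mul_zero] at this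
    linear_combination this
  linear_combination (q * q + 1) * this

section

variable (hn : 3 ≤ n) (hq : q ≠ 0) (hd : d ≠ 0) (hq4 : q ^ 4 ≠ 1)
include hn hq hd hq4

omit hq4 in
/-- A wheel of three boxes cannot be added to any configuration. -/
theorem wheel_cells {x y z : β} (hxy : M.col x = M.col y)
    (hz : (M.col z = M.col x + 1 ∨ M.col x = M.col z + 1))
    (hw : M.loc x = q ^ 2 * M.loc y ∧
      M.loc x = q * ((d ^ skewM (M.col x) (M.col z))⁻¹ * M.loc z)) (p s : P)
    (hx : x ∉ M.cells p) (hy : y ∉ M.cells p) (hz' : z ∉ M.cells p) :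
    M.cells s ≠ insert x (insert y (insert z (M.cells p))) :=
  M.wheel p s x y z hxy (not_wheel_of_ne hn hq hd hz hw.2) hw.1 hx hy hz'

/-- If the three boxes can never be added together, each word is zero. Otherwise they form no wheel,
and this excludes the two coincidences in `serre_of_exchange`. -/
theorem eps_serre {x y z : β} (hxy : M.col x = M.col y)
    (hz : (M.col z = M.col x + 1 ∨ M.col x = M.col z + 1)) :
    (M.eps B x * M.eps B y * M.eps B z - (q + q⁻¹) • (M.eps B x * M.eps B z * M.eps B y)
        + M.eps B z * M.eps B x * M.eps B y)
      + (M.eps B y * M.eps B x * M.eps B z - (q + q⁻¹) • (M.eps B y * M.eps B z * M.eps B x)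
        + M.eps B z * M.eps B y * M.eps B x) = 0 := by
  have hq' := q_sub_inv_ne hq hq4
  by_cases hw : (∀ p s, x ≠ y → x ≠ z → y ≠ z → x ∉ M.cells p → y ∉ M.cells p → z ∉ M.cells p →
      M.cells s ≠ insert x (insert y (insert z (M.cells p))))
  · have hw' : ∀ p s, x ≠ y → x ≠ z → y ≠ z → x ∉ M.cells p → y ∉ M.cells p → z ∉ M.cells p →
      M.cells s ≠ insert x (insert y (insert z (M.cells p))) := hw
    refine sum_eq_zero_of_six ?_ ?_ ?_ ?_ ?_ ?_ <;> refine eps_triple_eq_zero B ?_ <;>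
      intro p s h1 h2 h3 h4 h5 h6 h7 <;> refine hw p s ?_ ?_ ?_ ?_ ?_ ?_ ?_ <;>
      first
        | assumption
        | exact Ne.symm (by assumption)
        | (rw [h7]; ext b; simp only [Finset.mem_insert]; tauto)
  · have e1 := (M.isExchange hq' hn hd y x).eps_mul B
    have e2 := exchange_adj hn hq hd hz ((M.isExchange hq' hn hd z x).eps_mul B)
    have e3 := exchange_adj hn hq hd (hxy ▸ hz) ((M.isExchange hq' hn hd z y).eps_mul B)
    rw [← hxy] at e3
    rw [hxy, cartanA_self, skewM_self hn, zpow_zero, one_mul, one_mul] at e1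
    refine serre_of_exchange hq hq4 (M.loc_ne x)
      (mul_ne_zero (inv_ne_zero (zpow_ne_zero _ hd)) (M.loc_ne z)) e1 e2 e3 ?_ ?_
    · intro h
      exact hw fun p s _ _ _ hx hy hz' => M.wheel_cells hn hq hd hxy hz h p s hx hy hz'
    · intro h
      refine hw fun p s _ _ _ hx hy hz' h' => ?_
      refine M.wheel_cells hn hq hd hxy.symm (hxy ▸ hz) (by rw [← hxy]; exact h) p s hy hx hz' ?_
      rw [h', Finset.insert_comm]

theorem phi_serre {x y z : β} (hxy : M.col x = M.col y)
    (hz : (M.col z = M.col x + 1 ∨ M.col x = M.col z + 1)) :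
    (M.phi B x * M.phi B y * M.phi B z - (q + q⁻¹) • (M.phi B x * M.phi B z * M.phi B y)
        + M.phi B z * M.phi B x * M.phi B y)
      + (M.phi B y * M.phi B x * M.phi B z - (q + q⁻¹) • (M.phi B y * M.phi B z * M.phi B x)
        + M.phi B z * M.phi B y * M.phi B x) = 0 := by
  have hq' := q_sub_inv_ne hq hq4
  by_cases hw : (∀ p s, x ≠ y → x ≠ z → y ≠ z → x ∉ M.cells p → y ∉ M.cells p → z ∉ M.cells p →
      M.cells s ≠ insert x (insert y (insert z (M.cells p))))
  · refine sum_eq_zero_of_six ?_ ?_ ?_ ?_ ?_ ?_ <;> refine phi_triple_eq_zero B ?_ <;>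
      intro p s h1 h2 h3 h4 h5 h6 h7 <;> refine hw p s ?_ ?_ ?_ ?_ ?_ ?_ ?_ <;>
      first
        | assumption
        | exact Ne.symm (by assumption)
        | (rw [h7]; ext b; simp only [Finset.mem_insert]; tauto)
  · have e1 := (M.isExchange hq' hn hd y x).phi_mul B
    have e2 := exchange_adj hn hq hd hz ((M.isExchange hq' hn hd z x).phi_mul B)
    have e3 := exchange_adj hn hq hd (hxy ▸ hz) ((M.isExchange hq' hn hd z y).phi_mul B)
    rw [← hxy] at e3
    rw [hxy, cartanA_self, skewM_self hn, zpow_zero, one_mul, one_mul] at e1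
    -- Removals compose in the order opposite to additions, so the exchange relations of the φ are
    -- those of the ε in the opposite algebra.
    have key := serre_of_exchange (A := (Module.End ℂ V)ᵐᵒᵖ) (X := .op (M.phi B x))
      (Y := .op (M.phi B y)) (Z := .op (M.phi B z)) hq hq4 (M.loc_ne x)
      (mul_ne_zero (inv_ne_zero (zpow_ne_zero _ hd)) (M.loc_ne z))
      (congrArg MulOpposite.op e1) (congrArg MulOpposite.op e2) (congrArg MulOpposite.op e3) ?_ ?_
    · have := congrArg MulOpposite.unop key
      simp only [MulOpposite.unop_add, MulOpposite.unop_sub, MulOpposite.unop_smul,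
        MulOpposite.unop_mul, MulOpposite.unop_op, MulOpposite.unop_zero, ← mul_assoc] at this
      rw [← this]; abel
    · intro h
      exact hw fun p s _ _ _ hx hy hz' => M.wheel_cells hn hq hd hxy hz h p s hx hy hz'
    · intro h
      refine hw fun p s _ _ _ hx hy hz' h' => ?_
      refine M.wheel_cells hn hq hd hxy.symm (hxy ▸ hz) (by rw [← hxy]; exact h) p s hy hx hz' ?_
      rw [h', Finset.insert_comm]

theorem freeAction_rel {x y : FreeAlgebra ℂ (ToroidalGen n)} (h : ToroidalRel n q d x y) :
    M.freeAction B x = M.freeAction B y := by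
  have hq' := q_sub_inv_ne hq hq4
  cases h with
  | K_Kinv i =>
    rw [map_mul, freeAction_K, freeAction_Kinv, ← map_mul, map_one, ← map_one (diag B)]
    congr 1; funext p; exact M.Kc_zero_mul i p
  | Kinv_K i =>
    rw [map_mul, freeAction_K, freeAction_Kinv, ← map_mul, map_one, ← map_one (diag B)]
    congr 1; funext p; exact (mul_comm _ _).trans (M.Kc_zero_mul i p)
  | K_K ε ε' i j r s =>
    simp only [map_mul, M.freeAction_Kcur B hq']
    rw [← map_mul, ← map_mul, mul_comm]
  | K_E ε i j r s =>
    simp only [map_mul, map_sub, map_smul, M.freeAction_Kcur B hq', freeAction_E]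
    exact M.K_E_relation B ε i j r s
  | K_F ε i j r s =>
    simp only [map_mul, map_sub, map_smul, M.freeAction_Kcur B hq', freeAction_F]
    exact M.K_F_relation B ε i j r s
  | E_F i j r s =>
    have := M.E_F_relation B hq' i j r s
    rw [apply_ite (M.freeAction B)]
    simp only [map_mul, map_sub, map_smul, map_zero, M.freeAction_Kcur B hq', freeAction_F,
      freeAction_E]
    exact this
  | E_E i j r s =>
    simp only [map_mul, map_sub, map_smul, freeAction_E]
    refine quadratic_relation (M.opE_isLocalSum B) ?_ r s
    rintro b a rfl rfl
    exact (M.isExchange hq' hn hd a b).eps_mul B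
  | F_F i j r s =>
    simp only [map_mul, map_sub, map_smul, freeAction_F]
    refine quadratic_relation (M.opF_isLocalSum B) ?_ r s
    rintro b a rfl rfl
    -- After division by q^a the two exchange factors trade places and become the factors in the
    -- relation for F.
    have := congrArg (q ^ (-cartanA (M.col b) (M.col a)) • ·)
      ((M.isExchange hq' hn hd a b).phi_mul B)
    simp only [smul_smul] at this
    have hQ : q ^ cartanA (M.col b) (M.col a) ≠ 0 := zpow_ne_zero _ hq
    rw [zpow_neg] at this ⊢
    rw [eq_comm]
    convert this using 2 <;> field_simp
  | E_serre i j hij r₁ r₂ s =>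
    simp only [map_mul, map_sub, map_add, map_smul, map_zero, freeAction_E]
    refine serre_relation (M.opE_isLocalSum B) ?_ r₁ r₂ s
    rintro x y z rfl hy rfl
    exact M.eps_serre B hn hq hd hq4 hy.symm hij
  | F_serre i j hij r₁ r₂ s =>
    simp only [map_mul, map_sub, map_add, map_smul, map_zero, freeAction_F]
    refine serre_relation (M.opF_isLocalSum B) ?_ r₁ r₂ s
    rintro x y z rfl hy rfl
    exact M.phi_serre B hn hq hd hq4 hy.symm hij
  | E_comm i j h h₁ h₂ r s =>
    simp only [map_mul, freeAction_E]
    refine comm_relation (M.opE_isLocalSum B) ?_ r s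
    rintro b a rfl rfl
    have := (M.isExchange_one hq' a b (by simp [cartanA, h, h₁, h₂])).eps_mul B
    simpa using this
  | F_comm i j h h₁ h₂ r s =>
    simp only [map_mul, freeAction_F]
    refine comm_relation (M.opF_isLocalSum B) ?_ r s
    rintro b a rfl rfl
    have := (M.isExchange_one hq' a b (by simp [cartanA, h, h₁, h₂])).phi_mul B
    simpa using this.symm

/-- The representation defined by a box model. -/
def rep : QToroidal n q d →ₐ[ℂ] Module.End ℂ V :=
  RingQuot.liftAlgHom ℂ ⟨M.freeAction B, fun _ _ h => M.freeAction_rel B hn hq hd hq4 h⟩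

theorem rep_mk (x : FreeAlgebra ℂ (ToroidalGen n)) :
    M.rep B hn hq hd hq4 (RingQuot.mkAlgHom ℂ _ x) = M.freeAction B x :=
  RingQuot.liftAlgHom_mkAlgHom_apply ..

theorem rep_E (i : ZMod n) (r : ℤ) :
    M.rep B hn hq hd hq4 (QToroidal.E i r) = M.opE B i r :=
  (M.rep_mk B hn hq hd hq4 _).trans (M.freeAction_E B i r)

theorem rep_F (i : ZMod n) (r : ℤ) :
    M.rep B hn hq hd hq4 (QToroidal.F i r) = M.opF B i r :=
  (M.rep_mk B hn hq hd hq4 _).trans (M.freeAction_F B i r)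

theorem rep_Kcur (ε : Bool) (i : ZMod n) (r : ℤ) :
    M.rep B hn hq hd hq4 (QToroidal.Kcur ε i r) = diag B fun p => M.Kc ε i p r :=
  (M.rep_mk B hn hq hd hq4 _).trans (M.freeAction_Kcur B (q_sub_inv_ne hq hq4) ε i r)

theorem rep_Kinv (i : ZMod n) :
    M.rep B hn hq hd hq4 (QToroidal.Kinv i) = diag B fun p => M.Kc false i p 0 :=
  (M.rep_mk B hn hq hd hq4 _).trans (M.freeAction_Kinv B i)

end

end BoxModel

/-! ### Weights, irreducibility, grading and level of the module of a box model. -/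

namespace BoxModel

open BoxLattice

variable {n : ℕ} {q d : ℂ} {P β : Type*} [DecidableEq β] (M : BoxModel n q d P β)
variable {V : Type*} [AddCommGroup V] [Module ℂ V] (B : Module.Basis P ℂ V)

theorem repr_diag (g : P → ℂ) (v : V) (p : P) :
    B.repr (diag B g v) p = g p * B.repr v p := by
  have : (B.coord p).comp (diag B g) = g p • B.coord p := by
    refine B.ext fun p' => ?_
    simp only [LinearMap.comp_apply, LinearMap.smul_apply, diag_apply, map_smul,
      Module.Basis.coord_apply, Module.Basis.repr_self, smul_eq_mul]
    by_cases h : p' = p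
    · rw [h]
    · simp [h]
  exact LinearMap.congr_fun this v

section

variable (hn : 3 ≤ n) (hq : q ≠ 0) (hd : d ≠ 0) (hq4 : q ^ 4 ≠ 1)

theorem hasWeight_basis (p : P) :
    HasWeight (M.rep B hn hq hd hq4) (fun ε i r => M.Kc ε i p r) (B p) := fun ε i r => by
  rw [rep_Kcur, diag_apply]

theorem rep_isWeighted : IsWeighted (M.rep B hn hq hd hq4) := by
  rw [IsWeighted, eq_top_iff, ← B.span_eq, Submodule.span_le]
  rintro _ ⟨p, rfl⟩
  exact Submodule.subset_span ⟨_, M.hasWeight_basis B hn hq hd hq4 p⟩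

variable {M B hn hq hd hq4} in
theorem Kc_eq_of_hasWeight {φ : Bool → ZMod n → ℤ → ℂ} {v : V}
    (h : HasWeight (M.rep B hn hq hd hq4) φ v) {p : P} (hp : B.repr v p ≠ 0) (ε : Bool)
    (i : ZMod n) (r : ℤ) : M.Kc ε i p r = φ ε i r := by
  have h1 := h ε i r
  rw [rep_Kcur] at h1
  have h2 := congrArg (fun w => B.repr w p) h1
  simp only [repr_diag, map_smul, Finsupp.smul_apply, smul_eq_mul] at h2
  exact mul_right_cancel₀ hp h2

variable {M B hn hq hd hq4} in
theorem eq_of_hasWeight {φ : Bool → ZMod n → ℤ → ℂ} {v w : V}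
    (hv : HasWeight (M.rep B hn hq hd hq4) φ v) (hw : HasWeight (M.rep B hn hq hd hq4) φ w)
    {p p' : P} (hp : B.repr v p ≠ 0) (hp' : B.repr w p' ≠ 0) : p' = p :=
  M.weight_inj p' p fun ε i r =>
    (Kc_eq_of_hasWeight hw hp' ε i r).trans (Kc_eq_of_hasWeight hv hp ε i r).symm

theorem eq_smul_basis {v : V} {p : P} (h : ∀ p', B.repr v p' ≠ 0 → p' = p) :
    v = B.repr v p • B p := by
  apply B.repr.injective
  ext p'
  rw [map_smul, Module.Basis.repr_self, Finsupp.smul_apply, smul_eq_mul]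
  by_cases hp : p = p'
  · subst hp; simp
  · rw [Finsupp.single_eq_of_ne (Ne.symm hp), mul_zero]
    by_contra h'
    exact hp (h p' h').symm

/-- The basis vectors have pairwise different weights, so a weight vector is a multiple of one of
them. -/
theorem rep_isTame : IsTame (M.rep B hn hq hd hq4) := by
  refine ⟨M.rep_isWeighted B hn hq hd hq4, fun φ v w hv hw hv0 => ?_⟩
  obtain ⟨p, hp⟩ : ∃ p, B.repr v p ≠ 0 := by
    by_contra! h
    exact hv0 (B.repr.injective (by ext p; simp [h p]))
  have hv' := eq_smul_basis B fun p' hp' => eq_of_hasWeight hv hv hp hp'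
  have hw' : ∀ p', B.repr w p' ≠ 0 → p' = p := fun p' hp' => eq_of_hasWeight hv hw hp hp'
  refine ⟨B.repr w p * (B.repr v p)⁻¹, ?_⟩
  have hv'' : (B.repr v p)⁻¹ • v = B p := by
    conv_lhs => rw [hv']
    rw [map_smul, Module.Basis.repr_self, smul_smul]
    simp [hp]
  rw [mul_smul, hv'']
  exact eq_smul_basis B hw'

-- Induction on the size of the support: subtracting the eigenvalue at another configuration `p'` of
-- the support removes `p'` and keeps a nonzero coefficient at `p`.
variable {M B hn hq hd hq4} in
theorem basis_mem_of_repr_ne_zero {W : Submodule ℂ V}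
    (hW : IsInvariantSubspace (M.rep B hn hq hd hq4) W) {v : V} (hv : v ∈ W) {p : P}
    (hp : B.repr v p ≠ 0) : B p ∈ W := by
  induction hN : (B.repr v).support.card using Nat.strong_induction_on generalizing v with
  | _ N ih =>
    by_cases h : ∀ p', B.repr v p' ≠ 0 → p' = p
    · have := eq_smul_basis B h
      rw [this] at hv
      exact (W.smul_mem_iff hp).1 hv
    · push Not at h
      obtain ⟨p', hp', hne⟩ := h
      obtain ⟨ε, i, r, hK⟩ : ∃ ε i r, M.Kc ε i p r ≠ M.Kc ε i p' r := by
        by_contra! h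
        exact hne (M.weight_inj p p' h).symm
      have hv' : diag B (fun p => M.Kc ε i p r) v - M.Kc ε i p' r • v ∈ W := by
        refine W.sub_mem ?_ (W.smul_mem _ hv)
        rw [← M.rep_Kcur B hn hq hd hq4]
        exact hW _ v hv
      have hrepr : ∀ s, B.repr (diag B (fun p => M.Kc ε i p r) v - M.Kc ε i p' r • v) s
          = (M.Kc ε i s r - M.Kc ε i p' r) * B.repr v s := by
        intro s
        rw [map_sub, map_smul, Finsupp.sub_apply, Finsupp.smul_apply, repr_diag, smul_eq_mul, sub_mul]
      refine ih _ ?_ hv' ?_ rfl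
      · rw [← hN]
        refine Finset.card_lt_card ⟨fun s hs => ?_, fun hsub => ?_⟩
        · rw [Finsupp.mem_support_iff, hrepr] at hs
          exact Finsupp.mem_support_iff.2 (right_ne_zero_of_mul hs)
        · have := hsub (Finsupp.mem_support_iff.2 hp')
          rw [Finsupp.mem_support_iff, hrepr, sub_self, zero_mul] at this
          exact this rfl
      · rw [hrepr]
        exact mul_ne_zero (sub_ne_zero.2 hK) hp

theorem repr_opE_of_cov {p p' : P} {b : β} (h : M.Cov p b p') :
    B.repr (M.opE B (M.col b) 0 (B p)) p' = M.e p b := by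
  rw [opE_apply, map_sum, Finsupp.finsetSum_apply, Finset.sum_eq_single_of_mem b h.mem_adds]
  · rw [eps_cov B h]; simp [mode]
  · intro c hc hcb
    obtain ⟨s, hs⟩ := M.cov_of_mem_adds hc
    rw [eps_cov B hs]
    have : s ≠ p' := by rintro rfl; exact hcb (hs.box_eq h)
    simp [this]

theorem repr_opF_of_cov {p p' : P} {b : β} (h : M.Cov p b p') :
    B.repr (M.opF B (M.col b) 0 (B p')) p = M.f p b := by
  rw [opF_apply, map_sum, Finsupp.finsetSum_apply,
    Finset.sum_eq_single_of_mem b (M.mem_rems.2 ⟨p, h⟩)]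
  · rw [phi_cov B h]; simp [mode]
  · intro c hc hcb
    obtain ⟨s, hs⟩ := M.mem_rems.1 hc
    rw [phi_cov B hs]
    have : s ≠ p := by
      rintro rfl
      have h1 := hs.2.symm.trans h.2
      have : c ∈ insert b (M.cells s) := by rw [← h1]; exact Finset.mem_insert_self _ _
      rcases Finset.mem_insert.1 this with h2 | h2
      · exact hcb h2
      · exact hs.1 h2
    simp [this]

-- Every configuration is reached from the vacuum by adding boxes. The coefficient e of each step is
-- nonzero, and the new basis vector can be projected out inside `W`.
variable {M B hn hq hd hq4} in
theorem vac_generates {W : Submodule ℂ V} (hW : IsInvariantSubspace (M.rep B hn hq hd hq4) W)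
    (h0 : B M.vac ∈ W) : W = ⊤ := by
  rw [eq_top_iff, ← B.span_eq, Submodule.span_le]
  rintro _ ⟨p, rfl⟩
  induction p using M.toBoxLattice.vac_induction with
  | h0 => exact h0
  | hstep p b p' h hp =>
    refine basis_mem_of_repr_ne_zero hW (hW (QToroidal.E (M.col b) 0) _ hp) ?_
    rw [rep_E, M.repr_opE_of_cov B h]
    exact M.e_ne h

variable {M B hn hq hd hq4} in
theorem vac_mem {W : Submodule ℂ V} (hW : IsInvariantSubspace (M.rep B hn hq hd hq4) W) (p : P)
    (hp : B p ∈ W) : B M.vac ∈ W := by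
  induction p using M.toBoxLattice.vac_induction with
  | h0 => exact hp
  | hstep p b p' h ih =>
    refine ih (basis_mem_of_repr_ne_zero hW (hW (QToroidal.F (M.col b) 0) _ hp) ?_)
    rw [rep_F, M.repr_opF_of_cov B h]
    exact M.f_ne h

theorem rep_isIrreducible : IsIrreducibleRep (M.rep B hn hq hd hq4) := by
  refine ⟨⟨⟨B M.vac, 0, B.ne_zero _⟩⟩, fun W hW => ?_⟩
  by_cases h : W = ⊥
  · exact Or.inl h
  · right
    obtain ⟨v, hv, hv0⟩ := W.exists_mem_ne_zero_of_ne_bot h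
    obtain ⟨p, hp⟩ : ∃ p, B.repr v p ≠ 0 := by
      by_contra! h
      exact hv0 (B.repr.injective (by ext p; simp [h p]))
    exact vac_generates hW (vac_mem hW p (basis_mem_of_repr_ne_zero hW hv hp))

theorem rep_isLowestWeight : IsLowestWeight (M.rep B hn hq hd hq4) := by
  refine ⟨B M.vac, B.ne_zero _, fun i r => ?_, ⟨_, M.hasWeight_basis B hn hq hd hq4 _⟩,
    fun W hW h0 => vac_generates hW h0⟩
  rw [rep_F, opF_apply]
  refine Finset.sum_eq_zero fun b hb => ?_
  obtain ⟨s, hs⟩ := M.mem_rems.1 hb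
  have := hs.2
  rw [M.cells_vac] at this
  exact absurd this.symm (Finset.insert_ne_empty _ _)

/-- The number of boxes of each colour. -/
def content (p : P) (i : ZMod n) : ℤ := ((M.cells p).filter fun b => M.col b = i).card

open Classical in
theorem content_cov {p p' : P} {b : β} (h : M.Cov p b p') :
    M.content p' = M.content p + Pi.single (M.col b) 1 := by
  funext i
  rw [Pi.add_apply, content, content, h.2, Finset.filter_insert]
  by_cases hi : M.col b = i
  · rw [if_pos hi, Finset.card_insert_of_notMem fun h' => h.1 (Finset.mem_filter.1 h').1]
    subst hi; simp
  · rw [if_neg hi, Pi.single_eq_of_ne (Ne.symm hi)]; simp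

theorem card_cells_eq (hn : n ≠ 0) (p : P) :
    ((M.cells p).card : ℤ) = haveI : NeZero n := ⟨hn⟩; ∑ i : ZMod n, M.content p i := by
  have : NeZero n := ⟨hn⟩
  rw [Finset.card_eq_sum_card_fiberwise (f := M.col) (t := Finset.univ) fun _ _ => Finset.mem_univ _]
  push_cast
  rfl

-- The degree counts the boxes of each colour. It determines the number of boxes, and only finitely
-- many configurations have a given number.
open Classical in
theorem rep_isQuasiFinite : IsQuasiFinite (M.rep B hn hq hd hq4) := by
  refine ⟨M.rep_isWeighted B hn hq hd hq4,
    fun δ => Submodule.span ℂ (B '' {p | M.content p = δ}), ?_, ?_, ?_⟩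
  · refine DirectSum.isInternal_submodule_of_iSupIndep_of_iSup_eq_top ?_ ?_
    · intro δ
      have h1 := B.linearIndependent.disjoint_span_image
        (s := {p | M.content p = δ}) (t := {p | M.content p ≠ δ})
        (Set.disjoint_left.2 fun p h h' => h' h)
      refine h1.mono_right (iSup₂_le fun δ' hδ' => Submodule.span_mono (Set.image_mono ?_))
      intro p hp
      simp only [Set.mem_ofPred_eq] at hp ⊢
      rw [hp]; exact hδ'
    · rw [eq_top_iff, ← B.span_eq, Submodule.span_le]
      rintro _ ⟨p, rfl⟩
      exact Submodule.mem_iSup_of_mem (M.content p) (Submodule.subset_span ⟨p, rfl, rfl⟩)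
  · intro δ v hv i r
    induction hv using Submodule.span_induction with
    | mem x hx =>
      obtain ⟨p, rfl, rfl⟩ := hx
      refine ⟨?_, ?_, fun ε => ?_⟩
      · rw [rep_E, opE_apply]
        refine Submodule.sum_mem _ fun b hb => ?_
        obtain ⟨p', h⟩ := M.cov_of_mem_adds hb
        by_cases hi : M.col b = i
        · rw [eps_cov B h]
          refine Submodule.smul_mem _ _ (Submodule.smul_mem _ _ (Submodule.subset_span ⟨p', ?_, rfl⟩))
          rw [Set.mem_ofPred_eq, M.content_cov h, hi]
        · rw [M.mode_eq_zero hi, zero_smul]; exact Submodule.zero_mem _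
      · rw [rep_F, opF_apply]
        refine Submodule.sum_mem _ fun b hb => ?_
        obtain ⟨p', h⟩ := M.mem_rems.1 hb
        by_cases hi : M.col b = i
        · rw [phi_cov B h]
          refine Submodule.smul_mem _ _ (Submodule.smul_mem _ _ (Submodule.subset_span ⟨p', ?_, rfl⟩))
          rw [Set.mem_ofPred_eq, eq_sub_iff_add_eq, M.content_cov h, hi]
        · rw [M.mode_eq_zero hi, zero_smul]; exact Submodule.zero_mem _
      · rw [rep_Kcur, diag_apply]
        exact Submodule.smul_mem _ _ (Submodule.subset_span ⟨p, rfl, rfl⟩)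
    | zero => simp
    | add x y _ _ hx hy =>
      simp only [map_add]
      exact ⟨Submodule.add_mem _ hx.1 hy.1, Submodule.add_mem _ hx.2.1 hy.2.1,
        fun ε => Submodule.add_mem _ (hx.2.2 ε) (hy.2.2 ε)⟩
    | smul c x _ hx =>
      simp only [map_smul]
      exact ⟨Submodule.smul_mem _ _ hx.1, Submodule.smul_mem _ _ hx.2.1,
        fun ε => Submodule.smul_mem _ _ (hx.2.2 ε)⟩
  · intro δ
    have : NeZero n := ⟨by omega⟩
    refine Module.Finite.span_of_finite ℂ (Set.Finite.image _ ?_)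
    refine (M.finite_card (∑ i : ZMod n, δ i).toNat).subset fun p hp => ?_
    have := M.card_cells_eq (by omega) p
    rw [Set.mem_ofPred_eq] at hp ⊢
    rw [hp] at this
    omega

/-- K⁻ has no coefficient of z⁻¹, so the recursion at r = 0 relates only the constant terms. -/
theorem Kc_false_cov {p p' : P} {b : β} (h : M.Cov p b p') (i : ZMod n) :
    q ^ cartanA i (M.col b) * M.Kc false i p' 0 = M.Kc false i p 0 := by
  have := M.Kc_cov h false i 0
  rw [M.Kc_false_pos i p' (0 + 1) (by norm_num), M.Kc_false_pos i p (0 + 1) (by norm_num), mul_zero,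
    mul_zero, sub_zero, sub_zero] at this
  refine mul_left_cancel₀ (M.loc_ne b) ?_
  linear_combination this

theorem prod_range_zmod [NeZero n] (g : ZMod n → ℂ) :
    ∏ i ∈ Finset.range n, g (i : ZMod n) = ∏ i : ZMod n, g i := by
  refine Finset.prod_nbij' (fun i => (i : ZMod n)) ZMod.val (fun _ _ => Finset.mem_univ _)
    (fun i _ => Finset.mem_range.2 (ZMod.val_lt i)) (fun i hi => ?_) (fun i _ => ?_) (fun _ _ => rfl)
  · exact ZMod.val_cast_of_lt (Finset.mem_range.1 hi)
  · exact ZMod.natCast_zmod_val i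

theorem sum_cartanA (hn : 3 ≤ n) [NeZero n] (j : ZMod n) : ∑ i : ZMod n, cartanA i j = 0 := by
  have h1 := one_ne_zero_zmod hn
  have h2 := two_ne_zero_zmod hn
  have key : ∀ i : ZMod n, cartanA i j = (if i = j then (2 : ℤ) else 0)
      + (if i = j - 1 then (-1 : ℤ) else 0) + (if i = j + 1 then (-1 : ℤ) else 0) := by
    intro i
    by_cases ha : i = j
    · subst ha
      rw [cartanA_self, if_pos rfl, if_neg, if_neg]
      · rfl
      · intro h; exact h1 (by linear_combination -h)
      · intro h; exact h1 (by linear_combination h)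
    · rw [if_neg ha]
      by_cases hb : i = j - 1
      · rw [if_pos hb, if_neg, cartanA_adj hn (Or.inl (by rw [hb]; ring))]
        · rfl
        · intro h; exact h2 (by linear_combination hb - h)
      · rw [if_neg hb]
        by_cases hc : i = j + 1
        · rw [if_pos hc, cartanA_adj hn (Or.inr hc)]; rfl
        · rw [if_neg hc, cartanA, if_neg ha, if_neg]
          · rfl
          · rintro (h | h)
            · exact hb (by rw [h]; ring)
            · exact hc h
  simp only [key, Finset.sum_add_distrib, Finset.sum_ite_eq', Finset.mem_univ, if_true]
  rfl

theorem prod_zpow_eq {ι : Type*} (hq : q ≠ 0) (s : Finset ι) (g : ι → ℤ) :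
    ∏ i ∈ s, q ^ g i = q ^ ∑ i ∈ s, g i := by
  classical
  induction s using Finset.induction_on with
  | empty => simp
  | insert a s ha ih => rw [Finset.prod_insert ha, Finset.sum_insert ha, zpow_add₀ hq, ih]

/-- The columns of the affine Cartan matrix sum to zero, so adding a box does not change the product
and the level can be read off from the vacuum. -/
theorem prod_Kc_false [NeZero n] (hn : 3 ≤ n) (hq : q ≠ 0) (p : P) :
    ∏ i : ZMod n, M.Kc false i p 0 = ∏ i : ZMod n, M.Kc false i M.vac 0 := by
  induction p using M.toBoxLattice.vac_induction with
  | h0 => rfl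
  | hstep p b p' h ih =>
    rw [← ih]
    have : ∏ i : ZMod n, q ^ cartanA i (M.col b) = 1 := by
      rw [prod_zpow_eq hq, sum_cartanA hn, zpow_zero]
    rw [← Finset.prod_congr rfl fun i _ => M.Kc_false_cov h i, Finset.prod_mul_distrib, this, one_mul]

theorem rep_hasLevel [NeZero n] : HasLevel (M.rep B hn hq hd hq4)
    (∏ i : ZMod n, M.Kc false i M.vac 0) := by
  have h1 : M.rep B hn hq hd hq4 QToroidal.kappaInv
      = diag B fun p => ∏ i : ZMod n, M.Kc false i p 0 := by
    rw [QToroidal.kappaInv, map_list_prod, List.map_map]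
    have : ((M.rep B hn hq hd hq4) ∘ fun i : ℕ => (QToroidal.Kinv (i : ZMod n) : QToroidal n q d))
        = diag B ∘ fun (i : ℕ) (p : P) => M.Kc false (i : ZMod n) p 0 := by
      funext i; exact M.rep_Kinv B hn hq hd hq4 _
    rw [this, ← List.map_map, ← map_list_prod]
    congr 1
    funext p
    have h := map_list_prod (Pi.evalMonoidHom (fun _ : P => ℂ) p)
      ((List.range n).map fun (i : ℕ) (p : P) => M.Kc false (i : ZMod n) p 0)
    rw [List.map_map] at h
    rw [← prod_range_zmod]
    exact h
  intro v
  rw [h1]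
  have h2 : (fun p => ∏ i : ZMod n, M.Kc false i p 0)
      = algebraMap ℂ (P → ℂ) (∏ i : ZMod n, M.Kc false i M.vac 0) := by
    funext p; exact M.prod_Kc_false hn hq p
  rw [h2, AlgHom.commutes, Module.algebraMap_end_apply]

end

end BoxModel

/-! ## Values of rational functions -/

/-- The rational function `f` is regular at `x` with value `c`. -/
def HasVal (f : RatFunc ℂ) (x c : ℂ) : Prop :=
  f.denom.eval x ≠ 0 ∧ f.eval (RingHom.id ℂ) x = c

namespace HasVal

theorem unique {f : RatFunc ℂ} {x c c' : ℂ} (h : HasVal f x c) (h' : HasVal f x c') : c = c' :=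
  h.2.symm.trans h'.2

theorem mul {f g : RatFunc ℂ} {x a b : ℂ} (hf : HasVal f x a) (hg : HasVal g x b) :
    HasVal (f * g) x (a * b) := by
  refine ⟨fun h => ?_, ?_⟩
  · have h1 := Polynomial.eval_eq_zero_of_dvd_of_eval_eq_zero (RatFunc.denom_mul_dvd f g) h
    rw [Polynomial.eval_mul, mul_eq_zero] at h1
    exact h1.elim hf.1 hg.1
  · rw [RatFunc.eval_mul (RingHom.id ℂ) x (by exact hf.1) (by exact hg.1), hf.2, hg.2]

theorem add {f g : RatFunc ℂ} {x a b : ℂ} (hf : HasVal f x a) (hg : HasVal g x b) :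
    HasVal (f + g) x (a + b) := by
  refine ⟨fun h => ?_, ?_⟩
  · have h1 := Polynomial.eval_eq_zero_of_dvd_of_eval_eq_zero (RatFunc.denom_add_dvd f g) h
    rw [Polynomial.eval_mul, mul_eq_zero] at h1
    exact h1.elim hf.1 hg.1
  · rw [RatFunc.eval_add (RingHom.id ℂ) x (by exact hf.1) (by exact hg.1), hf.2, hg.2]

theorem const (x c : ℂ) : HasVal (RatFunc.C c) x c := ⟨by simp, by simp⟩

theorem one (x : ℂ) : HasVal 1 x 1 := ⟨by simp, by simp⟩

theorem zero (x : ℂ) : HasVal 0 x 0 := ⟨by simp, by simp⟩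

theorem X (x : ℂ) : HasVal RatFunc.X x x := ⟨by simp, by simp⟩

theorem sub_const (x c : ℂ) : HasVal (RatFunc.X - RatFunc.C c) x (x - c) := by
  rw [sub_eq_add_neg, ← map_neg, sub_eq_add_neg]; exact (X x).add (const x _)

theorem linear (x a b : ℂ) : HasVal (RatFunc.C a * RatFunc.X - RatFunc.C b) x (a * x - b) := by
  rw [sub_eq_add_neg, ← map_neg, sub_eq_add_neg]; exact ((const x a).mul (X x)).add (const x _)

/-- A nonzero value means that the numerator does not vanish at x, and the denominator of f⁻¹
divides that numerator. -/
theorem inv {f : RatFunc ℂ} {x c : ℂ} (hf : HasVal f x c) (hc : c ≠ 0) : HasVal f⁻¹ x c⁻¹ := by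
  have hf0 : f ≠ 0 := by rintro rfl; exact hc (hf.unique (zero x))
  have hnum : f.num.eval x ≠ 0 := by
    intro h
    apply hc
    rw [← hf.2, RatFunc.eval, Polynomial.eval₂_id, h, zero_div]
  have hden : f⁻¹.denom.eval x ≠ 0 := fun h =>
    hnum (Polynomial.eval_eq_zero_of_dvd_of_eval_eq_zero (RatFunc.denom_inv_dvd hf0) h)
  have h1 : HasVal f⁻¹ x (f⁻¹.eval (RingHom.id ℂ) x) := ⟨hden, rfl⟩
  have h2 := (hf.mul h1).unique (by rw [mul_inv_cancel₀ hf0]; exact one x)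
  rwa [eq_inv_of_mul_eq_one_right h2] at h1

theorem div {f g : RatFunc ℂ} {x a b : ℂ} (hf : HasVal f x a) (hg : HasVal g x b) (hb : b ≠ 0) :
    HasVal (f / g) x (a / b) := by
  rw [div_eq_mul_inv, div_eq_mul_inv]; exact hf.mul (hg.inv hb)

theorem prod {ι : Type*} (s : Finset ι) {f : ι → RatFunc ℂ} {x : ℂ} {c : ι → ℂ}
    (h : ∀ i ∈ s, HasVal (f i) x (c i)) : HasVal (∏ i ∈ s, f i) x (∏ i ∈ s, c i) := by
  classical
  induction s using Finset.induction_on with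
  | empty => simpa using one x
  | insert a s ha ih =>
    rw [Finset.prod_insert ha, Finset.prod_insert ha]
    exact (h a (Finset.mem_insert_self _ _)).mul
      (ih fun i hi => h i (Finset.mem_insert_of_mem hi))

theorem sum {ι : Type*} (s : Finset ι) {f : ι → RatFunc ℂ} {x : ℂ} {c : ι → ℂ}
    (h : ∀ i ∈ s, HasVal (f i) x (c i)) : HasVal (∑ i ∈ s, f i) x (∑ i ∈ s, c i) := by
  classical
  induction s using Finset.induction_on with
  | empty => simpa using zero x
  | insert a s ha ih =>
    rw [Finset.sum_insert ha, Finset.sum_insert ha]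
    exact (h a (Finset.mem_insert_self _ _)).add
      (ih fun i hi => h i (Finset.mem_insert_of_mem hi))

end HasVal

/-- A pole: a rational function with nonzero residue is not regular. -/
theorem denom_eval_eq_zero_of_hasVal {f : RatFunc ℂ} {x c : ℂ}
    (h : HasVal (f * (RatFunc.X - RatFunc.C x)) x c) (hc : c ≠ 0) : f.denom.eval x = 0 := by
  by_contra hx
  have h1 : HasVal f x (f.eval (RingHom.id ℂ) x) := ⟨hx, rfl⟩
  have h2 := (h1.mul (HasVal.sub_const x x)).unique h
  rw [sub_self, mul_zero] at h2
  exact hc h2.symm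

/-! ## Rows of a partition -/

section Rows

variable {n : ℕ} (q d : ℂ) (k : ZMod n) (u : ℂ)

/-- The location `q₁^m q₃^s u` of the box in the column `m` and the row `s`. -/
def xloc (m s : ℤ) : ℂ := (d / q) ^ m * (1 / (d * q)) ^ s * u

/-- The colour of the box in the column `m` and the row `s`. -/
def bcol (m s : ℤ) : ZMod n := k + (s : ZMod n) - (m : ZMod n)

variable {F : Type*} [Field F] (φ : ℂ →+* F)

/-- The factor of an addable box at `x` in the eigenvalue of `K_i(z)`. -/
def afac (x : ℂ) (z : F) : F := (φ q⁻¹ * z - φ (q * x)) / (z - φ x)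

/-- The factor of a removable box at `x` in the eigenvalue of `K_i(z)`. -/
def bfac (x : ℂ) (z : F) : F := (φ q * z - φ (q⁻¹ * x)) / (z - φ x)

open Classical in
/-- The factor of the row `s` of length `m` in the eigenvalue of `K_i(z)`. -/
def rowFac (i : ZMod n) (s m : ℤ) (z : F) : F :=
  (if i = bcol k (m - 1) s then bfac q φ (xloc q d u (m - 1) s) z else 1) *
    (if i = bcol k m s then afac q φ (xloc q d u m s) z else 1)

/-- `h` is obtained from the eigenvalue `h₀` of `K_i(z)` by adding a box of colour `j` at `x`. -/
def IsKRatio (i j : ZMod n) (x : ℂ) (z h₀ h : F) : Prop :=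
  h * (φ (q ^ cartanA i j * x) - φ (d ^ skewM i j) * z)
      = (φ x - φ (d ^ skewM i j * q ^ cartanA i j) * z) * h₀ ∧
    (cartanA i j = 0 → h = h₀)

variable {q d k u φ}

theorem IsKRatio.mul_right {i j : ZMod n} {x : ℂ} {z h₀ h : F} (H : IsKRatio q d φ i j x z h₀ h)
    (g : F) : IsKRatio q d φ i j x z (h₀ * g) (h * g) :=
  ⟨by linear_combination g * H.1, fun h' => by rw [H.2 h']⟩

theorem xloc_succ_left (hq : q ≠ 0) (hd : d ≠ 0) (m s : ℤ) :
    xloc q d u (m + 1) s = d / q * xloc q d u m s := by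
  unfold xloc
  rw [zpow_add_one₀ (div_ne_zero hd hq)]; ring

theorem xloc_succ_right (hq : q ≠ 0) (hd : d ≠ 0) (m s : ℤ) :
    xloc q d u m (s + 1) = 1 / (d * q) * xloc q d u m s := by
  unfold xloc
  rw [zpow_add_one₀ (one_div_ne_zero (mul_ne_zero hd hq))]; ring

theorem xloc_ne_zero (hq : q ≠ 0) (hd : d ≠ 0) (hu : u ≠ 0) (m s : ℤ) : xloc q d u m s ≠ 0 :=
  mul_ne_zero (mul_ne_zero (zpow_ne_zero _ (div_ne_zero hd hq))
    (zpow_ne_zero _ (one_div_ne_zero (mul_ne_zero hd hq)))) hu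

/-- This is q₁q₂q₃ = 1. -/
theorem xloc_diag (hq : q ≠ 0) (hd : d ≠ 0) (m s : ℤ) :
    q ^ 2 * xloc q d u (m + 1) (s + 1) = xloc q d u m s := by
  rw [xloc_succ_left hq hd, xloc_succ_right hq hd]; field_simp

theorem xloc_eq (hq : q ≠ 0) (hd : d ≠ 0) (m s m' s' : ℤ) :
    xloc q d u m s = (d / q) ^ (m - m') * (1 / (d * q)) ^ (s - s') * xloc q d u m' s' := by
  unfold xloc
  rw [zpow_sub₀ (div_ne_zero hd hq), zpow_sub₀ (one_div_ne_zero (mul_ne_zero hd hq))]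
  have h1 := zpow_ne_zero m' (div_ne_zero hd hq)
  have h2 := zpow_ne_zero s' (one_div_ne_zero (mul_ne_zero hd hq))
  generalize (d / q) ^ m' = A at *
  generalize (1 / (d * q)) ^ s' = B at *
  field_simp

theorem GenericParams.eq_zero (hgen : GenericParams q d) {a c : ℤ}
    (h : (d / q) ^ a * (1 / (d * q)) ^ c = 1) : a = 0 ∧ c = 0 := by
  have := hgen a 0 c (by rw [zpow_zero, mul_one]; exact h)
  exact ⟨this.1, this.2.symm⟩

theorem GenericParams.q_four (hgen : GenericParams q d) : q ^ 4 ≠ 1 := by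
  intro h
  have := hgen 0 2 0 (by
    rw [zpow_zero, zpow_zero, one_mul, mul_one, ← h]
    norm_cast; rw [← pow_mul])
  omega

/-- Genericity with exponent 0 at q₂ makes the monomials in q₁ and q₃ pairwise distinct, so a
multiplicative relation of locations is a translation of coordinates. -/
theorem xloc_shift_inj (hq : q ≠ 0) (hd : d ≠ 0) (hu : u ≠ 0) (hgen : GenericParams q d)
    {m s m' s' α γ : ℤ}
    (h : xloc q d u m s = (d / q) ^ α * (1 / (d * q)) ^ γ * xloc q d u m' s') :
    m = m' + α ∧ s = s' + γ := by
  rw [xloc_eq hq hd m s m' s'] at h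
  have h1 := mul_right_cancel₀ (xloc_ne_zero hq hd hu m' s') h
  have h2 := hgen.eq_zero (a := m - m' - α) (c := s - s' - γ) (by
    have hA := zpow_ne_zero α (div_ne_zero hd hq)
    have hB := zpow_ne_zero γ (one_div_ne_zero (mul_ne_zero hd hq))
    rw [zpow_sub₀ (div_ne_zero hd hq) _ α, zpow_sub₀ (one_div_ne_zero (mul_ne_zero hd hq)) _ γ,
      div_mul_div_comm, h1, div_self (mul_ne_zero hA hB)])
  omega

theorem xloc_inj (hq : q ≠ 0) (hd : d ≠ 0) (hu : u ≠ 0) (hgen : GenericParams q d)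
    {m s m' s' : ℤ} (h : xloc q d u m s = xloc q d u m' s') : m = m' ∧ s = s' := by
  have := xloc_shift_inj hq hd hu hgen (α := 0) (γ := 0) (m := m) (s := s) (m' := m') (s' := s')
    (by simpa using h)
  omega

/-- Lengthening the row replaces, for i = j, the addable factor by a removable one at the same
place. For i = j + 1 it deletes the old removable factor, for i = j - 1 it creates a new addable
factor, and other colours see no change. -/
theorem rowFac_succ (hn : 3 ≤ n) (hq : q ≠ 0) (hd : d ≠ 0) (i : ZMod n) (s m : ℤ) {z : F}
    (hz : z ≠ φ (xloc q d u (m - 1) s)) (hz' : z ≠ φ (xloc q d u (m + 1) s)) :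
    IsKRatio q d φ i (bcol k m s) (xloc q d u m s) z
      (rowFac q d k u φ i s m z) (rowFac q d k u φ i s (m + 1) z) := by
  have hq' : φ q ≠ 0 := (map_ne_zero φ).2 hq
  have hd' : φ d ≠ 0 := (map_ne_zero φ).2 hd
  have h1 := BoxModel.one_ne_zero_zmod hn
  have h2 := BoxModel.two_ne_zero_zmod hn
  have hb1 : bcol k (m - 1) s = bcol k m s + 1 := by unfold bcol; push_cast; ring
  have hb2 : bcol k m s = bcol k (m + 1) s + 1 := by unfold bcol; push_cast; ring
  set j := bcol k m s with hj
  have hx := xloc_succ_left (u := u) hq hd (m - 1) s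
  rw [sub_add_cancel] at hx
  unfold rowFac IsKRatio
  rw [add_sub_cancel_right]
  by_cases hij : i = j
  · rw [← hj, if_pos hij, if_pos hij, if_neg, if_neg, hij, BoxModel.cartanA_self,
      BoxModel.skewM_self hn]
    · refine ⟨?_, fun h => absurd h (by norm_num)⟩
      simp only [afac, bfac, map_mul, map_zpow₀, map_inv₀, zpow_zero, one_mul, mul_one, map_one]
      -- Both sides have the denominator z - x, so only numerators are compared and z ≠ x is not
      -- needed.
      rw [div_mul_eq_mul_div, mul_div_assoc']
      congr 1
      rw [zpow_ofNat]; field_simp; ring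
    · rw [hb1]; intro h; exact h1 (by linear_combination hij - h)
    · intro h; exact h1 (by linear_combination h - hij - hb2)
  · rw [← hj, if_neg hij, if_neg hij, mul_one, one_mul]
    by_cases hb : i = bcol k (m - 1) s
    · have hi : i = j + 1 := hb.trans hb1
      rw [if_pos hb, if_neg, BoxModel.cartanA_adj hn (Or.inr hi), BoxModel.skewM_pred hn hi]
      · refine ⟨?_, fun h => absurd h (by norm_num)⟩
        have hz2 : z - φ (xloc q d u (m - 1) s) ≠ 0 := sub_ne_zero.2 hz
        simp only [bfac]
        rw [hx]
        generalize hD : z - φ (xloc q d u (m - 1) s) = D at hz2 ⊢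
        obtain rfl : z = D + φ (xloc q d u (m - 1) s) := by rw [← hD]; ring
        simp only [map_mul, map_inv₀, map_div₀, zpow_neg_one, zpow_one]
        field_simp; ring
      · intro h
        exact h2 (by linear_combination h - hi - hb2)
    · by_cases hc : i = bcol k (m + 1) s
      · have hi : j = i + 1 := by rw [hc]; exact hb2
        rw [if_neg hb, if_pos hc, BoxModel.cartanA_adj hn (Or.inl hi), BoxModel.skewM_succ hi]
        refine ⟨?_, fun h => absurd h (by norm_num)⟩
        have hz2 : z - φ (xloc q d u (m + 1) s) ≠ 0 := sub_ne_zero.2 hz'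
        simp only [afac]
        rw [xloc_succ_left hq hd] at hz2 ⊢
        generalize hD : z - φ (d / q * xloc q d u m s) = D at hz2 ⊢
        obtain rfl : z = D + φ (d / q * xloc q d u m s) := by rw [← hD]; ring
        simp only [map_mul, map_inv₀, map_div₀, zpow_neg_one]
        field_simp; ring
      · have hA : cartanA i j = 0 := by
          rw [cartanA, if_neg hij, if_neg]
          rintro (h | h)
          · exact hc (by rw [← sub_eq_iff_eq_add.2 hb2, h]; ring)
          · exact hb (by rw [hb1, h])
        rw [if_neg hb, if_neg hc, hA, skewM_eq_zero hA]
        refine ⟨?_, fun _ => rfl⟩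
        simp

theorem rowFac_hasVal (i : ZMod n) (s m : ℤ) {x : ℂ} (hx : x ≠ xloc q d u (m - 1) s)
    (hx' : x ≠ xloc q d u m s) :
    HasVal (rowFac q d k u RatFunc.C i s m RatFunc.X) x
      (rowFac q d k u (RingHom.id ℂ) i s m x) := by
  unfold rowFac
  refine HasVal.mul ?_ ?_
  · split_ifs
    · exact (HasVal.linear x _ _).div (HasVal.sub_const x _) (sub_ne_zero.2 hx)
    · exact HasVal.one x
  · split_ifs
    · exact (HasVal.linear x _ _).div (HasVal.sub_const x _) (sub_ne_zero.2 hx')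
    · exact HasVal.one x

end Rows

/-! ## Corners of a partition -/

namespace Partn

theorem anti (lam : Partn) {a b : ℕ} (h : a ≤ b) : lam.1 b ≤ lam.1 a := lam.2 h

theorem eq_zero_of_len_le (lam : Partn) {s : ℕ} (hs : lam.len ≤ s) : lam.1 s = 0 := by
  by_contra h
  have h1 : Finset.range (s + 1) ⊆ lam.1.support := by
    intro t ht
    have := lam.anti (Nat.lt_succ_iff.1 (Finset.mem_range.1 ht))
    exact Finsupp.mem_support_iff.2 (by omega)
  have h2 := Finset.card_le_card h1
  rw [Finset.card_range] at h2
  unfold len at hs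
  omega

/-- A box can be added to the row `s`. -/
def AddRow (lam : Partn) (s : ℕ) : Prop := ∀ ⦃t⦄, t < s → lam.1 s < lam.1 t

/-- A box can be removed from the row `s`. -/
def RemRow (lam : Partn) (s : ℕ) : Prop := lam.1 (s + 1) < lam.1 s

theorem addRow_zero (lam : Partn) : lam.AddRow 0 := fun _ h => absurd h (Nat.not_lt_zero _)

theorem addRow_succ (lam : Partn) (s : ℕ) : lam.AddRow (s + 1) ↔ lam.RemRow s :=
  ⟨fun h => h (Nat.lt_succ_self s), fun h _ ht => h.trans_le (lam.anti (Nat.lt_succ_iff.1 ht))⟩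

theorem AddRow.le_len {lam : Partn} {s : ℕ} (h : lam.AddRow s) : s ≤ lam.len := by
  by_contra! hs
  have := h hs
  rw [lam.eq_zero_of_len_le le_rfl] at this
  omega

theorem RemRow.lt_len {lam : Partn} {s : ℕ} (h : lam.RemRow s) : s < lam.len :=
  ((lam.addRow_succ s).2 h).le_len

open Classical in
/-- The addable boxes `(row, column)`. -/
def addBoxes (lam : Partn) : Finset (ℕ × ℕ) :=
  ((Finset.range (lam.len + 1)).filter lam.AddRow).image fun s => (s, lam.1 s)

open Classical in
/-- The removable boxes `(row, column)`. -/
def remBoxes (lam : Partn) : Finset (ℕ × ℕ) :=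
  ((Finset.range (lam.len + 1)).filter lam.RemRow).image fun s => (s, lam.1 s - 1)

theorem mem_addBoxes {lam : Partn} {b : ℕ × ℕ} :
    b ∈ lam.addBoxes ↔ lam.AddRow b.1 ∧ b.2 = lam.1 b.1 := by
  classical
  rw [addBoxes, Finset.mem_image]
  constructor
  · rintro ⟨s, hs, rfl⟩
    exact ⟨(Finset.mem_filter.1 hs).2, rfl⟩
  · rintro ⟨h1, h2⟩
    exact ⟨b.1, Finset.mem_filter.2 ⟨Finset.mem_range.2 (Nat.lt_succ_of_le h1.le_len), h1⟩,
      Prod.ext rfl h2.symm⟩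

theorem mem_remBoxes {lam : Partn} {b : ℕ × ℕ} :
    b ∈ lam.remBoxes ↔ lam.RemRow b.1 ∧ b.2 + 1 = lam.1 b.1 := by
  classical
  rw [remBoxes, Finset.mem_image]
  constructor
  · rintro ⟨s, hs, rfl⟩
    have h1 := (Finset.mem_filter.1 hs).2
    refine ⟨h1, ?_⟩
    unfold RemRow at h1
    dsimp only; omega
  · rintro ⟨h1, h2⟩
    exact ⟨b.1, Finset.mem_filter.2 ⟨Finset.mem_range.2 (by have := h1.lt_len; omega), h1⟩,
      Prod.ext rfl (by dsimp only; omega)⟩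

open Classical in
/-- All corners. -/
def corners (lam : Partn) : Finset (ℕ × ℕ) := lam.addBoxes ∪ lam.remBoxes

theorem disjoint_addBoxes_remBoxes (lam : Partn) : Disjoint lam.addBoxes lam.remBoxes := by
  rw [Finset.disjoint_left]
  intro b h1 h2
  have h1 := (mem_addBoxes.1 h1).2
  have h2 := (mem_remBoxes.1 h2).2
  omega

end Partn

/-! ### The eigenvalue of K_i(z) as a product over corners. -/

section KProduct

variable {n : ℕ} (q d : ℂ) (k : ZMod n) (u : ℂ)
variable {F : Type*} [Field F] (φ : ℂ →+* F)

open Classical in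
/-- The factor of the corner `(row, column)`. -/
def cornerFac (lam : Partn) (b : ℕ × ℕ) (z : F) : F :=
  if b ∈ lam.addBoxes then afac q φ (xloc q d u b.2 b.1) z else bfac q φ (xloc q d u b.2 b.1) z

open Classical in
/-- The corners of colour `i`. -/
def colCorners (i : ZMod n) (lam : Partn) : Finset (ℕ × ℕ) :=
  lam.corners.filter fun b => i = bcol k b.2 b.1

variable {q d k u φ}

open Classical in
theorem rowFac_eq (i : ZMod n) (s m : ℤ) (z : F) :
    rowFac q d k u φ i s m z = (if i = bcol k (m - 1) s then bfac q φ (xloc q d u (m - 1) s) z else 1) *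
    (if i = bcol k m s then afac q φ (xloc q d u m s) z else 1) := rfl

/-- The two boxes differ by a diagonal step, so each numerator is a scalar multiple of the other
denominator; this is ψ(q₂w)ψ(1/w) = 1. -/
theorem bfac_mul_afac (hq : q ≠ 0) (hd : d ≠ 0) (m s : ℤ) {z : F}
    (h1 : z ≠ φ (xloc q d u (m - 1) s)) (h2 : z ≠ φ (xloc q d u m (s + 1))) :
    bfac q φ (xloc q d u (m - 1) s) z * afac q φ (xloc q d u m (s + 1)) z = 1 := by
  have hq' : φ q ≠ 0 := (map_ne_zero φ).2 hq
  have h := xloc_diag (u := u) hq hd (m - 1) s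
  rw [sub_add_cancel] at h
  rw [← h] at h1 ⊢
  have h1' := sub_ne_zero.2 h1
  have h2' := sub_ne_zero.2 h2
  unfold bfac afac
  rw [div_mul_div_comm, div_eq_one_iff_eq (mul_ne_zero h1' h2')]
  simp only [map_mul, map_inv₀, map_pow]
  field_simp

theorem bcol_diag (m s : ℤ) : bcol k m (s + 1) = bcol k (m - 1) s := by
  unfold bcol; push_cast; ring

theorem cast_rowCut {n : ℕ} [NeZero n] (k i : ZMod n) (T : ℕ) :
    ((n * T + (i - k - 1).val : ℕ) : ZMod n) = i - k - 1 := by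
  push_cast
  rw [ZMod.natCast_self, zero_mul, zero_add, ZMod.natCast_zmod_val]

-- Telescoping: if two consecutive rows have equal length, the removable factor of the upper one
-- cancels the addable factor of the lower one. What survives are the corners and the trailing
-- factor of the last row.
open Classical in
theorem prod_rowFac_succ (hq : q ≠ 0) (hd : d ≠ 0) (i : ZMod n) (lam : Partn) {z : F}
    (hz : ∀ m s : ℤ, z ≠ φ (xloc q d u m s)) (N : ℕ) :
    ∏ s ∈ Finset.range (N + 1), rowFac q d k u φ i s (lam.1 s) z =
      (∏ s ∈ Finset.range N,
        (if lam.AddRow s ∧ i = bcol k (lam.1 s) s then afac q φ (xloc q d u (lam.1 s) s) z else 1) *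
        (if lam.RemRow s ∧ i = bcol k (lam.1 s - 1) s then
          bfac q φ (xloc q d u (lam.1 s - 1) s) z else 1)) *
      (if lam.AddRow N ∧ i = bcol k (lam.1 N) N then afac q φ (xloc q d u (lam.1 N) N) z else 1) *
      (if i = bcol k (lam.1 N - 1) N then bfac q φ (xloc q d u (lam.1 N - 1) N) z else 1) := by
  have aux : ∀ X b c a : F, b * a = 1 → X * b * (c * a) = X * c := by
    intro X b c a h; linear_combination X * c * h
  induction N with
  | zero =>
    rw [Finset.prod_range_one, Finset.prod_range_zero, one_mul, rowFac_eq, mul_comm]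
    simp [lam.addRow_zero]
  | succ N ih =>
    rw [Finset.prod_range_succ, ih, Finset.prod_range_succ _ N, rowFac_eq]
    simp only [lam.addRow_succ]
    by_cases h : lam.RemRow N
    · simp only [h, true_and]; ring
    · have he : lam.1 (N + 1) = lam.1 N :=
        le_antisymm (lam.anti (Nat.le_succ N)) (not_lt.1 h)
      simp only [h, false_and, if_false, he, mul_one]
      push_cast
      rw [bcol_diag (k := k) (lam.1 N : ℤ) N]
      by_cases hi : i = bcol k (lam.1 N - 1) N
      · simp only [if_pos hi]
        have := bfac_mul_afac hq hd (lam.1 N : ℤ) N (hz _ _) (hz _ _)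
        exact aux _ _ _ _ this
      · simp only [if_neg hi]; ring

theorem prod_rowFac_eq (hn : 3 ≤ n) (hq : q ≠ 0) (hd : d ≠ 0) (i : ZMod n) (lam : Partn) {z : F}
    (hz : ∀ m s : ℤ, z ≠ φ (xloc q d u m s)) {T : ℕ} (hT : lam.len + 1 ≤ T) :
    ∏ s ∈ Finset.range (n * T + (i - k - 1).val), rowFac q d k u φ i s (lam.1 s) z =
      ∏ b ∈ colCorners k i lam, cornerFac q d u φ lam b z := by
  classical
  have : NeZero n := ⟨by omega⟩
  have hnT : T ≤ n * T := Nat.le_mul_of_pos_left _ (by omega)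
  obtain ⟨N, hN⟩ : ∃ N, n * T + (i - k - 1).val = N + 1 := ⟨n * T + (i - k - 1).val - 1, by omega⟩
  have hlen : lam.len < N + 1 := by omega
  have hc := cast_rowCut k i T
  rw [hN] at hc ⊢
  have hlN : lam.1 N = 0 := lam.eq_zero_of_len_le (by omega)
  -- The cutoff has N + 1 ≡ i - k - 1 and row N is empty, so the trailing box has colour i - 1 and
  -- contributes no factor.
  rw [prod_rowFac_succ hq hd i lam hz, if_neg (c := i = bcol k (lam.1 N - 1) N), mul_one]
  swap
  · rw [hlN]; unfold bcol; push_cast at hc ⊢; intro h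
    exact BoxModel.one_ne_zero_zmod hn (by linear_combination h + hc)
  have hrem : ¬ lam.RemRow N := fun h => by have := h.lt_len; omega
  have e1 : ∏ b ∈ colCorners k i lam, cornerFac q d u φ lam b z =
      (∏ b ∈ lam.addBoxes, if i = bcol k b.2 b.1 then afac q φ (xloc q d u b.2 b.1) z else 1) *
      (∏ b ∈ lam.remBoxes, if i = bcol k b.2 b.1 then bfac q φ (xloc q d u b.2 b.1) z else 1) := by
    rw [colCorners, Finset.prod_filter, Partn.corners,
      Finset.prod_union lam.disjoint_addBoxes_remBoxes]
    congr 1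
    · refine Finset.prod_congr rfl fun b hb => ?_
      rw [cornerFac, if_pos hb]
    · refine Finset.prod_congr rfl fun b hb => ?_
      rw [cornerFac, if_neg fun h => Finset.disjoint_left.1 lam.disjoint_addBoxes_remBoxes h hb]
  have key : ∀ (R : ℕ → Prop) (_ : ∀ s, R s → s ≤ lam.len) (g : ℕ → F),
      ∏ s ∈ (Finset.range (lam.len + 1)).filter R, g s =
        ∏ s ∈ Finset.range (N + 1), if R s then g s else 1 := by
    intro R hR g
    rw [← Finset.prod_filter]
    refine Finset.prod_congr ?_ fun _ _ => rfl
    ext s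
    simp only [Finset.mem_filter, Finset.mem_range]
    exact ⟨fun h => ⟨by omega, h.2⟩, fun h => ⟨by have := hR s h.2; omega, h.2⟩⟩
  rw [e1, Partn.addBoxes, Partn.remBoxes, Finset.prod_image (by intro a _ b _ h; exact congrArg Prod.fst h),
    Finset.prod_image (by intro a _ b _ h; exact congrArg Prod.fst h),
    key _ (fun s h => h.le_len), key _ (fun s h => h.lt_len.le), Finset.prod_range_succ,
    Finset.prod_range_succ (fun s => if lam.RemRow s then _ else _), if_neg hrem, mul_one,
    Finset.prod_mul_distrib, mul_right_comm]
  have e2 : ∀ s, lam.RemRow s → (((lam.1 s - 1 : ℕ) : ℤ)) = (lam.1 s : ℤ) - 1 := by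
    intro s h; unfold Partn.RemRow at h; omega
  congr 1
  · congr 1
    · exact Finset.prod_congr rfl fun s _ => ite_and ..
    · exact ite_and ..
  · refine Finset.prod_congr rfl fun s _ => ?_
    by_cases h : lam.RemRow s
    · simp only [h, true_and, if_true, e2 s h]
    · simp only [h, false_and, if_false]

end KProduct

/-! ### Eigenvalues and matrix coefficients of a Fock module through row factors. -/

section FockRat

variable {n : ℕ} {q d : ℂ} {k : ZMod n} {u : ℂ}

theorem cond_one (i : ZMod n) (m s : ℕ) :
    ((m : ZMod n) + i = ((s + 1 : ℕ) : ZMod n) + k) ↔ i = bcol k (m - 1) s := by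
  unfold bcol; push_cast
  constructor <;> intro h <;> linear_combination h

theorem cond_two (i : ZMod n) (m s : ℕ) :
    ((m : ZMod n) + i + 1 = ((s + 1 : ℕ) : ZMod n) + k) ↔ i = bcol k m s := by
  unfold bcol; push_cast
  constructor <;> intro h <;> linear_combination h

theorem psi_div {F : Type*} [Field F] (φ : ℂ →+* F) (x : ℂ) {z : F} (hz : z ≠ 0) :
    psi (φ q) (φ x / z) = bfac q φ x z := by
  unfold psi bfac
  rw [← mul_div_mul_right _ _ hz]
  simp only [map_mul, map_inv₀]
  congr 1 <;> field_simp

theorem psi_div_inv {F : Type*} [Field F] (φ : ℂ →+* F) (hq : q ≠ 0) (x : ℂ) {z : F} (hz : z ≠ 0) :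
    (psi (φ q) (φ (q ^ 2 * x) / z))⁻¹ = afac q φ x z := by
  have hq' : φ q ≠ 0 := (map_ne_zero φ).2 hq
  unfold psi afac
  rw [inv_div, ← mul_div_mul_right _ _ (mul_ne_zero hz (inv_ne_zero hq'))]
  simp only [map_mul, map_inv₀, map_pow]
  congr 1 <;> field_simp

theorem fockK_eq_prod (hq : q ≠ 0) (hd : d ≠ 0) (i : ZMod n) (lam : Partn) {z : RatFunc ℂ}
    (hz : z ≠ 0) : fockK q d k u i lam z =
      ∏ s ∈ Finset.range (rowCut k i lam), rowFac q d k u RatFunc.C i s (lam.1 s) z := by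
  unfold fockK
  refine Finset.prod_congr rfl fun s _ => ?_
  have h : (d / q) ^ ((lam.1 s : ℤ) - 1) * (1 / (d * q)) ^ ((s : ℤ) - 1) * u =
      q ^ 2 * xloc q d u (lam.1 s) s := by
    have := xloc_diag (u := u) hq hd ((lam.1 s : ℤ) - 1) ((s : ℤ) - 1)
    rw [sub_add_cancel, sub_add_cancel] at this
    rw [this, xloc]
  simp only [cond_one, cond_two, h, psi_div_inv RatFunc.C hq _ hz]
  simp only [rowFac_eq, ← psi_div RatFunc.C _ hz, xloc]

theorem rowFactor_eq (hq : q ≠ 0) (hd : d ≠ 0) (hu : u ≠ 0) (i : ZMod n) (lam : Partn) (j s : ℕ) :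
    rowFactor q d k i lam j s =
      rowFac q d k u (RingHom.id ℂ) i s (lam.1 s) (xloc q d u (lam.1 j) j) := by
  have hz := xloc_ne_zero (u := u) hq hd hu (lam.1 j) j
  have h1 : psi q ((d / q) ^ ((lam.1 s : ℤ) - lam.1 j - 1) * (1 / (d * q)) ^ ((s : ℤ) - j)) =
      bfac q (RingHom.id ℂ) (xloc q d u (lam.1 s - 1) s) (xloc q d u (lam.1 j) j) := by
    rw [← psi_div (RingHom.id ℂ) _ hz, RingHom.id_apply, RingHom.id_apply,
      xloc_eq hq hd ((lam.1 s : ℤ) - 1) s (lam.1 j) j, mul_div_cancel_right₀ _ hz]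
    congr 3; ring
  have h2 : psi q ((d / q) ^ ((lam.1 j : ℤ) - lam.1 s) * (1 / (d * q)) ^ ((j : ℤ) - s)) =
      afac q (RingHom.id ℂ) (xloc q d u (lam.1 s) s) (xloc q d u (lam.1 j) j) := by
    have hz2 := xloc_ne_zero (u := u) hq hd hu (lam.1 s) s
    rw [← mul_div_cancel_right₀ ((d / q) ^ ((lam.1 j : ℤ) - lam.1 s) * (1 / (d * q)) ^ ((j : ℤ) - s)) hz2,
      ← xloc_eq hq hd]
    unfold psi afac
    simp only [RingHom.id_apply]
    rw [← mul_div_mul_right _ _ (neg_ne_zero.2 hz2)]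
    congr 1 <;> field_simp <;> ring
  unfold rowFactor
  simp only [cond_one, cond_two, h1, h2, rowFac_eq]

theorem fockK_eq_prod_corners (hn : 3 ≤ n) (hq : q ≠ 0) (hd : d ≠ 0) (i : ZMod n)
    (lam : Partn) {z : RatFunc ℂ} (hz : ∀ c, z ≠ RatFunc.C c) :
    fockK q d k u i lam z = ∏ b ∈ colCorners k i lam, cornerFac q d u RatFunc.C lam b z := by
  rw [fockK_eq_prod hq hd i lam (by simpa using hz 0)]
  exact prod_rowFac_eq hn hq hd i lam (fun _ _ => hz _) le_rfl

/-- Both cutoffs give the same product over corners. A common cutoff makes it possible to compare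
partitions of different lengths row by row. -/
theorem fockK_eq_prod_of_le (hn : 3 ≤ n) (hq : q ≠ 0) (hd : d ≠ 0) (i : ZMod n)
    (lam : Partn) {z : RatFunc ℂ} (hz : ∀ c, z ≠ RatFunc.C c) {T : ℕ} (hT : lam.len + 1 ≤ T) :
    fockK q d k u i lam z = ∏ s ∈ Finset.range (n * T + (i - k - 1).val),
      rowFac q d k u RatFunc.C i s (lam.1 s) z := by
  rw [fockK_eq_prod hq hd i lam (by simpa using hz 0), prod_rowFac_eq hn hq hd i lam (fun _ _ => hz _) hT]
  exact prod_rowFac_eq hn hq hd i lam (fun _ _ => hz _) le_rfl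

end FockRat

/-! ## Matrix coefficients and residues in a Fock module -/

section Exchange

variable {n : ℕ} {q d : ℂ}

/-- The box at `y` of colour `i` is the translate of the box at `x` of colour `j` by `(-1, -1)`,
`(1, 0)` or `(0, 1)`. -/
def StepLoc (q d : ℂ) (i j : ZMod n) (x y : ℂ) : Prop :=
  i = j ∧ y = q ^ 2 * x ∨ j = i + 1 ∧ y = d / q * x ∨ i = j + 1 ∧ y = 1 / (d * q) * x

/-- The equation is the vanishing of the linear factor that multiplies `h` in `IsKRatio`; the cases
of the Cartan entry give the three steps. -/
theorem stepLoc_of_eq (hn : 3 ≤ n) (hq : q ≠ 0) (hd : d ≠ 0) {i j : ZMod n} {x y : ℂ}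
    (hA : cartanA i j ≠ 0) (h : q ^ cartanA i j * x = d ^ skewM i j * y) : StepLoc q d i j x y := by
  unfold StepLoc
  by_cases h1 : i = j
  · subst h1
    rw [BoxModel.cartanA_self, BoxModel.skewM_self hn, zpow_zero, one_mul] at h
    exact Or.inl ⟨rfl, h.symm⟩
  by_cases h2 : j = i + 1
  · rw [BoxModel.cartanA_adj hn (Or.inl h2), BoxModel.skewM_succ h2, zpow_neg_one,
      zpow_neg_one] at h
    refine Or.inr (Or.inl ⟨h2, ?_⟩)
    field_simp at h ⊢
    linear_combination -h
  by_cases h3 : i = j + 1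
  · rw [BoxModel.cartanA_adj hn (Or.inr h3), BoxModel.skewM_pred hn h3, zpow_neg_one,
      zpow_one] at h
    refine Or.inr (Or.inr ⟨h3, ?_⟩)
    field_simp at h ⊢
    linear_combination -h
  · exact absurd (by rw [cartanA, if_neg h1, if_neg (by tauto)]) hA

/-- The ratio at y caused by the box at x and the ratio at x caused by the box at y are inverse to
each other, because a is symmetric and m skew. The two hypotheses on steps keep both denominators
nonzero. -/
theorem IsKRatio.exchange (hn : 3 ≤ n) (hq : q ≠ 0) (hd : d ≠ 0) {i j : ZMod n}
    {x y h₀ h g₀ g : ℂ} (H : IsKRatio q d (RingHom.id ℂ) i j x y h₀ h)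
    (G : IsKRatio q d (RingHom.id ℂ) j i y x g₀ g)
    (h1 : ¬ StepLoc q d i j x y) (h2 : ¬ StepLoc q d j i y x) : h₀ * g₀ = h * g := by
  by_cases hA : cartanA i j = 0
  · rw [H.2 hA, G.2 (by rw [cartanA_comm, hA])]
  have hP : q ^ cartanA i j * x - d ^ skewM i j * y ≠ 0 :=
    fun h => h1 (stepLoc_of_eq hn hq hd hA (sub_eq_zero.1 h))
  have hQ : q ^ cartanA j i * y - d ^ skewM j i * x ≠ 0 :=
    fun h => h2 (stepLoc_of_eq hn hq hd (by rwa [cartanA_comm]) (sub_eq_zero.1 h))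
  have H1 := H.1
  have G1 := G.1
  simp only [RingHom.id_apply] at H1 G1
  have hm : d ^ skewM i j * d ^ skewM j i = 1 := by
    rw [skewM_comm hn j i, zpow_neg, mul_inv_cancel₀ (zpow_ne_zero _ hd)]
  rw [cartanA_comm j i] at hQ G1
  generalize q ^ cartanA i j = a at *
  generalize d ^ skewM i j = m at *
  generalize d ^ skewM j i = m' at *
  apply mul_right_cancel₀ (mul_ne_zero hP hQ)
  have e : (x - m * a * y) * (y - m' * a * x) = (a * x - m * y) * (a * y - m' * x) := by
    linear_combination (a ^ 2 * x * y - x * y) * hm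
  linear_combination (-(x - m * a * y) * h₀) * G1 - (g * (a * y - m' * x)) * H1 -  h₀ * g₀ * e

end Exchange

section FockCoef

variable {n : ℕ} (q d : ℂ) (k : ZMod n) (u : ℂ)

/-- The coefficient of `E_i(z)` for adding a box to the row `j`. -/
def fe (lam : Partn) (j : ℕ) : ℂ :=
  ∏ s ∈ Finset.range j, rowFac q d k u (RingHom.id ℂ) (bcol k (lam.1 j) j) s (lam.1 s)
    (xloc q d u (lam.1 j) j)

/-- The coefficient of `F_i(z)` for removing the box that was added to the row `j` of `lam`. -/
def ff (lam : Partn) (j : ℕ) : ℂ :=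
  ∏ s ∈ Finset.Ico (j + 1) (rowCut k (bcol k (lam.1 j) j) lam),
    rowFac q d k u (RingHom.id ℂ) (bcol k (lam.1 j) j) s (lam.1 s) (xloc q d u (lam.1 j) j)

/-- `lam'` is `lam` with one more box in the row `j`. -/
def AddBox (lam lam' : Partn) (j : ℕ) : Prop := lam'.1 = lam.1 + Finsupp.single j 1

variable {q d k u}

theorem AddBox.self {lam lam' : Partn} {j : ℕ} (h : AddBox lam lam' j) :
    lam'.1 j = lam.1 j + 1 := by rw [h]; simp

theorem AddBox.of_ne {lam lam' : Partn} {j s : ℕ} (h : AddBox lam lam' j) (hs : s ≠ j) :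
    lam'.1 s = lam.1 s := by rw [h]; simp [Finsupp.single_eq_of_ne hs]

theorem AddBox.addRow {lam lam' : Partn} {j : ℕ} (h : AddBox lam lam' j) : lam.AddRow j := by
  intro t ht
  have := lam'.anti ht.le
  rw [h.self, h.of_ne ht.ne] at this
  omega

theorem AddBox.remRow {lam lam' : Partn} {j : ℕ} (h : AddBox lam lam' j) : lam'.RemRow j := by
  unfold Partn.RemRow
  have := lam.anti (Nat.le_succ j)
  rw [h.self, h.of_ne (Nat.succ_ne_self j)]
  omega

theorem Partn.AddRow.exists_addBox {lam : Partn} {j : ℕ} (h : lam.AddRow j) :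
    ∃ lam', AddBox lam lam' j := by
  refine ⟨⟨lam.1 + Finsupp.single j 1, fun s t hst => ?_⟩, rfl⟩
  have h1 := lam.anti hst
  simp only [Finsupp.add_apply]
  rcases eq_or_ne t j with rfl | ht
  · rcases hst.lt_or_eq with h2 | rfl
    · have := h h2
      rw [Finsupp.single_eq_same, Finsupp.single_eq_of_ne h2.ne]; omega
    · rfl
  · rw [Finsupp.single_eq_of_ne ht]; omega

theorem Partn.RemRow.exists_addBox {lam' : Partn} {j : ℕ} (h : lam'.RemRow j) :
    ∃ lam, AddBox lam lam' j := by
  unfold Partn.RemRow at h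
  refine ⟨⟨lam'.1 - Finsupp.single j 1, fun s t hst => ?_⟩, ?_⟩
  · have h1 := lam'.anti hst
    simp only [Finsupp.tsub_apply]
    rcases eq_or_ne s j with rfl | hs
    · rcases hst.lt_or_eq with h2 | rfl
      · have := lam'.anti (Nat.succ_le_of_lt h2)
        rw [Finsupp.single_eq_same, Finsupp.single_eq_of_ne h2.ne']
        simp only [Nat.succ_eq_add_one] at this; omega
      · exact le_rfl
    · rw [Finsupp.single_eq_of_ne hs]; omega
  · ext s
    simp only [Finsupp.add_apply, Finsupp.tsub_apply]
    rcases eq_or_ne s j with rfl | hs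
    · rw [Finsupp.single_eq_same]; omega
    · rw [Finsupp.single_eq_of_ne hs]; omega

/-- The factors of empty rows telescope to the two addable end factors, which are absent because a,
b ≡ i - k - 1. Nonvanishing of denominators is required only from row a on. -/
theorem prod_rowFac_zero (hn : 3 ≤ n) (hq : q ≠ 0) (hd : d ≠ 0) {F : Type*} [Field F]
    (φ : ℂ →+* F) (i : ZMod n) {z : F} {a b : ℕ} (hab : a ≤ b)
    (ha : (a : ZMod n) = i - k - 1) (hb : (b : ZMod n) = i - k - 1)
    (hz : ∀ m s : ℤ, a ≤ s → z ≠ φ (xloc q d u m s)) :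
    ∏ s ∈ Finset.Ico a b, rowFac q d k u φ i s 0 z = 1 := by
  classical
  have h0 : ∀ c : ℕ, (c : ZMod n) = i - k - 1 → ¬ i = bcol k 0 c := by
    intro c hc h; unfold bcol at h; push_cast at h
    exact BoxModel.one_ne_zero_zmod hn (by linear_combination h + hc)
  have key : ∀ N, a ≤ N → (∏ s ∈ Finset.Ico a N, rowFac q d k u φ i s 0 z) *
      (if i = bcol k 0 N then afac q φ (xloc q d u 0 N) z else 1) =
      (if i = bcol k 0 a then afac q φ (xloc q d u 0 a) z else 1) := by
    intro N hN
    induction N, hN using Nat.le_induction with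
    | base => simp
    | succ N hN ih =>
      rw [← ih, Finset.prod_Ico_succ_top hN, mul_assoc]
      congr 1
      rw [rowFac_eq]
      push_cast
      rw [bcol_diag (k := k) (0 : ℤ) N]
      have := bfac_mul_afac (u := u) (φ := φ) (z := z) hq hd (0 : ℤ) N (hz _ _ (by omega))
          (hz _ _ (by omega))
      rw [zero_sub] at this ⊢
      by_cases hi : i = bcol k (-1) N
      · rw [if_pos hi, if_pos hi]
        linear_combination (if i = bcol k 0 N then afac q φ (xloc q d u 0 N) z else 1) * this
      · rw [if_neg hi, if_neg hi, one_mul, mul_one]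
  have := key b hab
  rwa [if_neg (h0 a ha), if_neg (h0 b hb), mul_one] at this

/-- Beyond the cutoff all rows are empty and `prod_rowFac_zero` applies; the box itself lies in an
earlier row, so no denominator vanishes. -/
theorem ff_eq (hn : 3 ≤ n) (hq : q ≠ 0) (hd : d ≠ 0) (hu : u ≠ 0) (hgen : GenericParams q d)
    {lam : Partn} {j : ℕ} (hj : lam.AddRow j) {T : ℕ} (hT : lam.len + 1 ≤ T) :
    ff q d k u lam j = ∏ s ∈ Finset.Ico (j + 1) (n * T + (bcol k (lam.1 j) j - k - 1).val),
      rowFac q d k u (RingHom.id ℂ) (bcol k (lam.1 j) j) s (lam.1 s) (xloc q d u (lam.1 j) j) := by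
  have : NeZero n := ⟨by omega⟩
  have hjl := hj.le_len
  have h1 : lam.len + 1 ≤ n * (lam.len + 1) := Nat.le_mul_of_pos_left _ (by omega)
  have h2 : n * (lam.len + 1) ≤ n * T := Nat.mul_le_mul_left _ hT
  unfold ff rowCut
  set i := bcol k (lam.1 j) j
  have e : ∏ s ∈ Finset.Ico (n * (lam.len + 1) + (i - k - 1).val) (n * T + (i - k - 1).val),
      rowFac q d k u (RingHom.id ℂ) i s (lam.1 s) (xloc q d u (lam.1 j) j) = 1 := by
    rw [← prod_rowFac_zero (u := u) (k := k) hn hq hd (RingHom.id ℂ) i (z := xloc q d u (lam.1 j) j)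
      (a := n * (lam.len + 1) + (i - k - 1).val) (b := n * T + (i - k - 1).val) (by omega)
      (cast_rowCut k i _) (cast_rowCut k i _)]
    · refine Finset.prod_congr rfl fun s hs => ?_
      rw [lam.eq_zero_of_len_le (by have := (Finset.mem_Ico.1 hs).1; omega)]; rfl
    · intro m s hs h
      have := (xloc_inj hq hd hu hgen h).2
      omega
  rw [← Finset.prod_Ico_consecutive _ (n := n * (lam.len + 1) + (i - k - 1).val)
    (k := n * T + (i - k - 1).val) (by omega) (by omega), e, mul_one]

/-- A zero or pole would put the end of row s at the added box or at a diagonal neighbour of it. By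
genericity this fixes rows and columns, against addability in row j or monotonicity of the
partition. -/
theorem rowFac_ne_zero (hq : q ≠ 0) (hd : d ≠ 0) (hu : u ≠ 0)
    (hgen : GenericParams q d) {lam : Partn} {j s : ℕ} (hj : lam.AddRow j) (hs : s ≠ j)
    (i : ZMod n) :
    rowFac q d k u (RingHom.id ℂ) i s (lam.1 s) (xloc q d u (lam.1 j) j) ≠ 0 := by
  rw [rowFac_eq]
  refine mul_ne_zero ?_ ?_
  · split_ifs with h
    · refine div_ne_zero (fun h0 => ?_) (fun h0 => ?_)
      · have h1 : xloc q d u (lam.1 s - 1) s = xloc q d u (lam.1 j - 1) (j - 1) := by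
          rw [← xloc_diag hq hd ((lam.1 j : ℤ) - 1), sub_add_cancel, sub_add_cancel]
          simp only [RingHom.id_apply] at h0
          field_simp at h0
          linear_combination -h0
        have h2 := xloc_inj hq hd hu hgen h1
        have := hj (t := s) (by omega)
        omega
      · have := xloc_inj hq hd hu hgen (sub_eq_zero.1 h0)
        omega
    · exact one_ne_zero
  · split_ifs with h
    · refine div_ne_zero (fun h0 => ?_) (fun h0 => ?_)
      · have h1 : xloc q d u (lam.1 j) j = xloc q d u (lam.1 s - 1) (s - 1) := by
          rw [← xloc_diag hq hd ((lam.1 s : ℤ) - 1), sub_add_cancel, sub_add_cancel]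
          simp only [RingHom.id_apply] at h0
          field_simp at h0
          linear_combination h0
        have h2 := xloc_inj hq hd hu hgen h1
        have := lam.anti (a := j) (b := s) (by omega)
        omega
      · have := xloc_inj hq hd hu hgen (sub_eq_zero.1 h0)
        omega
    · exact one_ne_zero

theorem fe_ne_zero (hq : q ≠ 0) (hd : d ≠ 0) (hu : u ≠ 0) (hgen : GenericParams q d)
    {lam : Partn} {j : ℕ} (hj : lam.AddRow j) : fe q d k u lam j ≠ 0 :=
  Finset.prod_ne_zero_iff.2 fun s hs =>
    rowFac_ne_zero hq hd hu hgen hj (by have := Finset.mem_range.1 hs; omega) _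

theorem ff_ne_zero (hq : q ≠ 0) (hd : d ≠ 0) (hu : u ≠ 0) (hgen : GenericParams q d)
    {lam : Partn} {j : ℕ} (hj : lam.AddRow j) : ff q d k u lam j ≠ 0 :=
  Finset.prod_ne_zero_iff.2 fun s hs =>
    rowFac_ne_zero hq hd hu hgen hj (by have := (Finset.mem_Ico.1 hs).1; omega) _

theorem fe_congr {lam lam' : Partn} {j : ℕ} (h : ∀ s ≤ j, lam'.1 s = lam.1 s) :
    fe q d k u lam' j = fe q d k u lam j := by
  unfold fe
  rw [h j le_rfl]
  exact Finset.prod_congr rfl fun s hs => by rw [h s (Finset.mem_range.1 hs).le]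

theorem ff_congr (hn : 3 ≤ n) (hq : q ≠ 0) (hd : d ≠ 0) (hu : u ≠ 0) (hgen : GenericParams q d)
    {lam lam' : Partn} {j : ℕ} (hj : lam.AddRow j) (hj' : lam'.AddRow j)
    (h : ∀ s ≥ j, lam'.1 s = lam.1 s) :
    ff q d k u lam' j = ff q d k u lam j := by
  rw [ff_eq hn hq hd hu hgen hj (T := max lam.len lam'.len + 1) (by omega),
    ff_eq hn hq hd hu hgen hj' (T := max lam.len lam'.len + 1) (by omega), h j le_rfl]
  exact Finset.prod_congr rfl fun s hs => by rw [h s (by have := (Finset.mem_Ico.1 hs).1; omega)]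

/-- Splitting off the row `j` from the eigenvalue of `K_i(z)`. -/
theorem fockK_split (hn : 3 ≤ n) (hq : q ≠ 0) (hd : d ≠ 0) (i : ZMod n) (lam : Partn) {j T : ℕ}
    (hT : lam.len + 1 ≤ T) (hj : j < T) {z : RatFunc ℂ} (hz : ∀ c, z ≠ RatFunc.C c) :
    fockK q d k u i lam z =
      rowFac q d k u RatFunc.C i j (lam.1 j) z *
        ((∏ s ∈ Finset.range j, rowFac q d k u RatFunc.C i s (lam.1 s) z) *
        ∏ s ∈ Finset.Ico (j + 1) (n * T + (i - k - 1).val),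
          rowFac q d k u RatFunc.C i s (lam.1 s) z) := by
  have h1 : T ≤ n * T := Nat.le_mul_of_pos_left _ (by omega)
  rw [fockK_eq_prod_of_le hn hq hd i lam hz hT, Finset.range_eq_Ico,
    ← Finset.prod_Ico_consecutive _ (n := j + 1) (by omega) (by omega),
    Finset.prod_Ico_succ_top (Nat.zero_le j), ← Finset.range_eq_Ico]
  ring

/-- Under a common cutoff only the factor of row j changes, and `rowFac_succ` gives the change. -/
theorem fockK_ratio (hn : 3 ≤ n) (hq : q ≠ 0) (hd : d ≠ 0) (i : ZMod n) {lam lam' : Partn} {j : ℕ}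
    (h : AddBox lam lam' j) {z : RatFunc ℂ} (hz : ∀ c, z ≠ RatFunc.C c) :
    IsKRatio q d RatFunc.C i (bcol k (lam.1 j) j) (xloc q d u (lam.1 j) j) z
      (fockK q d k u i lam z) (fockK q d k u i lam' z) := by
  rw [fockK_split hn hq hd i lam (j := j) (T := max lam.len lam'.len + j + 1) (by omega) (by omega) hz,
    fockK_split hn hq hd i lam' (j := j) (T := max lam.len lam'.len + j + 1) (by omega) (by omega) hz,
    h.self]
  have e1 : ∏ s ∈ Finset.range j, rowFac q d k u RatFunc.C i s (lam'.1 s) z =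
      ∏ s ∈ Finset.range j, rowFac q d k u RatFunc.C i s (lam.1 s) z :=
    Finset.prod_congr rfl fun s hs => by rw [h.of_ne (Finset.mem_range.1 hs).ne]
  have e2 : ∀ N, ∏ s ∈ Finset.Ico (j + 1) N, rowFac q d k u RatFunc.C i s (lam'.1 s) z =
      ∏ s ∈ Finset.Ico (j + 1) N, rowFac q d k u RatFunc.C i s (lam.1 s) z := fun N =>
    Finset.prod_congr rfl fun s hs => by
      rw [h.of_ne (by have := (Finset.mem_Ico.1 hs).1; omega)]
  rw [e1, e2]
  push_cast
  exact (rowFac_succ hn hq hd i j (lam.1 j) (hz _) (hz _)).mul_right _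

theorem X_ne_C (c : ℂ) : (RatFunc.X : RatFunc ℂ) ≠ RatFunc.C c := by
  intro h
  have h1 := (HasVal.X (c + 1)).unique (h ▸ HasVal.const (c + 1) c)
  simp at h1

theorem X_inv_ne_C (c : ℂ) : (RatFunc.X : RatFunc ℂ)⁻¹ ≠ RatFunc.C c := by
  intro h
  exact X_ne_C c⁻¹ (by rw [← inv_inv RatFunc.X, h, map_inv₀])

/-- Only row j can have a pole at this box. The other rows are regular there: those above multiply
to the coefficient of E, those below to that of F. -/
theorem hasVal_fockK_residue (hn : 3 ≤ n) (hq : q ≠ 0) (hd : d ≠ 0) (hu : u ≠ 0)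
    (hgen : GenericParams q d) {lam lam' : Partn} {j : ℕ} (hj : lam.AddRow j)
    (h : ∀ s, s ≠ j → lam'.1 s = lam.1 s) {c : ℂ}
    (hc : HasVal (rowFac q d k u RatFunc.C (bcol k (lam.1 j) j) j (lam'.1 j) RatFunc.X *
      (RatFunc.X - RatFunc.C (xloc q d u (lam.1 j) j))) (xloc q d u (lam.1 j) j) c) :
    HasVal (fockK q d k u (bcol k (lam.1 j) j) lam' RatFunc.X *
      (RatFunc.X - RatFunc.C (xloc q d u (lam.1 j) j))) (xloc q d u (lam.1 j) j)
      (c * (fe q d k u lam j * ff q d k u lam j)) := by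
  rw [fockK_split hn hq hd _ lam' (j := j) (T := max lam.len lam'.len + j + 1) (by omega) (by omega)
    X_ne_C, mul_right_comm]
  refine hc.mul (HasVal.mul ?_ ?_)
  · refine HasVal.prod _ fun s hs => ?_
    have := Finset.mem_range.1 hs
    rw [h s this.ne]
    refine rowFac_hasVal _ _ _ ?_ ?_ <;> intro h' <;>
      have := xloc_inj hq hd hu hgen h' <;> omega
  · rw [ff_eq hn hq hd hu hgen hj (T := max lam.len lam'.len + j + 1) (by omega)]
    refine HasVal.prod _ fun s hs => ?_
    have := (Finset.mem_Ico.1 hs).1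
    rw [h s (by omega)]
    refine rowFac_hasVal _ _ _ ?_ ?_ <;> intro h' <;>
      have := xloc_inj hq hd hu hgen h' <;> omega

theorem hasVal_fockK_add (hn : 3 ≤ n) (hq : q ≠ 0) (hd : d ≠ 0) (hu : u ≠ 0)
    (hgen : GenericParams q d) {lam : Partn} {j : ℕ} (hj : lam.AddRow j) :
    HasVal (fockK q d k u (bcol k (lam.1 j) j) lam RatFunc.X *
      (RatFunc.X - RatFunc.C (xloc q d u (lam.1 j) j))) (xloc q d u (lam.1 j) j)
      ((q⁻¹ - q) * xloc q d u (lam.1 j) j * (fe q d k u lam j * ff q d k u lam j)) := by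
  refine hasVal_fockK_residue hn hq hd hu hgen hj (fun _ _ => rfl) ?_
  rw [rowFac_eq, if_pos rfl, if_neg, one_mul, afac, div_mul_cancel₀ _ (sub_ne_zero.2 (X_ne_C _))]
  · convert HasVal.linear (xloc q d u (lam.1 j) j) q⁻¹ (q * xloc q d u (lam.1 j) j) using 1; ring
  · unfold bcol; push_cast; intro h
    exact BoxModel.one_ne_zero_zmod hn (by linear_combination -h)

theorem hasVal_fockK_rem (hn : 3 ≤ n) (hq : q ≠ 0) (hd : d ≠ 0) (hu : u ≠ 0)
    (hgen : GenericParams q d) {lam lam' : Partn} {j : ℕ} (h : AddBox lam lam' j) :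
    HasVal (fockK q d k u (bcol k (lam.1 j) j) lam' RatFunc.X *
      (RatFunc.X - RatFunc.C (xloc q d u (lam.1 j) j))) (xloc q d u (lam.1 j) j)
      ((q - q⁻¹) * xloc q d u (lam.1 j) j * (fe q d k u lam j * ff q d k u lam j)) := by
  refine hasVal_fockK_residue hn hq hd hu hgen h.addRow (fun _ hs => h.of_ne hs) ?_
  rw [rowFac_eq, h.self]
  push_cast
  rw [add_sub_cancel_right, if_pos rfl, if_neg, mul_one, bfac,
    div_mul_cancel₀ _ (sub_ne_zero.2 (X_ne_C _))]
  · convert HasVal.linear (xloc q d u (lam.1 j) j) q (q⁻¹ * xloc q d u (lam.1 j) j) using 1; ring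
  · unfold bcol; push_cast; intro h
    exact BoxModel.one_ne_zero_zmod hn (by linear_combination h)

/-- A diagonal step would contradict monotonicity, a horizontal one stays in the same row, and a
vertical one would make row j' as long as the row above it. -/
theorem not_stepLoc_of_rows (hq : q ≠ 0) (hd : d ≠ 0) (hu : u ≠ 0) (hgen : GenericParams q d)
    {i i' : ZMod n} {lam : Partn} {j j' : ℕ} (hj' : lam.AddRow j')
    (hne : j ≠ j') :
    ¬ StepLoc q d i i' (xloc q d u (lam.1 j) j) (xloc q d u (lam.1 j') j') := by
  rintro (⟨-, h⟩ | ⟨-, h⟩ | ⟨-, h⟩)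
  · have h1 := xloc_diag (u := u) hq hd ((lam.1 j : ℤ) - 1) ((j : ℤ) - 1)
    rw [sub_add_cancel, sub_add_cancel, ← h] at h1
    have h2 := xloc_inj hq hd hu hgen h1
    have := lam.anti (a := j') (b := j) (by omega)
    omega
  · rw [← xloc_succ_left hq hd] at h
    have h2 := xloc_inj hq hd hu hgen h
    omega
  · rw [← xloc_succ_right hq hd] at h
    have h2 := xloc_inj hq hd hu hgen h
    have := hj' (t := j) (by omega)
    omega

theorem fe_mul_ff_comm (hn : 3 ≤ n) (hq : q ≠ 0) (hd : d ≠ 0) (hu : u ≠ 0)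
    (hgen : GenericParams q d) {lam la lb : Partn} {j j' : ℕ} (hne : j ≠ j')
    (ha : AddBox lam la j) (hb : AddBox lam lb j') (hab : la.AddRow j') :
    fe q d k u lam j * ff q d k u lam j' = ff q d k u la j' * fe q d k u lb j := by
  rcases lt_or_gt_of_ne hne with hlt | hlt
  -- For j < j' the coefficient of F involves only rows from j' on and that of E only rows up to j,
  -- so neither is affected by the other move.
  · rw [ff_congr hn hq hd hu hgen hb.addRow hab (fun s hs => ha.of_ne (by omega)),
      fe_congr (fun s hs => hb.of_ne (s := s) (by omega)), mul_comm]
  -- For j' < j exactly one factor changes in each product, and the two changes compensate by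
  -- `IsKRatio.exchange`.
  · have e1 : ∀ lam : Partn, fe q d k u lam j = (∏ s ∈ Finset.range j with s ≠ j',
        rowFac q d k u (RingHom.id ℂ) (bcol k (lam.1 j) j) s (lam.1 s) (xloc q d u (lam.1 j) j)) *
        rowFac q d k u (RingHom.id ℂ) (bcol k (lam.1 j) j) j' (lam.1 j') (xloc q d u (lam.1 j) j) := by
      intro lam
      rw [Finset.filter_ne', Finset.prod_erase_mul _ _ (Finset.mem_range.2 hlt)]; rfl
    set T := max lam.len la.len + j + 1 with hT
    have hnT : T ≤ n * T := Nat.le_mul_of_pos_left _ (by omega)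
    set i' := bcol k (lam.1 j') j' with hi'
    have hmem : j ∈ Finset.Ico (j' + 1) (n * T + (i' - k - 1).val) :=
      Finset.mem_Ico.2 (by omega)
    have hlj' : la.1 j' = lam.1 j' := ha.of_ne (by omega)
    have hlj : lb.1 j = lam.1 j := hb.of_ne (by omega)
    rw [e1 lam, e1 lb, ff_eq hn hq hd hu hgen hb.addRow (T := T) (by omega),
      ff_eq hn hq hd hu hgen hab (T := T) (by omega), hlj', hlj, hb.self, ← hi',
      ← Finset.prod_erase_mul _ _ hmem, ← Finset.prod_erase_mul _ _ hmem, ha.self]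
    have e2 : ∏ s ∈ Finset.range j with s ≠ j', rowFac q d k u (RingHom.id ℂ) (bcol k (lam.1 j) j)
        s (lb.1 s) (xloc q d u (lam.1 j) j) = ∏ s ∈ Finset.range j with s ≠ j',
        rowFac q d k u (RingHom.id ℂ) (bcol k (lam.1 j) j) s (lam.1 s) (xloc q d u (lam.1 j) j) :=
      Finset.prod_congr rfl fun s hs => by rw [hb.of_ne (Finset.mem_filter.1 hs).2]
    have e3 : ∏ s ∈ (Finset.Ico (j' + 1) (n * T + (i' - k - 1).val)).erase j,
        rowFac q d k u (RingHom.id ℂ) i' s (la.1 s) (xloc q d u (lam.1 j') j') =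
        ∏ s ∈ (Finset.Ico (j' + 1) (n * T + (i' - k - 1).val)).erase j,
        rowFac q d k u (RingHom.id ℂ) i' s (lam.1 s) (xloc q d u (lam.1 j') j') :=
      Finset.prod_congr rfl fun s hs => by rw [ha.of_ne (Finset.mem_erase.1 hs).1]
    rw [e2, e3]
    have hloc : ∀ m m' : ℤ, ∀ s s' : ℕ, s ≠ s' → xloc q d u m s ≠ xloc q d u m' s' := by
      intro m m' s s' hs h
      have := xloc_inj hq hd hu hgen h
      omega
    have H := rowFac_succ (u := u) (k := k) (φ := RingHom.id ℂ) hn hq hd (bcol k (lam.1 j) j)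
      j' (lam.1 j') (z := xloc q d u (lam.1 j) j) (hloc _ _ _ _ hne) (hloc _ _ _ _ hne)
    have G := rowFac_succ (u := u) (k := k) (φ := RingHom.id ℂ) hn hq hd i'
      j (lam.1 j) (z := xloc q d u (lam.1 j') j') (hloc _ _ _ _ hne.symm) (hloc _ _ _ _ hne.symm)
    have := IsKRatio.exchange hn hq hd H G
      (not_stepLoc_of_rows hq hd hu hgen ha.addRow hne.symm)
      (not_stepLoc_of_rows hq hd hu hgen hb.addRow hne)
    push_cast
    generalize (∏ s ∈ Finset.range j with s ≠ j', _ : ℂ) = A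
    generalize (∏ s ∈ (Finset.Ico (j' + 1) (n * T + (i' - k - 1).val)).erase j, _ : ℂ) = B
    linear_combination (A * B) * this

end FockCoef

/-! ## Partial fractions and expansions -/

/-- Induction on the number of factors. The coefficients do not depend on the field, so the same
ones serve for the variable X, for X⁻¹ and for the number 0. -/
theorem exists_partial_fractions {ι : Type*} (T : Finset ι) (x α β : ι → ℂ)
    (hx : Set.InjOn x T) :
    ∃ c : ι → ℂ, ∀ {F : Type} [Field F] (φ : ℂ →+* F) (z : F), (∀ a ∈ T, z ≠ φ (x a)) →
      ∏ a ∈ T, (φ (α a) * z - φ (β a)) / (z - φ (x a)) =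
        φ (∏ a ∈ T, α a) + ∑ a ∈ T, φ (c a) / (z - φ (x a)) := by
  classical
  induction T using Finset.induction_on with
  | empty => exact ⟨0, fun φ z _ => by simp⟩
  | insert b T hb ih =>
    obtain ⟨c, hc⟩ := ih (hx.mono (by simp))
    set r : ℂ := α b * x b - β b with hr
    -- Multiplying by the new factor α + r/(z - x_b) splits each product of two poles, and the pole
    -- at x_b collects the remainders.
    refine ⟨fun a => if a = b then r * (∏ a ∈ T, α a) + ∑ a ∈ T, r * c a / (x b - x a)
      else α b * c a - r * c a / (x b - x a), fun {F} _ φ z hz => ?_⟩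
    have hxb : ∀ a ∈ T, x b - x a ≠ 0 := fun a ha => sub_ne_zero.2 fun h =>
      hb (by rw [hx (by simp) (by simp [ha]) h]; exact ha)
    rw [Finset.prod_insert hb, hc φ z (fun a ha => hz a (Finset.mem_insert_of_mem ha)),
      Finset.prod_insert hb, Finset.sum_insert hb]
    dsimp only
    rw [if_pos rfl]
    have hzb : z - φ (x b) ≠ 0 := sub_ne_zero.2 (hz b (Finset.mem_insert_self _ _))
    have e1 : (φ (α b) * z - φ (β b)) / (z - φ (x b)) = φ (α b) + φ r / (z - φ (x b)) := by
      rw [hr, map_sub, map_mul]; field_simp; ring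
    have e2 : ∑ a ∈ T, φ (if a = b then r * (∏ a ∈ T, α a) + ∑ a ∈ T, r * c a / (x b - x a)
        else α b * c a - r * c a / (x b - x a)) / (z - φ (x a)) =
        ∑ a ∈ T, ((φ (α b) + φ r / (z - φ (x b))) * (φ (c a) / (z - φ (x a))) -
          φ (r * c a / (x b - x a)) / (z - φ (x b))) := by
      refine Finset.sum_congr rfl fun a ha => ?_
      rw [if_neg (by rintro rfl; exact hb ha)]
      have h1 : z - φ (x a) ≠ 0 := sub_ne_zero.2 (hz a (Finset.mem_insert_of_mem ha))
      have h2 : φ (x b) - φ (x a) ≠ 0 := by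
        rw [← map_sub]; exact (map_ne_zero φ).2 (hxb a ha)
      simp only [map_sub, map_mul, map_div₀]
      field_simp
      ring
    rw [e1, e2, Finset.sum_sub_distrib, ← Finset.mul_sum, ← Finset.sum_div, ← map_sum]
    simp only [map_add, map_mul]
    ring

theorem coe_ratFunc_C (c : ℂ) : ((RatFunc.C c : RatFunc ℂ) : LaurentSeries ℂ) = HahnSeries.C c := by
  rw [← RatFunc.algebraMap_C]
  exact (RatFunc.coe_coe (Polynomial.C c)).symm.trans (by rw [Polynomial.coe_C, PowerSeries.coe_C])

theorem coeff_hahnSeries_C (c : ℂ) (r : ℤ) :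
    (HahnSeries.C c : LaurentSeries ℂ).coeff r = if r = 0 then c else 0 := by
  rw [HahnSeries.C_apply, HahnSeries.coeff_single]
  split_ifs <;> rfl

theorem coeff_C_div_one_sub (c x : ℂ) (r : ℤ) :
    ((RatFunc.C c / (1 - RatFunc.C x * RatFunc.X) : RatFunc ℂ) : LaurentSeries ℂ).coeff r =
      if 0 ≤ r then c * x ^ r else 0 := by
  have h0 : (1 - RatFunc.C x * RatFunc.X : RatFunc ℂ) ≠ 0 := by
    intro h
    have h1 := ((HasVal.one 0).add ((HasVal.const 0 (-x)).mul (HasVal.X 0))).unique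
      (c' := 0) (by
        have e : (1 + RatFunc.C (-x) * RatFunc.X : RatFunc ℂ) = 0 := by rw [← h, map_neg]; ring
        rw [e]; exact HasVal.zero 0)
    simp at h1
  have h : ((RatFunc.C c / (1 - RatFunc.C x * RatFunc.X) : RatFunc ℂ) : LaurentSeries ℂ) =
      ((PowerSeries.mk fun m => c * x ^ m : PowerSeries ℂ) : LaurentSeries ℂ) := by
    rw [map_div₀, div_eq_iff ((map_ne_zero _).2 h0), map_sub, map_one, map_mul, coe_ratFunc_C,
      coe_ratFunc_C, RatFunc.coe_X, ← PowerSeries.coe_X, ← PowerSeries.coe_C, ← PowerSeries.coe_C,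
      ← PowerSeries.coe_one, ← PowerSeries.coe_mul, ← PowerSeries.coe_sub, ← PowerSeries.coe_mul]
    congr 1
    ext m
    rw [mul_sub, mul_one, mul_left_comm, map_sub, PowerSeries.coeff_C, PowerSeries.coeff_C_mul]
    cases m with
    | zero => simp
    | succ m => simp [PowerSeries.coeff_succ_mul_X]; ring
  rw [h, PowerSeries.coeff_coe]
  split_ifs with h1 h2 h2
  · omega
  · rfl
  · rw [PowerSeries.coeff_mk, ← zpow_natCast, Int.natAbs_of_nonneg h2]
  · omega

theorem coeff_C_div_X_sub (c : ℂ) {x : ℂ} (hx : x ≠ 0) (r : ℤ) :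
    ((RatFunc.C c / (RatFunc.X - RatFunc.C x) : RatFunc ℂ) : LaurentSeries ℂ).coeff r =
      if 0 ≤ r then -(c * x ^ (-r - 1)) else 0 := by
  have h : (RatFunc.C c / (RatFunc.X - RatFunc.C x) : RatFunc ℂ) =
      RatFunc.C (-(c / x)) / (1 - RatFunc.C x⁻¹ * RatFunc.X) := by
    have hx' : RatFunc.C x ≠ (0 : RatFunc ℂ) := (map_ne_zero _).2 hx
    have h1 : (1 - RatFunc.C x⁻¹ * RatFunc.X : RatFunc ℂ) =
      -(RatFunc.X - RatFunc.C x) / RatFunc.C x := by rw [map_inv₀]; field_simp; ring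
    rw [h1, map_neg, map_div₀]
    have h2 := sub_ne_zero.2 (X_ne_C x)
    field_simp
  rw [h, coeff_C_div_one_sub]
  split_ifs with h1
  · rw [inv_zpow, zpow_sub₀ hx, zpow_neg, zpow_one]; ring
  · rfl

theorem coeff_X_mul (f : RatFunc ℂ) (r : ℤ) :
    ((RatFunc.X * f : RatFunc ℂ) : LaurentSeries ℂ).coeff r = (f : LaurentSeries ℂ).coeff (r - 1) := by
  rw [map_mul, RatFunc.coe_X]
  have := HahnSeries.coeff_single_mul_add (r := (1 : ℂ)) (x := (f : LaurentSeries ℂ)) (a := r - 1)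
    (b := (1 : ℤ))
  rwa [one_mul, sub_add_cancel] at this

theorem coeff_X_inv_mul (f : RatFunc ℂ) (r : ℤ) :
    ((RatFunc.X⁻¹ * f : RatFunc ℂ) : LaurentSeries ℂ).coeff r =
      (f : LaurentSeries ℂ).coeff (r + 1) := by
  have := coeff_X_mul (RatFunc.X⁻¹ * f) (r + 1)
  rw [mul_inv_cancel_left₀ RatFunc.X_ne_zero, add_sub_cancel_right] at this
  exact this.symm

theorem coeff_C_mul (c : ℂ) (f : RatFunc ℂ) (r : ℤ) :
    ((RatFunc.C c * f : RatFunc ℂ) : LaurentSeries ℂ).coeff r =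
      c * (f : LaurentSeries ℂ).coeff r := by
  rw [map_mul, coe_ratFunc_C, HahnSeries.C_mul_eq_smul, HahnSeries.coeff_smul, smul_eq_mul]

theorem coeff_C_div_X_inv_sub (c x : ℂ) (r : ℤ) :
    ((RatFunc.C c / (RatFunc.X⁻¹ - RatFunc.C x) : RatFunc ℂ) : LaurentSeries ℂ).coeff r =
      if 1 ≤ r then c * x ^ (r - 1) else 0 := by
  have h : (RatFunc.C c / (RatFunc.X⁻¹ - RatFunc.C x) : RatFunc ℂ) =
      RatFunc.X * (RatFunc.C c / (1 - RatFunc.C x * RatFunc.X)) := by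
    have h0 : (RatFunc.X : RatFunc ℂ) ≠ 0 := RatFunc.X_ne_zero
    have h1 : (1 - RatFunc.C x * RatFunc.X : RatFunc ℂ) =
        (RatFunc.X⁻¹ - RatFunc.C x) * RatFunc.X := by field_simp
    have h2 := sub_ne_zero.2 (X_inv_ne_C x)
    rw [h1]
    generalize (RatFunc.X⁻¹ - RatFunc.C x : RatFunc ℂ) = D at h2
    field_simp
  rw [h, coeff_X_mul, coeff_C_div_one_sub]
  simp only [sub_nonneg]

/-! ## Expansions of a product of linear fractions -/

section Expansion

variable {ι : Type*} {T : Finset ι} {x α β c : ι → ℂ} {f : RatFunc ℂ → RatFunc ℂ}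

/-- The partial fractions are expanded as geometric series at both ends. Their coefficients are the
residues, so the difference of the expansions is a sum over the poles. -/
theorem coeff_prod_linear (hx0 : ∀ a, x a ≠ 0) (hx : Set.InjOn x T)
    (hf : ∀ z, (∀ c, z ≠ RatFunc.C c) →
      f z = ∏ a ∈ T, (RatFunc.C (α a) * z - RatFunc.C (β a)) / (z - RatFunc.C (x a)))
    (hc : ∀ a ∈ T, HasVal (f RatFunc.X * (RatFunc.X - RatFunc.C (x a))) (x a) (c a)) (r : ℤ) :
    ((f RatFunc.X⁻¹ : RatFunc ℂ) : LaurentSeries ℂ).coeff r =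
        (if r = 0 then ∏ a ∈ T, α a else if 0 < r then ∑ a ∈ T, c a * x a ^ (r - 1) else 0) ∧
    ((f RatFunc.X : RatFunc ℂ) : LaurentSeries ℂ).coeff (-r) =
        (if r = 0 then ∏ a ∈ T, β a / x a
          else if r < 0 then - ∑ a ∈ T, c a * x a ^ (r - 1) else 0) ∧
    ∏ a ∈ T, α a - ∏ a ∈ T, β a / x a = ∑ a ∈ T, c a * x a ^ (-1 : ℤ) := by
  classical
  obtain ⟨c', hc'⟩ := exists_partial_fractions T x α β hx
  have e1 := hc' RatFunc.C RatFunc.X (fun a _ => X_ne_C _)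
  have e2 := hc' RatFunc.C RatFunc.X⁻¹ (fun a _ => X_inv_ne_C _)
  rw [← hf _ X_ne_C] at e1
  rw [← hf _ X_inv_ne_C] at e2
  -- After multiplication by X - x_a all other terms vanish at x_a.
  have hcc : ∀ a ∈ T, c' a = c a := by
    intro a ha
    refine HasVal.unique ?_ (hc a ha)
    rw [e1, ← Finset.add_sum_erase _ _ ha, add_mul, add_mul,
      div_mul_cancel₀ _ (sub_ne_zero.2 (X_ne_C _))]
    have h1 := (HasVal.const (x a) (∏ a ∈ T, α a)).mul (HasVal.sub_const (x a) (x a))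
    have h2 : HasVal ((∑ b ∈ T.erase a, RatFunc.C (c' b) / (RatFunc.X - RatFunc.C (x b))) *
        (RatFunc.X - RatFunc.C (x a))) (x a) ((∑ b ∈ T.erase a, c' b / (x a - x b)) * (x a - x a)) := by
      refine HasVal.mul (HasVal.sum _ fun b hb => ?_) (HasVal.sub_const _ _)
      refine (HasVal.const _ _).div (HasVal.sub_const _ _) (sub_ne_zero.2 fun h => ?_)
      exact (Finset.mem_erase.1 hb).1 (hx (Finset.mem_erase.1 hb).2 ha h.symm)
    convert h1.add ((HasVal.const (x a) (c' a)).add h2) using 1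
    rw [sub_self]; ring
  -- The value at z = 0 compares the constant terms of the two expansions.
  have e0 := hc' (RingHom.id ℂ) 0 (fun a _ h => hx0 a h.symm)
  have h0 : ∏ a ∈ T, α a - ∏ a ∈ T, β a / x a = ∑ a ∈ T, c a * x a ^ (-1 : ℤ) := by
    simp only [RingHom.id_apply, mul_zero, zero_sub, neg_div_neg_eq] at e0
    rw [e0, sub_add_cancel_left, ← Finset.sum_neg_distrib]
    refine Finset.sum_congr rfl fun a ha => ?_
    rw [hcc a ha, zpow_neg_one, div_neg, neg_neg]; rfl
  refine ⟨?_, ?_, h0⟩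
  · rw [e2, map_add, map_sum, HahnSeries.coeff_add, HahnSeries.coeff_sum, coe_ratFunc_C]
    simp only [coeff_C_div_X_inv_sub, coeff_hahnSeries_C]
    rcases lt_trichotomy r 0 with h | h | h
    · rw [if_neg h.ne, if_neg h.ne, if_neg h.le.not_gt, zero_add]
      exact Finset.sum_eq_zero fun a _ => if_neg (by omega)
    · rw [if_pos h, if_pos h]
      convert add_zero _
      exact Finset.sum_eq_zero fun a _ => if_neg (by omega)
    · rw [if_neg h.ne', if_neg h.ne', if_pos h, zero_add]
      exact Finset.sum_congr rfl fun a ha => by rw [if_pos (by omega), hcc a ha]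
  · rw [e1, map_add, map_sum, HahnSeries.coeff_add, HahnSeries.coeff_sum, coe_ratFunc_C]
    simp only [coeff_C_div_X_sub _ (hx0 _), coeff_hahnSeries_C, neg_eq_zero, neg_neg]
    rcases lt_trichotomy r 0 with h | h | h
    · rw [if_neg h.ne, if_neg h.ne, if_pos h, zero_add, ← Finset.sum_neg_distrib]
      exact Finset.sum_congr rfl fun a ha => by rw [if_pos (by omega), hcc a ha]
    · subst h
      rw [if_pos rfl, if_pos rfl, eq_comm, ← sub_eq_iff_eq_add', ← neg_inj, neg_sub, h0,
        ← Finset.sum_neg_distrib]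
      exact Finset.sum_congr rfl fun a ha => by
        rw [if_pos (by omega), hcc a ha, neg_neg, zero_sub]
    · rw [if_neg h.ne', if_neg h.ne', if_neg h.le.not_gt, zero_add]
      exact Finset.sum_eq_zero fun a _ => if_neg (by omega)

end Expansion

/-- The coefficientwise form of the ratio of two eigenvalues. -/
theorem coeff_of_isKRatio {n : ℕ} {q d : ℂ} {i j : ZMod n} {x : ℂ} {h₀ h : RatFunc ℂ} (r : ℤ) :
    (IsKRatio q d RatFunc.C i j x RatFunc.X⁻¹ h₀ h →
      q ^ cartanA i j * x * (h : LaurentSeries ℂ).coeff r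
        - d ^ skewM i j * (h : LaurentSeries ℂ).coeff (r + 1) =
      x * (h₀ : LaurentSeries ℂ).coeff r
        - d ^ skewM i j * q ^ cartanA i j * (h₀ : LaurentSeries ℂ).coeff (r + 1)) ∧
    (IsKRatio q d RatFunc.C i j x RatFunc.X h₀ h →
      q ^ cartanA i j * x * (h : LaurentSeries ℂ).coeff (-r)
        - d ^ skewM i j * (h : LaurentSeries ℂ).coeff (-(r + 1)) =
      x * (h₀ : LaurentSeries ℂ).coeff (-r)
        - d ^ skewM i j * q ^ cartanA i j * (h₀ : LaurentSeries ℂ).coeff (-(r + 1))) := by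
  constructor <;> intro H
  · have := congrArg (fun g : RatFunc ℂ => (g : LaurentSeries ℂ).coeff r)
      (show RatFunc.C (q ^ cartanA i j * x) * h - RatFunc.C (d ^ skewM i j) * (RatFunc.X⁻¹ * h) =
        RatFunc.C x * h₀ - RatFunc.C (d ^ skewM i j * q ^ cartanA i j) * (RatFunc.X⁻¹ * h₀) by
          linear_combination H.1)
    simpa only [map_sub, HahnSeries.coeff_sub, coeff_C_mul, coeff_X_inv_mul] using this
  · have := congrArg (fun g : RatFunc ℂ => (g : LaurentSeries ℂ).coeff (-r))
      (show RatFunc.C (q ^ cartanA i j * x) * h - RatFunc.C (d ^ skewM i j) * (RatFunc.X * h) =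
        RatFunc.C x * h₀ - RatFunc.C (d ^ skewM i j * q ^ cartanA i j) * (RatFunc.X * h₀) by
          linear_combination H.1)
    have e : -(r + 1) = -r - 1 := by ring
    rw [e]
    simpa only [map_sub, HahnSeries.coeff_sub, coeff_C_mul, coeff_X_mul] using this

/-! ## Values of the eigenvalue of `K_i(z)` away from the corners; matrix coefficients -/

section Values

variable {n : ℕ} {q d : ℂ} {k : ZMod n} {u : ℂ}

theorem mem_colCorners {i : ZMod n} {lam : Partn} {b : ℕ × ℕ} :
    b ∈ colCorners k i lam ↔ (b ∈ lam.addBoxes ∨ b ∈ lam.remBoxes) ∧ i = bcol k b.2 b.1 := by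
  classical
  rw [colCorners, Finset.mem_filter, Partn.corners, Finset.mem_union]

theorem hasVal_fockK (hn : 3 ≤ n) (hq : q ≠ 0) (hd : d ≠ 0) (i : ZMod n) (lam : Partn) {x : ℂ}
    (hx : ∀ b ∈ colCorners k i lam, x ≠ xloc q d u b.2 b.1) :
    HasVal (fockK q d k u i lam RatFunc.X) x
      (∏ b ∈ colCorners k i lam, cornerFac q d u (RingHom.id ℂ) lam b x) := by
  rw [fockK_eq_prod_corners hn hq hd i lam X_ne_C]
  refine HasVal.prod _ fun b hb => ?_
  unfold cornerFac
  split_ifs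
  · exact (HasVal.linear x _ _).div (HasVal.sub_const x _) (sub_ne_zero.2 (hx b hb))
  · exact (HasVal.linear x _ _).div (HasVal.sub_const x _) (sub_ne_zero.2 (hx b hb))

theorem prod_cornerFac_eq_zero_iff (hq : q ≠ 0) (i : ZMod n) (lam : Partn) {x : ℂ}
    (hx : ∀ b ∈ colCorners k i lam, x ≠ xloc q d u b.2 b.1) :
    ∏ b ∈ colCorners k i lam, cornerFac q d u (RingHom.id ℂ) lam b x = 0 ↔
      (∃ b ∈ lam.addBoxes, i = bcol k b.2 b.1 ∧ x = q ^ 2 * xloc q d u b.2 b.1) ∨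
      ∃ b ∈ lam.remBoxes, i = bcol k b.2 b.1 ∧ xloc q d u b.2 b.1 = q ^ 2 * x := by
  have ha : ∀ y : ℂ, x ≠ y → (afac q (RingHom.id ℂ) y x = 0 ↔ x = q ^ 2 * y) := by
    intro y hy
    unfold afac
    simp only [RingHom.id_apply]
    rw [div_eq_zero_iff, or_iff_left (sub_ne_zero.2 hy), sub_eq_zero]
    constructor <;> intro h
    · field_simp at h; linear_combination h
    · rw [h]; field_simp
  have hb : ∀ y : ℂ, x ≠ y → (bfac q (RingHom.id ℂ) y x = 0 ↔ y = q ^ 2 * x) := by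
    intro y hy
    unfold bfac
    simp only [RingHom.id_apply]
    rw [div_eq_zero_iff, or_iff_left (sub_ne_zero.2 hy), sub_eq_zero]
    constructor <;> intro h
    · field_simp at h; linear_combination -h
    · rw [h]; field_simp
  have hdj := Finset.disjoint_left.1 lam.disjoint_addBoxes_remBoxes
  rw [Finset.prod_eq_zero_iff]
  constructor
  · rintro ⟨b, hb', h⟩
    obtain ⟨h1, h2⟩ := mem_colCorners.1 hb'
    unfold cornerFac at h
    split_ifs at h with h3
    · exact Or.inl ⟨b, h3, h2, (ha _ (hx b hb')).1 h⟩
    · exact Or.inr ⟨b, h1.resolve_left h3, h2, (hb _ (hx b hb')).1 h⟩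
  · rintro (⟨b, h1, h2, h3⟩ | ⟨b, h1, h2, h3⟩)
    · have hm : b ∈ colCorners k i lam := mem_colCorners.2 ⟨Or.inl h1, h2⟩
      refine ⟨b, hm, ?_⟩
      rw [cornerFac, if_pos h1]
      exact (ha _ (hx b hm)).2 h3
    · have hm : b ∈ colCorners k i lam := mem_colCorners.2 ⟨Or.inr h1, h2⟩
      refine ⟨b, hm, ?_⟩
      rw [cornerFac, if_neg fun h => hdj h h1]
      exact (hb _ (hx b hm)).2 h3

theorem isAddBox_iff {i : ZMod n} {lam lam' : Partn} {j : ℕ} :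
    IsAddBox k i lam lam' j ↔ AddBox lam lam' j ∧ i = bcol k (lam.1 j) j := by
  unfold IsAddBox AddBox
  rw [cond_two]

theorem AddBox.unique {lam lam' : Partn} {j j' : ℕ} (h : AddBox lam lam' j)
    (h' : AddBox lam lam' j') : j = j' := by
  by_contra hne
  have := h.self
  rw [h'.of_ne hne] at this
  omega

theorem sum_isAddBox {i : ZMod n} {lam lam' : Partn} (g : ℕ → DeltaSum) [∀ j, Decidable (IsAddBox k i lam lam' j)] :
    (∀ j, AddBox lam lam' j → ∑ s ∈ lam'.1.support, (if IsAddBox k i lam lam' s then g s else 0) =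
      if IsAddBox k i lam lam' j then g j else 0) ∧
    ((∀ j, ¬ AddBox lam lam' j) →
      ∑ s ∈ lam'.1.support, (if IsAddBox k i lam lam' s then g s else 0) = 0) := by
  constructor
  · intro j hj
    refine Finset.sum_eq_single j (fun s _ hs => if_neg fun h => hs ?_) fun h => ?_
    · exact (isAddBox_iff.1 h).1.unique hj
    · have := hj.self
      rw [Finsupp.notMem_support_iff.1 h] at this
      omega
  · intro h
    exact Finset.sum_eq_zero fun s _ => if_neg fun h' => h s (isAddBox_iff.1 h').1

open Classical in
theorem fockE_of_addBox (hq : q ≠ 0) (hd : d ≠ 0) (hu : u ≠ 0) (i : ZMod n) {lam lam' : Partn}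
    {j : ℕ} (h : AddBox lam lam' j) :
    fockE q d k u i lam' lam = if bcol k (lam.1 j) j = i then
      Finsupp.single (xloc q d u (lam.1 j) j) (fe q d k u lam j) else 0 := by
  unfold fockE
  rw [(sum_isAddBox _).1 j h]
  by_cases hi : i = bcol k (lam.1 j) j
  · rw [if_pos (isAddBox_iff.2 ⟨h, hi⟩), if_pos hi.symm, fe, ← hi]
    congr 1
    exact Finset.prod_congr rfl fun s _ => rowFactor_eq hq hd hu i lam j s
  · rw [if_neg fun h' => hi (isAddBox_iff.1 h').2, if_neg (Ne.symm hi)]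

open Classical in
theorem fockF_of_addBox (hq : q ≠ 0) (hd : d ≠ 0) (hu : u ≠ 0) (i : ZMod n) {lam lam' : Partn}
    {j : ℕ} (h : AddBox lam lam' j) :
    fockF q d k u i lam lam' = if bcol k (lam.1 j) j = i then
      Finsupp.single (xloc q d u (lam.1 j) j) (ff q d k u lam j) else 0 := by
  unfold fockF
  rw [(sum_isAddBox _).1 j h]
  by_cases hi : i = bcol k (lam.1 j) j
  · rw [if_pos (isAddBox_iff.2 ⟨h, hi⟩), if_pos hi.symm, ff, ← hi]
    congr 1
    exact Finset.prod_congr rfl fun s _ => rowFactor_eq hq hd hu i lam j s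
  · rw [if_neg fun h' => hi (isAddBox_iff.1 h').2, if_neg (Ne.symm hi)]

theorem fockE_eq_zero (i : ZMod n) {lam lam' : Partn} (h : ∀ j, ¬ AddBox lam lam' j) :
    fockE q d k u i lam' lam = 0 := by
  classical exact (sum_isAddBox _).2 h

theorem fockF_eq_zero (i : ZMod n) {lam lam' : Partn} (h : ∀ j, ¬ AddBox lam lam' j) :
    fockF q d k u i lam lam' = 0 := by
  classical exact (sum_isAddBox _).2 h

theorem deltaCoeff_single (x c : ℂ) (r : ℤ) : deltaCoeff (Finsupp.single x c) r = c * x ^ r := by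
  unfold deltaCoeff
  rw [Finsupp.sum_single_index (by rw [zero_mul])]

theorem mulCoeff_single (f : RatFunc ℂ) (x c : ℂ) (r : ℤ) :
    mulCoeff f (Finsupp.single x c) r = f.eval (RingHom.id ℂ) x * c * x ^ r := by
  unfold mulCoeff
  rw [Finsupp.sum_single_index (by rw [mul_zero, zero_mul])]

theorem deltaCoeff_zero (r : ℤ) : deltaCoeff 0 r = 0 := Finsupp.sum_zero_index

theorem mulCoeff_zero (f : RatFunc ℂ) (r : ℤ) : mulCoeff f 0 r = 0 := Finsupp.sum_zero_index

end Values

/-! ## The lattice of pairs of partitions -/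

namespace Partn

theorem ext_iff' {lam lam' : Partn} : lam = lam' ↔ ∀ s, lam.1 s = lam'.1 s :=
  ⟨fun h _ => by rw [h], fun h => Subtype.ext (Finsupp.ext h)⟩

/-- The componentwise maximum. -/
def sup (lam mu : Partn) : Partn :=
  ⟨Finsupp.zipWith max (max_self 0) lam.1 mu.1, fun s t h => by
    simp only [Finsupp.zipWith_apply]
    exact max_le_max (lam.anti h) (mu.anti h)⟩

/-- The componentwise minimum. -/
def inf (lam mu : Partn) : Partn :=
  ⟨Finsupp.zipWith min (min_self 0) lam.1 mu.1, fun s t h => by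
    simp only [Finsupp.zipWith_apply]
    exact min_le_min (lam.anti h) (mu.anti h)⟩

theorem sup_apply (lam mu : Partn) (s : ℕ) : (lam.sup mu).1 s = max (lam.1 s) (mu.1 s) := by
  simp [sup]

theorem inf_apply (lam mu : Partn) (s : ℕ) : (lam.inf mu).1 s = min (lam.1 s) (mu.1 s) := by
  simp [inf]

/-- The empty partition. -/
def empty : Partn := ⟨0, fun _ _ _ => le_rfl⟩

theorem empty_apply (s : ℕ) : empty.1 s = 0 := rfl

theorem exists_remRow {lam : Partn} (h : lam ≠ empty) : ∃ j, lam.RemRow j := by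
  by_contra! hr
  apply h
  rw [ext_iff']
  have h1 : ∀ s, lam.1 s = lam.1 0 := by
    intro s
    induction s with
    | zero => rfl
    | succ s ih =>
      rw [← ih]
      exact le_antisymm (lam.anti (Nat.le_succ s)) (not_lt.1 (hr s))
  intro s
  rw [h1, ← h1 lam.len, lam.eq_zero_of_len_le le_rfl, empty_apply]

end Partn

/-- The boxes of pairs of partitions: `(layer, row, column)`. -/
abbrev PBox : Type := Bool × ℕ × ℕ

/-- The two components of a pair of partitions. -/
def part (p : Partn × Partn) (c : Bool) : Partn := bif c then p.2 else p.1

theorem part_ext {p p' : Partn × Partn} (h : ∀ c, part p c = part p' c) : p = p' :=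
  Prod.ext (h false) (h true)

/-- The boxes of a pair. -/
def pairCells (p : Partn × Partn) : Finset PBox :=
  Finset.univ.biUnion fun c : Bool => (part p c).1.support.biUnion fun j =>
    (Finset.range ((part p c).1 j)).image fun m => (c, j, m)

theorem mem_pairCells {p : Partn × Partn} {b : PBox} :
    b ∈ pairCells p ↔ b.2.2 < (part p b.1).1 b.2.1 := by
  unfold pairCells
  simp only [Finset.mem_biUnion, Finset.mem_univ, true_and, Finset.mem_image, Finset.mem_range,
    Finsupp.mem_support_iff]
  constructor
  · rintro ⟨c, j, -, m, hm, rfl⟩; exact hm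
  · intro h; exact ⟨b.1, b.2.1, by omega, b.2.2, h, rfl⟩

theorem pairCells_injective : Function.Injective pairCells := by
  intro p p' h
  refine part_ext fun c => Partn.ext_iff'.2 fun s => ?_
  have h1 : ∀ m, m < (part p c).1 s ↔ m < (part p' c).1 s := fun m => by
    have := Finset.ext_iff.1 h (c, s, m)
    rwa [mem_pairCells, mem_pairCells] at this
  have h2 := h1 ((part p c).1 s)
  have h3 := h1 ((part p' c).1 s)
  omega

/-- `p'` is obtained from `p` by adding the box `b`. -/
def PairCov (p : Partn × Partn) (b : PBox) (p' : Partn × Partn) : Prop :=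
  AddBox (part p b.1) (part p' b.1) b.2.1 ∧ b.2.2 = (part p b.1).1 b.2.1 ∧
    part p' (!b.1) = part p (!b.1)

theorem pairCov_iff {p p' : Partn × Partn} {b : PBox} :
    PairCov p b p' ↔ b ∉ pairCells p ∧ pairCells p' = insert b (pairCells p) := by
  obtain ⟨c, j, m⟩ := b
  constructor
  · rintro ⟨h1, h2, h3⟩
    dsimp only at h1 h2 h3
    refine ⟨by rw [mem_pairCells]; dsimp only; omega, ?_⟩
    ext ⟨c', j', m'⟩
    rw [Finset.mem_insert, mem_pairCells, mem_pairCells]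
    simp only [Prod.mk.injEq]
    rcases eq_or_ne c' c with rfl | hc
    · rcases eq_or_ne j' j with rfl | hj
      · rw [h1.self]; simp only [true_and]; omega
      · rw [h1.of_ne hj]; simp [hj]
    · have : c' = !c := by cases c <;> cases c' <;> simp_all
      subst this
      rw [h3]; simp [hc]
  · rintro ⟨h1, h2⟩
    have key : ∀ c' j' m', m' < (part p' c').1 j' ↔ (c' = c ∧ j' = j ∧ m' = m) ∨
        m' < (part p c').1 j' := by
      intro c' j' m'
      have := Finset.ext_iff.1 h2 (c', j', m')
      rwa [Finset.mem_insert, mem_pairCells, mem_pairCells, Prod.mk.injEq, Prod.mk.injEq] at this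
    rw [mem_pairCells] at h1
    dsimp only at h1
    have hoff : ∀ c' j', ¬ (c' = c ∧ j' = j) → (part p' c').1 j' = (part p c').1 j' := by
      intro c' j' h
      have k1 := key c' j' ((part p' c').1 j')
      have k2 := key c' j' ((part p c').1 j')
      have k3 : ∀ m', ¬ (c' = c ∧ j' = j ∧ m' = m) := fun m' hh => h ⟨hh.1, hh.2.1⟩
      rw [or_iff_right (k3 _)] at k1 k2
      omega
    have k1 := (key c j m).2 (Or.inl ⟨rfl, rfl, rfl⟩)
    have k2 := key c j ((part p c).1 j)
    have k3 := key c j ((part p' c).1 j - 1)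
    simp only [true_and] at k2 k3
    have hm : m = (part p c).1 j := by
      by_contra hne
      rcases k2.1 (by omega) with h | h <;> omega
    have hj : (part p' c).1 j = (part p c).1 j + 1 := by
      have k4 := key c j (m + 1)
      simp only [true_and] at k4
      omega
    refine ⟨Finsupp.ext fun s => ?_, hm, Partn.ext_iff'.2 fun s => hoff _ _ (by simp)⟩
    rw [Finsupp.add_apply]
    dsimp only
    rcases eq_or_ne s j with rfl | hs
    · rw [Finsupp.single_eq_same, hj]
    · rw [Finsupp.single_eq_of_ne hs, add_zero]
      exact hoff c s (by simp [hs])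

/-- The pairs of partitions that interlace with shifts `a`, `b` if `L` holds. -/
def pairSet (L : Prop) (a b : ℕ) : Set (Partn × Partn) := {p | L → p ∈ interlacing a b}

theorem mem_interlacing {p : Partn × Partn} {a b : ℕ} :
    p ∈ interlacing a b ↔ ∀ s, (part p true).1 (s + b) ≤ (part p false).1 s + a := by
  unfold interlacing
  rw [Set.mem_ofPred_eq]
  refine forall_congr' fun s => ?_
  change (p.2.1 (s + b) : ℤ) - a ≤ p.1.1 s ↔ p.2.1 (s + b) ≤ p.1.1 s + a
  omega

open Classical in
/-- The addable boxes of a pair, in the set of all pairs. -/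
def pairAdds (p : Partn × Partn) : Finset PBox :=
  Finset.univ.biUnion fun c : Bool => (part p c).addBoxes.image fun b => (c, b)

theorem mem_pairAdds {p : Partn × Partn} {b : PBox} :
    b ∈ pairAdds p ↔ b.2 ∈ (part p b.1).addBoxes := by
  classical
  unfold pairAdds
  simp only [Finset.mem_biUnion, Finset.mem_univ, true_and, Finset.mem_image]
  constructor
  · rintro ⟨c, b', h, rfl⟩; exact h
  · intro h; exact ⟨b.1, b.2, h, rfl⟩

theorem PairCov.mem_addBoxes {p p' : Partn × Partn} {b : PBox} (h : PairCov p b p') :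
    b.2 ∈ (part p b.1).addBoxes := Partn.mem_addBoxes.2 ⟨h.1.addRow, h.2.1⟩

theorem PairCov.mem_remBoxes {p p' : Partn × Partn} {b : PBox} (h : PairCov p b p') :
    b.2 ∈ (part p' b.1).remBoxes :=
  Partn.mem_remBoxes.2 ⟨h.1.remRow, by rw [h.1.self, h.2.1]⟩

/-- The pair with the component `c` replaced. -/
def setPart (p : Partn × Partn) (c : Bool) (lam : Partn) : Partn × Partn :=
  bif c then (p.1, lam) else (lam, p.2)

theorem part_setPart (p : Partn × Partn) (c : Bool) (lam : Partn) : part (setPart p c lam) c = lam := by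
  cases c <;> rfl

theorem part_setPart_not (p : Partn × Partn) (c : Bool) (lam : Partn) :
    part (setPart p c lam) (!c) = part p (!c) := by
  cases c <;> rfl

theorem exists_pairCov_of_mem_addBoxes {p : Partn × Partn} {b : PBox}
    (h : b.2 ∈ (part p b.1).addBoxes) : ∃ p', PairCov p b p' := by
  obtain ⟨h1, h2⟩ := Partn.mem_addBoxes.1 h
  obtain ⟨lam', h3⟩ := h1.exists_addBox
  exact ⟨setPart p b.1 lam', by rw [part_setPart]; exact h3, h2, part_setPart_not _ _ _⟩

theorem exists_pairCov_of_mem_remBoxes {p : Partn × Partn} {b : PBox}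
    (h : b.2 ∈ (part p b.1).remBoxes) : ∃ p', PairCov p' b p := by
  obtain ⟨h1, h2⟩ := Partn.mem_remBoxes.1 h
  obtain ⟨lam', h3⟩ := h1.exists_addBox
  refine ⟨setPart p b.1 lam', ?_⟩
  refine ⟨by rw [part_setPart]; exact h3, ?_, (part_setPart_not _ _ _).symm⟩
  rw [part_setPart]
  have := h3.self
  omega

section PairLattice

variable (L : Prop) (a b : ℕ)

/-- The interlacing condition compares one row of each layer with a fixed shift, so it passes to
componentwise maxima and, likewise, to minima. -/
theorem pairSet_exists_union (p p' : pairSet L a b) :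
    ∃ s : pairSet L a b, pairCells s = pairCells p ∪ pairCells p' := by
  refine ⟨⟨((p.1.1.sup p'.1.1), (p.1.2.sup p'.1.2)), fun hL => mem_interlacing.2 fun s => ?_⟩, ?_⟩
  · have h1 := mem_interlacing.1 (p.2 hL) s
    have h2 := mem_interlacing.1 (p'.2 hL) s
    simp only [part, cond_true, cond_false, Partn.sup_apply] at *
    omega
  · ext ⟨c, j, m⟩
    rw [Finset.mem_union, mem_pairCells, mem_pairCells, mem_pairCells]
    cases c <;> simp [part, Partn.sup_apply]

theorem pairSet_exists_inter (p p' : pairSet L a b) :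
    ∃ s : pairSet L a b, pairCells s = pairCells p ∩ pairCells p' := by
  refine ⟨⟨((p.1.1.inf p'.1.1), (p.1.2.inf p'.1.2)), fun hL => mem_interlacing.2 fun s => ?_⟩, ?_⟩
  · have h1 := mem_interlacing.1 (p.2 hL) s
    have h2 := mem_interlacing.1 (p'.2 hL) s
    simp only [part, cond_true, cond_false, Partn.inf_apply] at *
    omega
  · ext ⟨c, j, m⟩
    rw [Finset.mem_inter, mem_pairCells, mem_pairCells, mem_pairCells]
    cases c <;> simp [part, Partn.inf_apply]

variable {L a b} in
theorem PairCov.mem_of_true {p p' : Partn × Partn} {bx : PBox} (h : PairCov p bx p')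
    (hb : bx.1 = true) (hp' : p' ∈ pairSet L a b) : p ∈ pairSet L a b := by
  intro hL
  refine mem_interlacing.2 fun s => ?_
  have h1 := mem_interlacing.1 (hp' hL) s
  obtain ⟨h2, -, h4⟩ := h
  rw [hb] at h2 h4
  rw [Bool.not_true] at h4
  rw [h4] at h1
  have h5 : (part p true).1 (s + b) ≤ (part p' true).1 (s + b) := by
    rw [h2]; simp
  omega

variable {L a b} in
theorem PairCov.mem_of_false {p p' : Partn × Partn} {bx : PBox} (h : PairCov p bx p')
    (hb : bx.1 = false) (hp : p ∈ pairSet L a b) : p' ∈ pairSet L a b := by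
  intro hL
  refine mem_interlacing.2 fun s => ?_
  have h1 := mem_interlacing.1 (hp hL) s
  obtain ⟨h2, -, h4⟩ := h
  rw [hb] at h2 h4
  rw [Bool.not_false] at h4
  rw [h4]
  have h5 : (part p false).1 s ≤ (part p' false).1 s := by
    rw [h2]; simp
  omega

/-- Removing a box of the second layer only relaxes the interlacing condition; once that layer is
empty the condition holds trivially and the first layer can be emptied freely. -/
theorem pairSet_exists_rem (p : pairSet L a b) (hp : p.1 ≠ (Partn.empty, Partn.empty)) :
    ∃ (p' : pairSet L a b) (bx : PBox), PairCov p' bx p := by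
  by_cases hmu : p.1.2 = Partn.empty
  · have hlam : p.1.1 ≠ Partn.empty := fun h => hp (Prod.ext h hmu)
    obtain ⟨j, hj⟩ := Partn.exists_remRow hlam
    have hm : (j, p.1.1.1 j - 1) ∈ p.1.1.remBoxes :=
      Partn.mem_remBoxes.2 ⟨hj, by unfold Partn.RemRow at hj; dsimp only; omega⟩
    obtain ⟨p', hp'⟩ := exists_pairCov_of_mem_remBoxes (p := p.1) (b := (false, j, p.1.1.1 j - 1)) hm
    refine ⟨⟨p', fun _ => mem_interlacing.2 fun s => ?_⟩, _, hp'⟩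
    have h2 : part p.1 true = part p' true := hp'.2.2
    rw [← h2]
    change p.1.2.1 (s + b) ≤ _
    rw [hmu, Partn.empty_apply]
    exact Nat.zero_le _
  · obtain ⟨j, hj⟩ := Partn.exists_remRow hmu
    have hm : (j, p.1.2.1 j - 1) ∈ p.1.2.remBoxes :=
      Partn.mem_remBoxes.2 ⟨hj, by unfold Partn.RemRow at hj; dsimp only; omega⟩
    obtain ⟨p', hp'⟩ := exists_pairCov_of_mem_remBoxes (p := p.1) (b := (true, j, p.1.2.1 j - 1)) hm
    exact ⟨⟨p', hp'.mem_of_true rfl p.2⟩, _, hp'⟩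

/-- A box brings with it all boxes above it and all boxes to its left, so N boxes lie in an N × N
square of each layer. -/
theorem finite_pairCells_card (N : ℕ) : {p | (pairCells p).card = N}.Finite := by
  refine Set.Finite.of_finite_image (f := pairCells) ?_ pairCells_injective.injOn
  refine ((Finset.univ ×ˢ (Finset.range N ×ˢ Finset.range N)).powerset : Finset (Finset PBox)).finite_toSet.subset ?_
  rintro _ ⟨p, hp, rfl⟩
  rw [Finset.mem_coe, Finset.mem_powerset]
  rintro ⟨c, j, m⟩ hb
  rw [mem_pairCells] at hb
  dsimp only at hb
  rw [Set.mem_ofPred_eq] at hp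
  have h1 : (Finset.range (j + 1)).image (fun s => ((c, s, 0) : PBox)) ⊆ pairCells p := by
    intro x hx
    obtain ⟨s, hs, rfl⟩ := Finset.mem_image.1 hx
    rw [mem_pairCells]
    have := (part p c).anti (Nat.lt_succ_iff.1 (Finset.mem_range.1 hs))
    dsimp only; omega
  have h2 : (Finset.range (m + 1)).image (fun s => ((c, j, s) : PBox)) ⊆ pairCells p := by
    intro x hx
    obtain ⟨s, hs, rfl⟩ := Finset.mem_image.1 hx
    rw [mem_pairCells]
    have := Finset.mem_range.1 hs
    dsimp only; omega
  have h3 := Finset.card_le_card h1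
  have h4 := Finset.card_le_card h2
  rw [Finset.card_image_of_injective _ (fun x y h => by simpa using h), Finset.card_range] at h3 h4
  simp only [Finset.mem_product, Finset.mem_univ, Finset.mem_range, true_and]
  omega

open Classical in
/-- The lattice of pairs of partitions. -/
def pairLattice : BoxLattice (pairSet L a b) PBox where
  cells p := pairCells p
  cells_injective := pairCells_injective.comp Subtype.val_injective
  exists_union := pairSet_exists_union L a b
  exists_inter := pairSet_exists_inter L a b
  adds p := (pairAdds p).filter fun bx => ∃ p' : pairSet L a b, PairCov p bx p'
  mem_adds p bx := by
    rw [Finset.mem_filter]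
    constructor
    · rintro ⟨-, p', h⟩
      exact ⟨(pairCov_iff.1 h).1, p', (pairCov_iff.1 h).2⟩
    · rintro ⟨h, p', h'⟩
      have h1 : PairCov p bx p' := pairCov_iff.2 ⟨h, h'⟩
      exact ⟨mem_pairAdds.2 h1.mem_addBoxes, p', h1⟩
  vac := ⟨(Partn.empty, Partn.empty), fun _ => mem_interlacing.2 fun _ => Nat.zero_le _⟩
  cells_vac := by
    ext ⟨c, j, m⟩
    rw [mem_pairCells]
    cases c <;> simp [part, Partn.empty_apply]
  exists_rem p hp := by
    obtain ⟨p', bx, h⟩ := pairSet_exists_rem L a b p fun h => hp (Subtype.ext h)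
    exact ⟨p', bx, (pairCov_iff.1 h).1, (pairCov_iff.1 h).2⟩
  finite_card N := Set.Finite.preimage Subtype.val_injective.injOn (finite_pairCells_card N)

variable {L a b}

theorem pairLattice_cov {p p' : pairSet L a b} {bx : PBox} :
    (pairLattice L a b).Cov p bx p' ↔ PairCov p bx p' := by
  rw [pairCov_iff]
  exact Iff.rfl

theorem mem_pairLattice_adds {p : pairSet L a b} {bx : PBox} :
    bx ∈ (pairLattice L a b).adds p ↔ ∃ p' : pairSet L a b, PairCov p bx p' := by
  rw [(pairLattice L a b).mem_adds]
  constructor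
  · rintro ⟨h, p', h'⟩; exact ⟨p', pairLattice_cov.1 ⟨h, h'⟩⟩
  · rintro ⟨p', h⟩; exact ⟨(pairLattice_cov.2 h).1, p', (pairLattice_cov.2 h).2⟩

theorem mem_pairLattice_rems {p : pairSet L a b} {bx : PBox} :
    bx ∈ (pairLattice L a b).rems p ↔ ∃ p' : pairSet L a b, PairCov p' bx p := by
  rw [BoxLattice.mem_rems]
  simp only [pairLattice_cov]

end PairLattice

/-! ## Locations and colours of the boxes of pairs -/

section Geometry

variable {n : ℕ} (q d : ℂ) (k l : ZMod n) (u v : ℂ)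

/-- The spectral parameter of a layer. -/
def lpar (c : Bool) : ℂ := bif c then v else u

/-- The colour shift of a layer. -/
def lcol (c : Bool) : ZMod n := bif c then l else k

/-- The location of a box. -/
def bloc (x : PBox) : ℂ := xloc q d (lpar u v x.1) x.2.2 x.2.1

/-- The colour of a box. -/
def bcolor (x : PBox) : ZMod n := bcol (lcol k l x.1) x.2.2 x.2.1

/-- The horizontal coordinate of a box after the second layer has been shifted. -/
def siteX (a : ℕ) (x : PBox) : ℤ := x.2.2 - bif x.1 then (a : ℤ) + 1 else 0

/-- The vertical coordinate of a box after the second layer has been shifted. -/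
def siteY (b : ℕ) (x : PBox) : ℤ := x.2.1 - bif x.1 then (b : ℤ) + 1 else 0

/-- The standing assumptions; `L` says whether there is a resonance. -/
structure TensorData (L : Prop) (a b : ℕ) : Prop where
  hn : 3 ≤ n
  hq : q ≠ 0
  hd : d ≠ 0
  hu : u ≠ 0
  hv : v ≠ 0
  hgen : GenericParams q d
  res : L → Resonance q d k l u v a b
  nonres : ¬ L → ∀ a b : ℤ, ¬ Resonance q d k l u v a b

variable {q d k l u v}

/-- Writing q₂ = (q₁q₃)⁻¹ shows that the origin of the second layer lies in column -a-1 and row -b-1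
of the first, with matching colour. -/
theorem resonance_iff (hq : q ≠ 0) (hd : d ≠ 0) (a b : ℤ) :
    Resonance q d k l u v a b ↔ v = xloc q d u (-a - 1) (-b - 1) ∧ l = bcol k (-a - 1) (-b - 1) := by
  have h1 : u * (q ^ 2) ^ (b + 1) * (d / q) ^ (b - a) = xloc q d u (-a - 1) (-b - 1) := by
    have hq1 := div_ne_zero hd hq
    have hq3 := one_div_ne_zero (mul_ne_zero hd hq)
    have e : q ^ 2 = (d / q)⁻¹ * (1 / (d * q))⁻¹ := by field_simp
    unfold xloc
    rw [e, mul_zpow, inv_zpow', inv_zpow', mul_comm u, mul_right_comm, mul_right_comm _ _ ((d / q) ^ _),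
      ← zpow_add₀ hq1]
    congr 3 <;> ring
  have h2 : ((b - a : ℤ) : ZMod n) = k - l ↔ l = bcol k (-a - 1) (-b - 1) := by
    unfold bcol; push_cast
    constructor <;> intro h <;> linear_combination h
  rw [Resonance, h1, h2, eq_comm]

theorem xloc_add (hq : q ≠ 0) (hd : d ≠ 0) (m s m' s' : ℤ) :
    xloc q d (xloc q d u m' s') m s = xloc q d u (m + m') (s + s') := by
  unfold xloc
  rw [zpow_add₀ (div_ne_zero hd hq), zpow_add₀ (one_div_ne_zero (mul_ne_zero hd hq))]
  ring

namespace TensorData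

variable {L : Prop} {a b : ℕ} (D : TensorData q d k l u v L a b)
include D

theorem lpar_ne (c : Bool) : lpar u v c ≠ 0 := by
  cases c
  · exact D.hu
  · exact D.hv

theorem bloc_ne (x : PBox) : bloc q d u v x ≠ 0 := xloc_ne_zero D.hq D.hd (D.lpar_ne _) _ _

/-- A relation between boxes of different layers expresses v and l through u and k, so it is itself
a resonance. Hence `L` holds, and genericity identifies its shifts with `a` and `b`. -/
theorem site_step_aux {m j m' j' α γ : ℤ}
    (h : xloc q d v m' j' = (d / q) ^ α * (1 / (d * q)) ^ γ * xloc q d u m j)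
    (hc : bcol l m' j' = bcol k m j + (γ : ZMod n) - (α : ZMod n)) :
    L ∧ m' - (a + 1) = m + α ∧ j' - (b + 1) = j + γ := by
  have hv : v = xloc q d u (m + α - m') (j + γ - j') := by
    have e : v = xloc q d (xloc q d v m' j') (-m') (-j') := by
      rw [xloc_add D.hq D.hd, neg_add_cancel, neg_add_cancel]; simp [xloc]
    have e2 : (d / q) ^ α * (1 / (d * q)) ^ γ * xloc q d u m j = xloc q d u (m + α) (j + γ) := by
      rw [add_comm m, add_comm j, ← xloc_add D.hq D.hd]; rfl
    rw [e, h, e2, xloc_add D.hq D.hd]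
    congr 1 <;> ring
  have hl : l = bcol k (m + α - m') (j + γ - j') := by
    unfold bcol at hc ⊢
    push_cast
    linear_combination hc
  have hL : L := by
    by_contra hL
    refine D.nonres hL (m' - m - α - 1) (j' - j - γ - 1) ((resonance_iff D.hq D.hd _ _).2 ⟨?_, ?_⟩)
    · convert hv using 2 <;> ring
    · convert hl using 2 <;> ring
  have h1 := ((resonance_iff D.hq D.hd _ _).1 (D.res hL)).1
  have h2 := xloc_inj D.hq D.hd D.hu D.hgen (hv.symm.trans h1)
  exact ⟨hL, by omega, by omega⟩

/-- Inside a layer this is genericity, and between layers it is `site_step_aux`, read backwards when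
the first box lies in the second layer. -/
theorem site_step {x y : PBox} (α γ : ℤ)
    (h : bloc q d u v y = (d / q) ^ α * (1 / (d * q)) ^ γ * bloc q d u v x)
    (hc : bcolor k l y = bcolor k l x + (γ : ZMod n) - (α : ZMod n)) :
    (x.1 = y.1 ∨ L) ∧ siteX a y = siteX a x + α ∧ siteY b y = siteY b x + γ := by
  obtain ⟨c, j, m⟩ := x
  obtain ⟨c', j', m'⟩ := y
  unfold bloc at h
  unfold bcolor at hc
  unfold siteX siteY
  dsimp only at h hc ⊢
  rcases eq_or_ne c c' with rfl | hcc
  · have := xloc_shift_inj D.hq D.hd (D.lpar_ne c) D.hgen h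
    exact ⟨Or.inl rfl, by omega, by omega⟩
  · cases c <;> cases c' <;> first | exact absurd rfl hcc | skip
    · have := D.site_step_aux h hc
      simp only [cond_true, cond_false]
      exact ⟨Or.inr this.1, by omega, by omega⟩
    · have h' : xloc q d v m j = (d / q) ^ (-α) * (1 / (d * q)) ^ (-γ) * xloc q d u m' j' := by
        simp only [lpar, cond_true, cond_false] at h
        have hA := zpow_ne_zero α (div_ne_zero D.hd D.hq)
        have hB := zpow_ne_zero γ (one_div_ne_zero (mul_ne_zero D.hd D.hq))
        rw [h, zpow_neg, zpow_neg]
        generalize (d / q) ^ α = A at *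
        generalize (1 / (d * q)) ^ γ = B at *
        field_simp
      have := D.site_step_aux h' (by
        simp only [lcol, cond_true, cond_false] at hc
        push_cast; linear_combination -hc)
      simp only [cond_true, cond_false]
      exact ⟨Or.inr this.1, by omega, by omega⟩

theorem loc_of_site {x y : PBox} (α γ : ℤ) (hL : L) (hX : siteX a y = siteX a x + α)
    (hY : siteY b y = siteY b x + γ) :
    bloc q d u v y = (d / q) ^ α * (1 / (d * q)) ^ γ * bloc q d u v x ∧
      bcolor k l y = bcolor k l x + (γ : ZMod n) - (α : ZMod n) := by
  have h1 := (resonance_iff D.hq D.hd _ _).1 (D.res hL)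
  have key : ∀ x : PBox, bloc q d u v x = xloc q d u (siteX a x) (siteY b x) ∧
      bcolor k l x = bcol k (siteX a x) (siteY b x) := by
    rintro ⟨c, j, m⟩
    cases c
    · simp [bloc, bcolor, lpar, lcol, siteX, siteY]
    · simp only [bloc, bcolor, lpar, lcol, siteX, siteY, cond_true]
      constructor
      · rw [h1.1, xloc_add D.hq D.hd]
        congr 1 <;> ring
      · rw [h1.2]; unfold bcol; push_cast; ring
  rw [(key x).1, (key y).1, (key x).2, (key y).2, hX, hY]
  constructor
  · rw [add_comm _ α, add_comm _ γ, ← xloc_add D.hq D.hd]; rfl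
  · unfold bcol; push_cast; ring

theorem site_eq {x y : PBox} (h : bloc q d u v y = bloc q d u v x)
    (hc : bcolor k l y = bcolor k l x) :
    (x.1 = y.1 ∨ L) ∧ siteX a y = siteX a x ∧ siteY b y = siteY b x := by
  have := D.site_step (x := x) (y := y) 0 0 (by simp [h]) (by simp [hc])
  simpa using this

theorem site_diag {x y : PBox} (h : bloc q d u v y = q ^ 2 * bloc q d u v x)
    (hc : bcolor k l y = bcolor k l x) :
    (x.1 = y.1 ∨ L) ∧ siteX a y = siteX a x - 1 ∧ siteY b y = siteY b x - 1 := by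
  have hq := D.hq
  have hd := D.hd
  exact D.site_step (x := x) (y := y) (-1) (-1)
    (by rw [h, zpow_neg_one, zpow_neg_one]; field_simp) (by rw [hc]; ring)

theorem site_of_stepLoc {x y : PBox}
    (h : StepLoc q d (bcolor k l y) (bcolor k l x) (bloc q d u v x) (bloc q d u v y)) :
    (x.1 = y.1 ∨ L) ∧ (siteX a y = siteX a x - 1 ∧ siteY b y = siteY b x - 1 ∨
      siteX a y = siteX a x + 1 ∧ siteY b y = siteY b x ∨
      siteX a y = siteX a x ∧ siteY b y = siteY b x + 1) := by
  rcases h with ⟨h1, h2⟩ | ⟨h1, h2⟩ | ⟨h1, h2⟩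
  · have := D.site_diag h2 h1
    tauto
  · have := D.site_step (x := x) (y := y) 1 0 (by rw [h2]; simp) (by rw [h1]; simp)
    simp only [add_zero] at this
    tauto
  · have := D.site_step (x := x) (y := y) 0 1 (by rw [h2]; simp) (by rw [h1]; simp)
    simp only [add_zero] at this
    tauto

end TensorData

/-! ## The geometry of interlacing pairs -/

variable {L : Prop} {a b : ℕ} {p : Partn × Partn}

/-- In shifted coordinates a box of the second layer at a site forces boxes of the first layer at
all sites up to one diagonal step further; the shift by a + 1, b + 1 exceeds the interlacing shift
by one. -/
theorem lt_part_of_interlacing (hp : p ∈ interlacing a b) {j m X Y : ℕ} (h : m < (part p true).1 j)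
    (hX : X + a ≤ m) (hY : Y + b ≤ j) : X < (part p false).1 Y := by
  have h1 := mem_interlacing.1 hp Y
  have h2 := (part p true).anti hY
  omega

theorem lt_part_of_corner (hp : p ∈ interlacing a b) {bx : ℕ × ℕ}
    (h : bx ∈ (part p true).addBoxes ∨ bx ∈ (part p true).remBoxes) {X Y : ℕ}
    (hX : X + a + 1 ≤ bx.2) (hY : Y + b + 1 ≤ bx.1) : X < (part p false).1 (Y + 1) := by
  rcases h with h | h
  · have := (Partn.mem_addBoxes.1 h).2
    -- An addable box is not yet present, so its left neighbour is used; the bound on the column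
    -- shows that this neighbour exists.
    exact lt_part_of_interlacing hp (j := bx.1) (m := bx.2 - 1) (by omega) (by omega) (by omega)
  · have := (Partn.mem_remBoxes.1 h).2
    exact lt_part_of_interlacing hp (j := bx.1) (m := bx.2) (by omega) (by omega) (by omega)

theorem not_corner_of_lt {lam : Partn} {bx : ℕ × ℕ} (h : bx.2 < lam.1 (bx.1 + 1)) :
    ¬ (bx ∈ lam.addBoxes ∨ bx ∈ lam.remBoxes) := by
  have h0 := lam.anti (Nat.le_succ bx.1)
  rintro (h1 | h1)
  · have := (Partn.mem_addBoxes.1 h1).2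
    simp only [Nat.succ_eq_add_one] at h0; omega
  · have h2 := Partn.mem_remBoxes.1 h1
    have := h2.1
    unfold Partn.RemRow at this
    omega

namespace TensorData

variable (D : TensorData q d k l u v L a b)
include D

/-- On a common site, the corner of the second layer would force a box of the first layer just below
the corner of the first layer. -/
theorem corner_ne_of_layer (hp : p ∈ pairSet L a b) {x y : PBox} (hx1 : x.1 = false)
    (hy1 : y.1 = true)
    (hx : x.2 ∈ (part p false).addBoxes ∨ x.2 ∈ (part p false).remBoxes)
    (hy : y.2 ∈ (part p true).addBoxes ∨ y.2 ∈ (part p true).remBoxes)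
    (hc : bcolor k l x = bcolor k l y) : bloc q d u v x ≠ bloc q d u v y := by
  intro h
  obtain ⟨h1, h2, h3⟩ := D.site_eq h hc
  have hL : L := h1.resolve_left (by rw [hx1, hy1]; decide)
  unfold siteX at h2
  unfold siteY at h3
  rw [hx1, hy1] at h2 h3
  simp only [cond_true, cond_false] at h2 h3
  exact not_corner_of_lt (lt_part_of_corner (hp hL) hy (by omega) (by omega)) hx

theorem corner_inj (hp : p ∈ pairSet L a b) {x y : PBox}
    (hx : x.2 ∈ (part p x.1).addBoxes ∨ x.2 ∈ (part p x.1).remBoxes)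
    (hy : y.2 ∈ (part p y.1).addBoxes ∨ y.2 ∈ (part p y.1).remBoxes)
    (hc : bcolor k l x = bcolor k l y) (h : bloc q d u v x = bloc q d u v y) : x = y := by
  rcases eq_or_ne x.1 y.1 with hxy | hxy
  · obtain ⟨-, h2, h3⟩ := D.site_eq h hc
    unfold siteX at h2
    unfold siteY at h3
    rw [hxy] at h2 h3
    exact Prod.ext hxy (Prod.ext (by omega) (by omega))
  · exfalso
    cases hx1 : x.1 <;> cases hy1 : y.1 <;> rw [hx1] at hxy hx <;> rw [hy1] at hxy hy <;>
      first | exact hxy rfl | skip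
    · exact D.corner_ne_of_layer hp hx1 hy1 hx hy hc h
    · exact D.corner_ne_of_layer hp hy1 hx1 hy hx hc.symm h.symm

/-- No box of the second layer precedes a box missing in the first layer. -/
theorem not_stepLoc (hp : p ∈ pairSet L a b) {x y : PBox} (hx1 : x.1 = false) (hy1 : y.1 = true)
    (hx : (part p false).1 x.2.1 ≤ x.2.2) (hy : y.2.2 < (part p true).1 y.2.1) :
    ¬ StepLoc q d (bcolor k l y) (bcolor k l x) (bloc q d u v x) (bloc q d u v y) ∧
    ¬ StepLoc q d (bcolor k l x) (bcolor k l y) (bloc q d u v y) (bloc q d u v x) := by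
  have key : ∀ hL : L, ¬ (siteX a x ≤ siteX a y + 1 ∧ siteY b x ≤ siteY b y + 1) := by
    rintro hL ⟨h2, h3⟩
    unfold siteX at h2
    unfold siteY at h3
    rw [hx1, hy1] at h2 h3
    simp only [cond_true, cond_false] at h2 h3
    have := lt_part_of_interlacing (hp hL) hy (X := x.2.2) (Y := x.2.1) (by omega) (by omega)
    omega
  constructor <;> intro h
  · obtain ⟨h1, h2⟩ := D.site_of_stepLoc h
    exact key (h1.resolve_left (by rw [hx1, hy1]; decide)) (by omega)
  · obtain ⟨h1, h2⟩ := D.site_of_stepLoc h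
    exact key (h1.resolve_left (by rw [hx1, hy1]; decide)) (by omega)

/-- The eigenvalue on the first layer vanishes at an addable box of the second layer if and only
if adding the box leads out of the set. -/
theorem first_zero_iff (hp : p ∈ pairSet L a b) {p' : Partn × Partn} {y : PBox} (hy1 : y.1 = true)
    (h : PairCov p y p') :
    ((∃ c ∈ (part p false).addBoxes, bcolor k l y = bcol k c.2 c.1 ∧
        bloc q d u v y = q ^ 2 * xloc q d u c.2 c.1) ∨
      ∃ c ∈ (part p false).remBoxes, bcolor k l y = bcol k c.2 c.1 ∧
        xloc q d u c.2 c.1 = q ^ 2 * bloc q d u v y) ↔ p' ∉ pairSet L a b := by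
  have hy := h.mem_addBoxes
  obtain ⟨h1, h2, h3⟩ := h
  rw [hy1] at h1 h2 h3 hy
  rw [Bool.not_true] at h3
  have hself := h1.self
  constructor
  · rintro (⟨c, hc, hcol, hloc⟩ | ⟨c, hc, hcol, hloc⟩) hp'
    · have hs := D.site_diag (x := (false, c)) hloc hcol
      have hL : L := hs.1.resolve_left (by rw [hy1]; simp)
      obtain ⟨-, hX, hY⟩ := hs
      unfold siteX at hX
      unfold siteY at hY
      rw [hy1] at hX hY
      simp only [cond_true, cond_false] at hX hY
      -- The box c lies one diagonal step after y, so the presence of y in an interlacing pair would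
      -- force c to be present.
      have := lt_part_of_interlacing (hp' hL) (j := y.2.1) (m := y.2.2) (X := c.2) (Y := c.1)
        (by omega) (by omega) (by omega)
      rw [h3] at this
      have := (Partn.mem_addBoxes.1 hc).2
      omega
    · have hs := D.site_diag (y := (false, c)) hloc hcol.symm
      have hL : L := hs.1.resolve_left (by rw [hy1]; simp)
      obtain ⟨-, hX, hY⟩ := hs
      unfold siteX at hX
      unfold siteY at hY
      rw [hy1] at hX hY
      simp only [cond_true, cond_false] at hX hY
      -- Here c lies one diagonal step before y, and a box below c is forced, so c is no corner at
      -- all.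
      exact not_corner_of_lt (lt_part_of_corner (hp hL) (Or.inl hy) (by omega) (by omega)) (Or.inr hc)
  · intro hp'
    have hL : L := by
      by_contra hL
      exact hp' fun hL' => absurd hL' hL
    have hI := mem_interlacing.1 (hp hL)
    have : ¬ ∀ s, (part p' true).1 (s + b) ≤ (part p' false).1 s + a := fun hh =>
      hp' fun _ => mem_interlacing.2 hh
    push Not at this
    obtain ⟨Y, hY⟩ := this
    rw [h3] at hY
    have hrow : y.2.1 = Y + b := by
      by_contra hne
      rw [h1.of_ne (Ne.symm hne)] at hY
      exact absurd (hI Y) (by omega)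
    rw [← hrow, hself] at hY
    have hIY := hI Y
    rw [← hrow] at hIY
    -- The inequality is an equality in row Y. Strictness above row Y + b of the second layer, where
    -- y is addable, passes to the first layer.
    have hadd : (Y, (part p false).1 Y) ∈ (part p false).addBoxes := by
      refine Partn.mem_addBoxes.2 ⟨fun t ht => ?_, rfl⟩
      have h5 := (Partn.mem_addBoxes.1 hy).1 (t := t + b) (by omega)
      have h6 := hI t
      dsimp only
      omega
    have hs := D.loc_of_site (x := (false, Y, (part p false).1 Y)) (y := y) (-1) (-1) hL
      (by unfold siteX; rw [hy1]; simp only [cond_true, cond_false]; omega)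
      (by unfold siteY; rw [hy1]; simp only [cond_true, cond_false]; omega)
    refine Or.inl ⟨_, hadd, ?_, ?_⟩
    · rw [hs.2]; unfold bcolor; simp only [lcol, cond_false]; ring
    · rw [hs.1, zpow_neg_one, zpow_neg_one]
      have hq := D.hq
      have hd := D.hd
      unfold bloc; simp only [lpar, cond_false]
      field_simp

/-- The eigenvalue on the second layer vanishes at a removable box of the first layer if and only
if removing the box leads out of the set. -/
theorem second_zero_iff {p p' : Partn × Partn} (hp' : p' ∈ pairSet L a b) {x : PBox}
    (hx1 : x.1 = false) (h : PairCov p x p') :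
    ((∃ c ∈ (part p' true).addBoxes, bcolor k l x = bcol l c.2 c.1 ∧
        bloc q d u v x = q ^ 2 * xloc q d v c.2 c.1) ∨
      ∃ c ∈ (part p' true).remBoxes, bcolor k l x = bcol l c.2 c.1 ∧
        xloc q d v c.2 c.1 = q ^ 2 * bloc q d u v x) ↔ p ∉ pairSet L a b := by
  have hx := h.mem_remBoxes
  obtain ⟨h1, h2, h3⟩ := h
  rw [hx1] at h1 h2 h3 hx
  rw [Bool.not_false] at h3
  have hself := h1.self
  constructor
  · rintro (⟨c, hc, hcol, hloc⟩ | ⟨c, hc, hcol, hloc⟩) hp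
    · have hs := D.site_diag (x := (true, c)) hloc hcol
      have hL : L := hs.1.resolve_left (by rw [hx1]; simp)
      obtain ⟨-, hX, hY⟩ := hs
      unfold siteX at hX
      unfold siteY at hY
      rw [hx1] at hX hY
      simp only [cond_true, cond_false] at hX hY
      have h4 := lt_part_of_corner (hp' hL) (Or.inl hc) (X := x.2.2 + 1) (Y := x.2.1 + 1)
        (by omega) (by omega)
      have h5 := (Partn.mem_remBoxes.1 hx).2
      have h6 := (part p' false).anti (a := x.2.1) (b := x.2.1 + 1 + 1) (by omega)
      omega
    · have hs := D.site_diag (y := (true, c)) hloc hcol.symm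
      have hL : L := hs.1.resolve_left (by rw [hx1]; simp)
      obtain ⟨-, hX, hY⟩ := hs
      unfold siteX at hX
      unfold siteY at hY
      rw [hx1] at hX hY
      simp only [cond_true, cond_false] at hX hY
      have h5 := (Partn.mem_remBoxes.1 hc).2
      rw [h3] at h5
      have := lt_part_of_interlacing (hp hL) (j := c.1) (m := c.2) (X := x.2.2) (Y := x.2.1)
        (by omega) (by omega) (by omega)
      omega
  · intro hp
    have hL : L := by
      by_contra hL
      exact hp fun hL' => absurd hL' hL
    have hI := mem_interlacing.1 (hp' hL)
    have : ¬ ∀ s, (part p true).1 (s + b) ≤ (part p false).1 s + a := fun hh =>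
      hp fun _ => mem_interlacing.2 hh
    push Not at this
    obtain ⟨Y, hY⟩ := this
    rw [← h3] at hY
    have hrow : x.2.1 = Y := by
      by_contra hne
      have := h1.of_ne (Ne.symm hne)
      have := hI Y
      omega
    subst hrow
    have hIY := hI x.2.1
    -- The inequality is tight in the row of x, so row x.2.1 + b of the second layer ends in column
    -- x.2.2 + a; it drops strictly below because the row of x does.
    have hrem : (x.2.1 + b, x.2.2 + a) ∈ (part p' true).remBoxes := by
      refine Partn.mem_remBoxes.2 ⟨?_, by dsimp only; omega⟩
      have h5 := (Partn.mem_remBoxes.1 hx).1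
      unfold Partn.RemRow at h5 ⊢
      have h6 := hI (x.2.1 + 1)
      rw [add_right_comm] at h6
      dsimp only
      omega
    have hs := D.loc_of_site (x := x) (y := (true, x.2.1 + b, x.2.2 + a)) (-1) (-1) hL
      (by unfold siteX; rw [hx1]; simp only [cond_true, cond_false]; push_cast; omega)
      (by unfold siteY; rw [hx1]; simp only [cond_true, cond_false]; push_cast; omega)
    refine Or.inr ⟨_, hrem, ?_, ?_⟩
    · have := hs.2
      unfold bcolor at this ⊢; simp only [lcol, cond_true] at this ⊢
      rw [this]; ring
    · have := hs.1
      have hq := D.hq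
      have hd := D.hd
      unfold bloc at this ⊢; simp only [lpar, cond_true] at this ⊢
      rw [this, zpow_neg_one, zpow_neg_one]
      field_simp

end TensorData

end Geometry

/-! ## Forced corners and the wheel condition -/

section Geometry

variable {n : ℕ} {q d : ℂ} {k l : ZMod n} {u v : ℂ} {L : Prop} {a b : ℕ}

theorem PairCov.le {p p' : Partn × Partn} {x : PBox} (h : PairCov p x p') (c : Bool) (s : ℕ) :
    (part p c).1 s ≤ (part p' c).1 s ∧ (part p' c).1 s ≤ (part p c).1 s + 1 := by
  rcases eq_or_ne c x.1 with rfl | hc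
  · rcases eq_or_ne s x.2.1 with rfl | hs
    · rw [h.1.self]; omega
    · rw [h.1.of_ne hs]; omega
  · have hc' : c = !x.1 := by revert hc; cases c <;> cases x.1 <;> decide
    rw [hc', h.2.2]; omega

theorem PairCov.not_mem {p p' : Partn × Partn} {x : PBox} (h : PairCov p x p') :
    (part p x.1).1 x.2.1 ≤ x.2.2 := h.2.1.ge

theorem PairCov.mem {p p' : Partn × Partn} {x : PBox} (h : PairCov p x p') :
    x.2.2 < (part p' x.1).1 x.2.1 := by
  rw [h.1.self, h.2.1]; exact Nat.lt_succ_self _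

namespace TensorData

variable (D : TensorData q d k l u v L a b)
include D

/-- A corner c of `p` on the site of y is y itself when the layers agree, which is impossible.
Otherwise a corner in the second layer forces y to be present already, and y in the second layer
forces boxes beyond c. -/
theorem corner_forced {p pa s : Partn × Partn} (hp : p ∈ pairSet L a b) (hs : s ∈ pairSet L a b)
    {x y c : PBox} (hx : PairCov p x pa) (hy : PairCov pa y s)
    (hyp : ¬ ∃ p' : pairSet L a b, PairCov p y p')
    (hc : (∃ p' : pairSet L a b, PairCov p c p') ∨ ∃ p' : pairSet L a b, PairCov p' c p) :
    ¬ (bcolor k l c = bcolor k l y ∧ bloc q d u v c = bloc q d u v y) := by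
  rintro ⟨hcol, hloc⟩
  obtain ⟨h1, h2, h3⟩ := D.site_eq hloc hcol
  have hcc : c.2 ∈ (part p c.1).addBoxes ∨ c.2 ∈ (part p c.1).remBoxes := by
    rcases hc with ⟨p', h⟩ | ⟨p', h⟩
    · exact Or.inl h.mem_addBoxes
    · exact Or.inr h.mem_remBoxes
  have hy1 := hy.not_mem
  have hy2 := hy.mem
  unfold siteX at h2
  unfold siteY at h3
  rcases eq_or_ne y.1 c.1 with hyc | hyc
  · rw [hyc] at h2 h3
    have hcy : c = y := Prod.ext hyc.symm (Prod.ext (by omega) (by omega))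
    subst hcy
    rcases hc with h | ⟨p', h⟩
    · exact hyp h
    · have := h.mem
      have := (hx.le c.1 c.2.1).1
      omega
  · have hL := h1.resolve_left hyc
    cases hyl : y.1 <;> cases hcl : c.1 <;> rw [hyl, hcl] at h2 h3 hyc <;> rw [hcl] at hcc <;>
      rw [hyl] at hy1 hy2 <;> first | exact absurd rfl hyc | skip
    · simp only [cond_true, cond_false] at h2 h3
      have h4 := lt_part_of_corner (hp hL) hcc (X := y.2.2) (Y := y.2.1) (by omega) (by omega)
      have h5 := (part p false).anti (Nat.le_succ y.2.1)
      have h6 := (hx.le false y.2.1).1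
      simp only [Nat.succ_eq_add_one] at h5
      omega
    · simp only [cond_true, cond_false] at h2 h3
      -- The forced box lies one diagonal step beyond c. This leaves room for the single box by
      -- which the first layers of `p` and `pa` may differ.
      have h4 := lt_part_of_interlacing (hs hL) hy2 (X := c.2.2 + 1) (Y := c.2.1 + 1) (by omega)
        (by omega)
      have h5 := (hx.le false (c.2.1 + 1)).2
      have h6 : part s false = part pa false := by have := hy.2.2; rwa [hyl] at this
      rw [h6] at h4
      exact not_corner_of_lt (lam := part p false) (bx := c.2) (by omega) hcc

/-- In shifted coordinates a₂ follows a₁ by (1, 1), and y is one of the two boxes between. In every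
choice of layers monotonicity and interlacing force one of the three boxes to belong to `p` already.
-/
theorem wheel {p s : Partn × Partn} (hp : p ∈ pairSet L a b) (hs : s ∈ pairSet L a b)
    {a₁ a₂ y : PBox} (hcol : bcolor k l a₁ = bcolor k l a₂)
    (hy : bcolor k l y = bcolor k l a₁ + 1 ∧ bloc q d u v y = 1 / (d * q) * bloc q d u v a₁ ∨
      bcolor k l a₁ = bcolor k l y + 1 ∧ bloc q d u v y = d / q * bloc q d u v a₁)
    (hloc : bloc q d u v a₁ = q ^ 2 * bloc q d u v a₂)
    (h1 : a₁ ∉ pairCells p) (h2 : a₂ ∉ pairCells p) (h3 : y ∉ pairCells p) :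
    pairCells s ≠ insert a₁ (insert a₂ (insert y (pairCells p))) := by
  intro hcells
  have key : ∀ c j m, m < (part s c).1 j ↔ (c, j, m) = a₁ ∨ (c, j, m) = a₂ ∨ (c, j, m) = y ∨
      m < (part p c).1 j := by
    intro c j m
    have := Finset.ext_iff.1 hcells (c, j, m)
    simpa only [Finset.mem_insert, mem_pairCells] using this
  obtain ⟨hL1, hX1, hY1⟩ := D.site_diag hloc hcol
  have hysite : siteX a y = siteX a a₁ ∧ siteY b y = siteY b a₁ + 1 ∨
      siteX a y = siteX a a₁ + 1 ∧ siteY b y = siteY b a₁ := by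
    rcases hy with ⟨hc, hl⟩ | ⟨hc, hl⟩
    · have := (D.site_step (x := a₁) (y := y) 0 1 (by rw [hl]; simp) (by rw [hc]; simp)).2
      rw [add_zero] at this; exact Or.inl this
    · have := (D.site_step (x := a₁) (y := y) 1 0 (by rw [hl]; simp) (by rw [hc]; simp)).2
      rw [add_zero] at this; exact Or.inr this
  clear hcol hy hloc hcells
  obtain ⟨c₁, j₁, m₁⟩ := a₁
  obtain ⟨c₂, j₂, m₂⟩ := a₂
  obtain ⟨cy, jy, my⟩ := y
  rw [mem_pairCells] at h1 h2 h3
  unfold siteX at hX1 hysite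
  unfold siteY at hY1 hysite
  dsimp only at *
  have m1 := (key c₁ j₁ m₁).2 (Or.inl rfl)
  have m2 := (key c₂ j₂ m₂).2 (Or.inr (Or.inl rfl))
  have m3 := (key cy jy my).2 (Or.inr (Or.inr (Or.inl rfl)))
  have an := fun c s t h => (part p c).anti (a := s) (b := t) h
  have ans := fun c t t' h => (part s c).anti (a := t) (b := t') h
  simp only [Prod.mk.injEq] at key
  cases c₁ <;> cases c₂ <;> simp only [cond_true, cond_false] at hX1 hY1 hysite
  -- Within one layer a₂ needs both boxes between it and a₁; at most one of them is y, and the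
  -- other, lying in `p`, forces a₁ into `p`.
  · have e1 := (key false j₁ (m₁ + 1)).1 (by have := ans false j₁ j₂ (by omega); omega)
    have e2 := (key false (j₁ + 1) m₁).1 (by have := ans false (j₁ + 1) j₂ (by omega); omega)
    have := an false j₁ (j₁ + 1) (by omega)
    omega
  · have hL : L := hL1.resolve_left (by decide)
    -- A second-layer a₂ forces the first-layer box two diagonal steps after a₁, which is none of
    -- the added boxes.
    have e1 := lt_part_of_interlacing (hs hL) m2 (X := m₁ + 2) (Y := j₁ + 2) (by omega) (by omega)
    have e2 := (key false (j₁ + 2) (m₁ + 2)).1 e1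
    have := an false j₁ (j₁ + 2) (by omega)
    cases cy <;> simp only [cond_true, cond_false, true_and, false_and, false_or, reduceCtorEq] at hysite e2 <;> omega
  · have hL : L := hL1.resolve_left (by decide)
    cases cy <;> simp only [cond_true, cond_false] at hysite
    -- With y in the first layer, a box of the second layer next to a₁ already lies in `p` and
    -- forces y; with y in the second layer, y forces a box beyond a₂, and hence a₂.
    · rcases hysite with ⟨hx, hy⟩ | ⟨hx, hy⟩
      · have e1 := (key true j₁ (m₁ - 1)).1 (by omega)
        simp only [true_and, false_and, false_or, reduceCtorEq] at e1
        have e2 := lt_part_of_interlacing (hp hL) (j := j₁) (m := m₁ - 1) (by omega) (X := my) (Y := jy)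
          (by omega) (by omega)
        omega
      · have e0 := ans true (j₁ - 1) j₁ (by omega)
        have e1 := (key true (j₁ - 1) m₁).1 (by omega)
        simp only [true_and, false_and, false_or, reduceCtorEq] at e1
        have e2 := lt_part_of_interlacing (hp hL) (j := j₁ - 1) (m := m₁) (by omega) (X := my) (Y := jy)
          (by omega) (by omega)
        omega
    · rcases hysite with ⟨hx, hy⟩ | ⟨hx, hy⟩
      · have e1 := lt_part_of_interlacing (hs hL) m3 (X := m₂) (Y := j₂ + 1) (by omega) (by omega)
        have e2 := (key false (j₂ + 1) m₂).1 e1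
        simp only [true_and, false_and, false_or, reduceCtorEq] at e2
        have := an false j₂ (j₂ + 1) (by omega)
        omega
      · have e1 := lt_part_of_interlacing (hs hL) m3 (X := m₂ + 1) (Y := j₂) (by omega) (by omega)
        have e2 := (key false j₂ (m₂ + 1)).1 e1
        simp only [true_and, false_and, false_or, reduceCtorEq] at e2
        omega
  · have e1 := (key true j₁ (m₁ + 1)).1 (by have := ans true j₁ j₂ (by omega); omega)
    have e2 := (key true (j₁ + 1) m₁).1 (by have := ans true (j₁ + 1) j₂ (by omega); omega)
    have := an true j₁ (j₁ + 1) (by omega)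
    omega

end TensorData

end Geometry

/-! ## Eigenvalues on pairs -/

section PairK

variable {n : ℕ} (q d : ℂ) (k l : ZMod n) (u v : ℂ)

/-- The eigenvalue of `K_i(z)` on the component `c` of a pair. -/
def partK (i : ZMod n) (p : Partn × Partn) (c : Bool) (z : RatFunc ℂ) : RatFunc ℂ :=
  fockK q d (lcol k l c) (lpar u v c) i (part p c) z

/-- The eigenvalue of `Δ K_i(z)` on a pair. -/
def pairK (i : ZMod n) (p : Partn × Partn) (z : RatFunc ℂ) : RatFunc ℂ :=
  partK q d k l u v i p false z * partK q d k l u v i p true z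

open Classical in
/-- The corners of colour `i` of a pair. -/
def pairCorners (i : ZMod n) (p : Partn × Partn) : Finset PBox :=
  (colCorners k i p.1).image (fun x => (false, x)) ∪ (colCorners l i p.2).image (fun x => (true, x))

variable {q d k l u v}

theorem mem_pairCorners {i : ZMod n} {p : Partn × Partn} {x : PBox} :
    x ∈ pairCorners k l i p ↔
      (x.2 ∈ (part p x.1).addBoxes ∨ x.2 ∈ (part p x.1).remBoxes) ∧ bcolor k l x = i := by
  classical
  unfold pairCorners
  rw [Finset.mem_union, Finset.mem_image, Finset.mem_image]
  obtain ⟨c, y⟩ := x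
  constructor
  · rintro (⟨y', h, he⟩ | ⟨y', h, he⟩) <;> obtain ⟨rfl, rfl⟩ := Prod.mk.inj he <;>
      rw [mem_colCorners] at h <;> exact ⟨h.1, h.2.symm⟩
  · rintro ⟨h1, h2⟩
    cases c
    · exact Or.inl ⟨y, mem_colCorners.2 ⟨h1, h2.symm⟩, rfl⟩
    · exact Or.inr ⟨y, mem_colCorners.2 ⟨h1, h2.symm⟩, rfl⟩

open Classical in
theorem pairK_eq_prod (hn : 3 ≤ n) (hq : q ≠ 0) (hd : d ≠ 0) (i : ZMod n) (p : Partn × Partn)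
    {z : RatFunc ℂ} (hz : ∀ c, z ≠ RatFunc.C c) :
    pairK q d k l u v i p z = ∏ x ∈ pairCorners k l i p,
      (RatFunc.C (if x.2 ∈ (part p x.1).addBoxes then q⁻¹ else q) * z -
        RatFunc.C (if x.2 ∈ (part p x.1).addBoxes then q * bloc q d u v x else q⁻¹ * bloc q d u v x)) /
        (z - RatFunc.C (bloc q d u v x)) := by
  have hfac : ∀ x : PBox, (RatFunc.C (if x.2 ∈ (part p x.1).addBoxes then q⁻¹ else q) * z -
        RatFunc.C (if x.2 ∈ (part p x.1).addBoxes then q * bloc q d u v x else q⁻¹ * bloc q d u v x)) /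
        (z - RatFunc.C (bloc q d u v x)) =
      cornerFac q d (lpar u v x.1) RatFunc.C (part p x.1) x.2 z := by
    intro x
    unfold cornerFac afac bfac bloc
    split_ifs <;> rfl
  rw [Finset.prod_congr rfl fun x _ => hfac x, pairCorners, Finset.prod_union,
    Finset.prod_image (by intro x _ y _ h; exact (Prod.mk.inj h).2),
    Finset.prod_image (by intro x _ y _ h; exact (Prod.mk.inj h).2), pairK, partK, partK,
    fockK_eq_prod_corners hn hq hd i _ hz, fockK_eq_prod_corners hn hq hd i _ hz]
  · rfl
  · rw [Finset.disjoint_left]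
    intro x h1 h2
    obtain ⟨y, -, rfl⟩ := Finset.mem_image.1 h1
    obtain ⟨y', -, h⟩ := Finset.mem_image.1 h2
    simp at h

theorem partK_ratio (hn : 3 ≤ n) (hq : q ≠ 0) (hd : d ≠ 0) (i : ZMod n) {p p' : Partn × Partn}
    {x : PBox} (h : PairCov p x p') {z : RatFunc ℂ} (hz : ∀ c, z ≠ RatFunc.C c) :
    IsKRatio q d RatFunc.C i (bcolor k l x) (bloc q d u v x) z (partK q d k l u v i p x.1 z)
      (partK q d k l u v i p' x.1 z) := by
  have := fockK_ratio (k := lcol k l x.1) (u := lpar u v x.1) hn hq hd i h.1 hz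
  rw [← h.2.1] at this
  exact this

theorem partK_not {i : ZMod n} {p p' : Partn × Partn} {x : PBox} (h : PairCov p x p')
    (z : RatFunc ℂ) : partK q d k l u v i p' (!x.1) z = partK q d k l u v i p (!x.1) z := by
  unfold partK; rw [h.2.2]

theorem pairK_eq (i : ZMod n) (p : Partn × Partn) (c : Bool) (z : RatFunc ℂ) :
    pairK q d k l u v i p z = partK q d k l u v i p c z * partK q d k l u v i p (!c) z := by
  cases c
  · rfl
  · exact mul_comm _ _

theorem pairK_ratio (hn : 3 ≤ n) (hq : q ≠ 0) (hd : d ≠ 0) (i : ZMod n) {p p' : Partn × Partn}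
    {x : PBox} (h : PairCov p x p') {z : RatFunc ℂ} (hz : ∀ c, z ≠ RatFunc.C c) :
    IsKRatio q d RatFunc.C i (bcolor k l x) (bloc q d u v x) z (pairK q d k l u v i p z)
      (pairK q d k l u v i p' z) := by
  rw [pairK_eq i p x.1, pairK_eq i p' x.1, partK_not h]
  exact (partK_ratio hn hq hd i h hz).mul_right _

theorem pairK_ne_zero (hn : 3 ≤ n) (hq : q ≠ 0) (hd : d ≠ 0) (i : ZMod n)
    (p : Partn × Partn) : pairK q d k l u v i p RatFunc.X ≠ 0 := by
  classical
  have key : ∀ (α β : ℂ), α ≠ 0 → (RatFunc.C α * RatFunc.X - RatFunc.C β : RatFunc ℂ) ≠ 0 := by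
    intro α β hα h
    have h1 := (HasVal.linear ((β + 1) / α) α β).unique (by rw [h]; exact HasVal.zero _)
    rw [mul_div_cancel₀ _ hα] at h1
    simp at h1
  rw [pairK_eq_prod hn hq hd i p X_ne_C]
  refine Finset.prod_ne_zero_iff.2 fun x _ => div_ne_zero (key _ _ ?_) (sub_ne_zero.2 (X_ne_C _))
  split_ifs
  · exact inv_ne_zero hq
  · exact hq

end PairK

/-! ## Matrix coefficients on pairs -/

section PairCoef

variable {n : ℕ} (q d : ℂ) (k l : ZMod n) (u v : ℂ)

/-- The value at `x` of the eigenvalue of `K_i(z)` on the component `c`. -/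
def kval (c : Bool) (i : ZMod n) (p : Partn × Partn) (x : ℂ) : ℂ :=
  (partK q d k l u v i p c RatFunc.X).eval (RingHom.id ℂ) x

/-- The coefficient of `Δ E_i(z)` for adding the box `x` to `p`. -/
def pairE (p : Partn × Partn) (x : PBox) : ℂ :=
  (bif x.1 then kval q d k l u v (!x.1) (bcolor k l x) p (bloc q d u v x) else 1) *
    fe q d (lcol k l x.1) (lpar u v x.1) (part p x.1) x.2.1

/-- The coefficient of `Δ F_i(z)` for removing the box `x` that was added to `p`. -/
def pairF (p : Partn × Partn) (x : PBox) : ℂ :=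
  (bif x.1 then 1 else kval q d k l u v (!x.1) (bcolor k l x) p (bloc q d u v x)) *
    ff q d (lcol k l x.1) (lpar u v x.1) (part p x.1) x.2.1

variable {q d k l u v}

/-- The coproduct puts K into E for the second layer and into F for the first, so in the product it
occurs once in either case. -/
theorem pairE_mul_pairF (p : Partn × Partn) (x : PBox) :
    pairE q d k l u v p x * pairF q d k l u v p x =
      kval q d k l u v (!x.1) (bcolor k l x) p (bloc q d u v x) *
      (fe q d (lcol k l x.1) (lpar u v x.1) (part p x.1) x.2.1 *
        ff q d (lcol k l x.1) (lpar u v x.1) (part p x.1) x.2.1) := by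
  unfold pairE pairF
  cases x.1 <;> simp only [cond_true, cond_false] <;> ring

theorem kval_congr {c : Bool} {p p' : Partn × Partn} (h : part p' c = part p c) (i : ZMod n) (x : ℂ) :
    kval q d k l u v c i p' x = kval q d k l u v c i p x := by
  unfold kval partK; rw [h]

theorem IsKRatio.eval {i j : ZMod n} {x z c₀ c : ℂ} {h₀ h : RatFunc ℂ}
    (H : IsKRatio q d RatFunc.C i j x RatFunc.X h₀ h) (h0 : HasVal h₀ z c₀) (h1 : HasVal h z c) :
    IsKRatio q d (RingHom.id ℂ) i j x z c₀ c := by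
  refine ⟨?_, fun hA => (h1.unique (H.2 hA ▸ h0))⟩
  have e1 := h1.mul (HasVal.linear z (d ^ skewM i j) (q ^ cartanA i j * x))
  have e2 := (HasVal.linear z (d ^ skewM i j * q ^ cartanA i j) x).mul h0
  have H1 : h * (RatFunc.C (d ^ skewM i j) * RatFunc.X - RatFunc.C (q ^ cartanA i j * x)) =
      (RatFunc.C (d ^ skewM i j * q ^ cartanA i j) * RatFunc.X - RatFunc.C x) * h₀ := by
    linear_combination -H.1
  rw [H1] at e1
  have := e1.unique e2
  simp only [RingHom.id_apply]
  linear_combination -this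

variable {L : Prop} {a b : ℕ}

namespace TensorData

variable (D : TensorData q d k l u v L a b)
include D

theorem corner_avoids {p : Partn × Partn} (hp : p ∈ pairSet L a b) {x : PBox}
    (hx : x.2 ∈ (part p x.1).addBoxes ∨ x.2 ∈ (part p x.1).remBoxes) :
    ∀ y ∈ colCorners (lcol k l !x.1) (bcolor k l x) (part p !x.1),
      bloc q d u v x ≠ xloc q d (lpar u v !x.1) y.2 y.1 := by
  intro y hy h
  obtain ⟨h1, h2⟩ := mem_colCorners.1 hy
  have := D.corner_inj hp (x := x) (y := (!x.1, y)) hx h1 h2 h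
  have h3 := congrArg Prod.fst this
  simp at h3

/-- All poles of the other factor are at its corners of this colour, and none of them has the
location of a corner of the given layer. -/
theorem hasVal_partK {p : Partn × Partn} (hp : p ∈ pairSet L a b) {x : PBox}
    (hx : x.2 ∈ (part p x.1).addBoxes ∨ x.2 ∈ (part p x.1).remBoxes) :
    HasVal (partK q d k l u v (bcolor k l x) p (!x.1) RatFunc.X) (bloc q d u v x)
      (kval q d k l u v (!x.1) (bcolor k l x) p (bloc q d u v x)) :=
  ⟨(hasVal_fockK D.hn D.hq D.hd _ _ (D.corner_avoids hp hx)).1, rfl⟩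

theorem kval_eq_zero_iff {p : Partn × Partn} (hp : p ∈ pairSet L a b) {x : PBox}
    (hx : x.2 ∈ (part p x.1).addBoxes ∨ x.2 ∈ (part p x.1).remBoxes) :
    kval q d k l u v (!x.1) (bcolor k l x) p (bloc q d u v x) = 0 ↔
      (∃ c ∈ (part p !x.1).addBoxes, bcolor k l x = bcol (lcol k l !x.1) c.2 c.1 ∧
        bloc q d u v x = q ^ 2 * xloc q d (lpar u v !x.1) c.2 c.1) ∨
      ∃ c ∈ (part p !x.1).remBoxes, bcolor k l x = bcol (lcol k l !x.1) c.2 c.1 ∧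
        xloc q d (lpar u v !x.1) c.2 c.1 = q ^ 2 * bloc q d u v x := by
  have h1 := D.corner_avoids hp hx
  rw [← prod_cornerFac_eq_zero_iff D.hq _ _ h1,
    ← (hasVal_fockK D.hn D.hq D.hd _ _ h1).unique (D.hasVal_partK hp hx)]

theorem kval_add_eq_zero_iff {p p' : Partn × Partn} (hp : p ∈ pairSet L a b) {x : PBox}
    (h : PairCov p x p') (hx : x.1 = true) :
    kval q d k l u v (!x.1) (bcolor k l x) p (bloc q d u v x) = 0 ↔ p' ∉ pairSet L a b := by
  rw [D.kval_eq_zero_iff hp (Or.inl h.mem_addBoxes), ← D.first_zero_iff hp hx h, hx]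
  exact Iff.rfl

theorem kval_rem_eq_zero_iff {p p' : Partn × Partn} (hp' : p' ∈ pairSet L a b) {x : PBox}
    (h : PairCov p x p') (hx : x.1 = false) :
    kval q d k l u v (!x.1) (bcolor k l x) p (bloc q d u v x) = 0 ↔ p ∉ pairSet L a b := by
  rw [← kval_congr h.2.2, D.kval_eq_zero_iff hp' (Or.inr h.mem_remBoxes),
    ← D.second_zero_iff hp' hx h, hx]
  exact Iff.rfl

theorem fe_ne {p p' : Partn × Partn} {x : PBox} (h : PairCov p x p') :
    fe q d (lcol k l x.1) (lpar u v x.1) (part p x.1) x.2.1 ≠ 0 :=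
  fe_ne_zero D.hq D.hd (D.lpar_ne _) D.hgen h.1.addRow

theorem ff_ne {p p' : Partn × Partn} {x : PBox} (h : PairCov p x p') :
    ff q d (lcol k l x.1) (lpar u v x.1) (part p x.1) x.2.1 ≠ 0 :=
  ff_ne_zero D.hq D.hd (D.lpar_ne _) D.hgen h.1.addRow

/-- The Fock coefficient never vanishes and adding to the first layer never leaves the set, so the
factor K on the first layer alone decides. This is why the subspace is preserved. -/
theorem pairE_eq_zero_iff {p p' : Partn × Partn} (hp : p ∈ pairSet L a b) {x : PBox}
    (h : PairCov p x p') : pairE q d k l u v p x = 0 ↔ p' ∉ pairSet L a b := by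
  unfold pairE
  rw [mul_eq_zero, or_iff_left (D.fe_ne h)]
  cases hx : x.1
  · simp only [cond_false, one_ne_zero, false_iff, not_not]
    exact h.mem_of_false hx hp
  · rw [cond_true, ← hx]
    exact D.kval_add_eq_zero_iff hp h hx

theorem pairF_eq_zero_iff {p p' : Partn × Partn} (hp' : p' ∈ pairSet L a b) {x : PBox}
    (h : PairCov p x p') : pairF q d k l u v p x = 0 ↔ p ∉ pairSet L a b := by
  unfold pairF
  rw [mul_eq_zero, or_iff_left (D.ff_ne h)]
  cases hx : x.1
  · rw [cond_false, ← hx]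
    exact D.kval_rem_eq_zero_iff hp' h hx
  · simp only [cond_true, one_ne_zero, false_iff, not_not]
    exact h.mem_of_true hx hp'

theorem hasVal_pairK_add {p p' : Partn × Partn} (hp : p ∈ pairSet L a b) {x : PBox}
    (h : PairCov p x p') :
    HasVal (pairK q d k l u v (bcolor k l x) p RatFunc.X * (RatFunc.X - RatFunc.C (bloc q d u v x)))
      (bloc q d u v x)
      ((q⁻¹ - q) * bloc q d u v x * (pairE q d k l u v p x * pairF q d k l u v p x)) := by
  have h1 := hasVal_fockK_add (k := lcol k l x.1) (u := lpar u v x.1) D.hn D.hq D.hd (D.lpar_ne _)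
    D.hgen h.1.addRow
  rw [← h.2.1] at h1
  have h2 := h1.mul (D.hasVal_partK hp (Or.inl h.mem_addBoxes))
  rw [pairE_mul_pairF, pairK_eq _ _ x.1, mul_right_comm]
  rw [mul_comm (kval q d k l u v (!x.1) (bcolor k l x) p (bloc q d u v x)), ← mul_assoc]
  exact h2

theorem hasVal_pairK_rem {p p' : Partn × Partn} (hp' : p' ∈ pairSet L a b) {x : PBox}
    (h : PairCov p x p') :
    HasVal (pairK q d k l u v (bcolor k l x) p' RatFunc.X * (RatFunc.X - RatFunc.C (bloc q d u v x)))
      (bloc q d u v x)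
      ((q - q⁻¹) * bloc q d u v x * (pairE q d k l u v p x * pairF q d k l u v p x)) := by
  have h1 := hasVal_fockK_rem (k := lcol k l x.1) (u := lpar u v x.1) D.hn D.hq D.hd (D.lpar_ne _)
    D.hgen h.1
  rw [← h.2.1] at h1
  have h2 := h1.mul (D.hasVal_partK hp' (Or.inr h.mem_remBoxes))
  rw [pairE_mul_pairF, pairK_eq _ _ x.1, mul_right_comm, ← kval_congr h.2.2]
  rw [mul_comm (kval q d k l u v (!x.1) (bcolor k l x) p' (bloc q d u v x)), ← mul_assoc]
  exact h2

/-- In one layer this is `fe_mul_ff_comm`. If x is in the first layer and y in the second, no factor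
K is involved. In the opposite case both factors K change, and the changes compensate by
`IsKRatio.exchange`. -/
theorem pairE_mul_pairF_comm {p pa pb s : Partn × Partn} (hp : p ∈ pairSet L a b)
    (hpa : pa ∈ pairSet L a b) (hpb : pb ∈ pairSet L a b) {x y : PBox} (hxy : x ≠ y)
    (hx : PairCov p x pa) (hy : PairCov p y pb) (hys : PairCov pa y s) (hxs : PairCov pb x s) :
    pairE q d k l u v p x * pairF q d k l u v p y = pairF q d k l u v pa y * pairE q d k l u v pb x := by
  rcases eq_or_ne x.1 y.1 with hc | hc
  · have hrow : x.2.1 ≠ y.2.1 := by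
      intro h
      have h1 := hx.2.1
      have h2 := hy.2.1
      rw [hc, h, ← h2] at h1
      exact hxy (Prod.ext hc (Prod.ext h h1))
    have hx2 := hx.2.2
    have hx1 := hx.1
    have hy2 := hy.2.2
    rw [hc] at hx2 hx1
    have := fe_mul_ff_comm (k := lcol k l y.1) (u := lpar u v y.1) D.hn D.hq D.hd (D.lpar_ne _) D.hgen hrow
      hx1 hy.1 hys.1.addRow
    unfold pairE pairF
    rw [hc, kval_congr hx2, kval_congr hy2]
    linear_combination (bif y.1 then kval q d k l u v (!y.1) (bcolor k l x) p (bloc q d u v x) else 1) *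
      (bif y.1 then 1 else kval q d k l u v (!y.1) (bcolor k l y) p (bloc q d u v y)) * this
  · have hcx : y.1 = !x.1 := by revert hc; cases x.1 <;> cases y.1 <;> decide
    have hpax : part pa y.1 = part p y.1 := by rw [hcx]; exact hx.2.2
    have hpby : part pb x.1 = part p x.1 := by
      have := hy.2.2
      rwa [hcx, Bool.not_not] at this
    cases hx1 : x.1
    · have hy1 : y.1 = true := by rw [hcx, hx1]; rfl
      unfold pairE pairF
      rw [hpax, hpby, hx1, hy1]
      simp only [cond_true, cond_false]
      ring
    · have hy1 : y.1 = false := by rw [hcx, hx1]; rfl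
      have hxF := D.hasVal_partK hp (Or.inl hx.mem_addBoxes)
      have hxF' := D.hasVal_partK hpb (Or.inl hxs.mem_addBoxes)
      have hyF := D.hasVal_partK hp (Or.inl hy.mem_addBoxes)
      have hyF' := D.hasVal_partK hpa (Or.inl hys.mem_addBoxes)
      have H := partK_ratio (k := k) (l := l) (u := u) (v := v) D.hn D.hq D.hd (bcolor k l x) hy X_ne_C
      have G := partK_ratio (k := k) (l := l) (u := u) (v := v) D.hn D.hq D.hd (bcolor k l y) hx X_ne_C
      rw [hcx] at H
      rw [hcx, Bool.not_not] at hyF hyF'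
      -- In `pa` the box x of the second layer is present while y is still missing from the first,
      -- so no elementary step relates them.
      have hns := D.not_stepLoc hpa (x := y) (y := x) hy1 hx1
        (by have := hys.not_mem; rwa [hy1] at this) (by have := hx.mem; rwa [hx1] at this)
      have := IsKRatio.exchange D.hn D.hq D.hd (H.eval hxF hxF') (G.eval hyF hyF') hns.1 hns.2
      unfold pairE pairF
      rw [hpax, hpby, hcx, hx1]
      rw [hx1] at this
      simp only [cond_true, cond_false, Bool.not_true, Bool.not_false] at this ⊢
      linear_combination fe q d (lcol k l true) (lpar u v true) (part p true) x.2.1 *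
        ff q d (lcol k l false) (lpar u v false) (part p false) y.2.1 * this

open Classical in
/-- The difference of the two expansions is the sum of the contributions of the corners. -/
theorem exists_residues {p : pairSet L a b} (i : ZMod n) :
    ∃ c : PBox → ℂ,
      (∀ x ∈ pairCorners k l i p, HasVal (pairK q d k l u v i p RatFunc.X *
        (RatFunc.X - RatFunc.C (bloc q d u v x))) (bloc q d u v x) (c x)) ∧
      ∀ r : ℤ, ∑ x ∈ pairCorners k l i p, c x * bloc q d u v x ^ (r - 1) = (q - q⁻¹) *
        ((∑ x ∈ (pairLattice L a b).rems p, if bcolor k l x = i then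
          pairE q d k l u v ((pairLattice L a b).dn p x) x *
            pairF q d k l u v ((pairLattice L a b).dn p x) x * bloc q d u v x ^ r else 0)
        - ∑ x ∈ (pairLattice L a b).adds p, if bcolor k l x = i then
          pairE q d k l u v p x * pairF q d k l u v p x * bloc q d u v x ^ r else 0) := by
  set A := (pairLattice L a b).adds p with hA
  set R := (pairLattice L a b).rems p with hR
  refine ⟨fun x => (q - q⁻¹) * bloc q d u v x *
    ((if x ∈ R then pairE q d k l u v ((pairLattice L a b).dn p x) x *
      pairF q d k l u v ((pairLattice L a b).dn p x) x else 0) -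
    (if x ∈ A then pairE q d k l u v p x * pairF q d k l u v p x else 0)), ?_, ?_⟩
  · intro x hx
    obtain ⟨h1, rfl⟩ := mem_pairCorners.1 hx
    have hdj := Finset.disjoint_left.1 (part p.1 x.1).disjoint_addBoxes_remBoxes
    rcases h1 with h1 | h1
    · have hxR : x ∉ R := by
        rw [hR, mem_pairLattice_rems]
        rintro ⟨p', hp'⟩
        exact hdj h1 hp'.mem_remBoxes
      obtain ⟨p', hp'⟩ := exists_pairCov_of_mem_addBoxes h1
      dsimp only
      rw [if_neg hxR]
      convert D.hasVal_pairK_add p.2 hp' using 1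
      -- A corner of a partition at which the move leaves the set contributes no residue, because
      -- the coefficient vanishes there.
      by_cases hxA : x ∈ A
      · rw [if_pos hxA]; ring
      · rw [if_neg hxA, (D.pairE_eq_zero_iff p.2 hp').2 fun h =>
          hxA (mem_pairLattice_adds.2 ⟨⟨p', h⟩, hp'⟩)]
        ring
    · have hxA : x ∉ A := by
        rw [hA, mem_pairLattice_adds]
        rintro ⟨p', hp'⟩
        exact hdj hp'.mem_addBoxes h1
      obtain ⟨p', hp'⟩ := exists_pairCov_of_mem_remBoxes h1
      dsimp only
      rw [if_neg hxA]
      convert D.hasVal_pairK_rem p.2 hp' using 1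
      by_cases hxR : x ∈ R
      · obtain ⟨p'', hp''⟩ := mem_pairLattice_rems.1 hxR
        have e : p''.1 = p' := by
          have h1 := pairCov_iff.1 hp'
          have h2 := pairCov_iff.1 hp''
          apply pairCells_injective
          rw [← Finset.erase_insert h1.1, ← Finset.erase_insert h2.1, ← h1.2, ← h2.2]
        rw [if_pos hxR, (pairLattice_cov.2 hp'').dn_eq, e]; ring
      · rw [if_neg hxR, (D.pairF_eq_zero_iff p.2 hp').2 fun h =>
          hxR (mem_pairLattice_rems.2 ⟨⟨p', h⟩, hp'⟩)]
        ring
  · intro r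
    have key : ∀ (B : Finset PBox) (_ : ∀ x ∈ B, bcolor k l x = i → x ∈ pairCorners k l i p)
        (g : PBox → ℂ), ∑ x ∈ pairCorners k l i p, (if x ∈ B then g x else 0) =
        ∑ x ∈ B, if bcolor k l x = i then g x else 0 := by
      intro B hB g
      rw [← Finset.sum_filter, ← Finset.sum_filter]
      refine Finset.sum_congr ?_ fun _ _ => rfl
      ext x
      rw [Finset.mem_filter, Finset.mem_filter]
      exact ⟨fun h => ⟨h.2, (mem_pairCorners.1 h.1).2⟩, fun h => ⟨hB x h.1 h.2, h.1⟩⟩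
    rw [← key R fun x hx hi => by
        obtain ⟨p', hp'⟩ := mem_pairLattice_rems.1 hx
        exact mem_pairCorners.2 ⟨Or.inr hp'.mem_remBoxes, hi⟩,
      ← key A fun x hx hi => by
        obtain ⟨p', hp'⟩ := mem_pairLattice_adds.1 hx
        exact mem_pairCorners.2 ⟨Or.inl hp'.mem_addBoxes, hi⟩,
      ← Finset.sum_sub_distrib, Finset.mul_sum]
    refine Finset.sum_congr rfl fun x _ => ?_
    have : bloc q d u v x ^ r = bloc q d u v x * bloc q d u v x ^ (r - 1) := by
      rw [← zpow_one_add₀ (D.bloc_ne x)]; congr 1; ring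
    rw [this]
    by_cases h1 : x ∈ R <;> by_cases h2 : x ∈ A <;> simp only [h1, h2, if_true, if_false] <;> ring

/-- The expansions of the eigenvalue. -/
theorem deltaK_expansion {p : pairSet L a b} (i : ZMod n) (r : ℤ) :
    (r < 0 → deltaK q d k l u v true i r p = 0) ∧ (0 < r → deltaK q d k l u v false i r p = 0) ∧
    deltaK q d k l u v true i 0 p * deltaK q d k l u v false i 0 p = 1 ∧
    deltaK q d k l u v false i 0 p =
      ∏ x ∈ pairCorners k l i p, (open Classical in if x.2 ∈ (part p.1 x.1).addBoxes then q else q⁻¹) ∧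
    deltaK q d k l u v true i r p - deltaK q d k l u v false i r p = (q - q⁻¹) *
        ((∑ x ∈ (pairLattice L a b).rems p, open Classical in if bcolor k l x = i then
          pairE q d k l u v ((pairLattice L a b).dn p x) x *
            pairF q d k l u v ((pairLattice L a b).dn p x) x * bloc q d u v x ^ r else 0)
        - ∑ x ∈ (pairLattice L a b).adds p, open Classical in if bcolor k l x = i then
          pairE q d k l u v p x * pairF q d k l u v p x * bloc q d u v x ^ r else 0) := by
  classical
  obtain ⟨c, hc, hsum⟩ := D.exists_residues (p := p) i
  have H := fun r => coeff_prod_linear (T := pairCorners k l i p) (x := bloc q d u v) (c := c)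
    (f := pairK q d k l u v i p) D.bloc_ne
    (fun x hx y hy h => by
      obtain ⟨hx1, hx2⟩ := mem_pairCorners.1 hx
      obtain ⟨hy1, hy2⟩ := mem_pairCorners.1 hy
      exact D.corner_inj p.2 hx1 hy1 (hx2.trans hy2.symm) h)
    (fun z hz => pairK_eq_prod D.hn D.hq D.hd i p hz) hc r
  have hT : ∀ r, deltaK q d k l u v true i r p = _ := fun r => (H r).1
  have hF : ∀ r, deltaK q d k l u v false i r p = _ := fun r => (H r).2.1
  have h0 := (H 0).2.2
  have hβ : ∏ x ∈ pairCorners k l i p, (if x.2 ∈ (part p.1 x.1).addBoxes then q * bloc q d u v x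
      else q⁻¹ * bloc q d u v x) / bloc q d u v x =
      ∏ x ∈ pairCorners k l i p, (if x.2 ∈ (part p.1 x.1).addBoxes then q else q⁻¹) := by
    refine Finset.prod_congr rfl fun x _ => ?_
    split_ifs <;> exact mul_div_cancel_right₀ _ (D.bloc_ne x)
  refine ⟨fun hr => ?_, fun hr => ?_, ?_, ?_, ?_⟩
  · rw [hT, if_neg hr.ne, if_neg hr.le.not_gt]
  · rw [hF, if_neg hr.ne', if_neg hr.le.not_gt]
  · rw [hT, hF, if_pos rfl, if_pos rfl, hβ, ← Finset.prod_mul_distrib]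
    refine Finset.prod_eq_one fun x _ => ?_
    split_ifs
    · exact inv_mul_cancel₀ D.hq
    · exact mul_inv_cancel₀ D.hq
  · rw [hF, if_pos rfl, hβ]
  · rw [← hsum, hT, hF]
    rcases lt_trichotomy r 0 with h | h | h
    · rw [if_neg h.ne, if_neg h.le.not_gt, if_neg h.ne, if_pos h]; ring
    · subst h
      rw [if_pos rfl, if_pos rfl, h0]; rfl
    · rw [if_neg h.ne', if_pos h, if_neg h.ne', if_neg h.le.not_gt, sub_zero]

end TensorData

end PairCoef

/-! ## The eigenvalues determine the pair -/

section WeightInj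

variable {n : ℕ} (q d : ℂ) (k l : ZMod n) (u v : ℂ)

/-- The numerator of the contribution of a box to the eigenvalue of `K_i(z)`, at `0` when the
colours are not adjacent. -/
def boxNum (i : ZMod n) (x : PBox) : ℂ :=
  if cartanA i (bcolor k l x) = 0 then 0 else d ^ skewM i (bcolor k l x) * q ^ cartanA i (bcolor k l x)

/-- The constant and the linear coefficient of the denominator of the contribution of a box. -/
def boxDen (i : ZMod n) (x : PBox) : ℂ × ℂ :=
  if cartanA i (bcolor k l x) = 0 then (bloc q d u v x, 0)
  else (q ^ cartanA i (bcolor k l x) * bloc q d u v x, d ^ skewM i (bcolor k l x))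

variable {q d k l u v} {L : Prop} {a b : ℕ}

theorem hasVal_sub_linear (z α β : ℂ) :
    HasVal (RatFunc.C β - RatFunc.C α * RatFunc.X) z (β - α * z) := by
  have := (HasVal.const z β).add ((HasVal.const z (-α)).mul (HasVal.X z))
  rw [map_neg] at this
  convert this using 1 <;> ring

theorem sub_linear_ne_zero (α : ℂ) {β : ℂ} (hβ : β ≠ 0) :
    (RatFunc.C β - RatFunc.C α * RatFunc.X : RatFunc ℂ) ≠ 0 := by
  intro h
  have := (hasVal_sub_linear 0 α β).unique (by rw [h]; exact HasVal.zero 0)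
  rw [mul_zero, sub_zero] at this
  exact hβ this

namespace TensorData

variable (D : TensorData q d k l u v L a b)
include D

/-- Box by box from the vacuum, by `pairK_ratio`. The form without denominators lets boxes of
unrelated colours put the same harmless factor on both sides. -/
theorem pairK_mul_boxDen (i : ZMod n) (p : pairSet L a b) :
    pairK q d k l u v i p RatFunc.X * ∏ x ∈ pairCells p.1,
        (RatFunc.C (boxDen q d k l u v i x).1 - RatFunc.C (boxDen q d k l u v i x).2 * RatFunc.X) =
      pairK q d k l u v i (pairLattice L a b).vac RatFunc.X * ∏ x ∈ pairCells p.1,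
        (RatFunc.C (bloc q d u v x) - RatFunc.C (boxNum q d k l i x) * RatFunc.X) := by
  induction p using (pairLattice L a b).vac_induction with
  | h0 =>
    have : pairCells (pairLattice L a b).vac.1 = ∅ := (pairLattice L a b).cells_vac
    rw [this, Finset.prod_empty, Finset.prod_empty]
  | hstep p x p' h ih =>
    have h' := pairLattice_cov.1 h
    obtain ⟨h1, h2⟩ := pairCov_iff.1 h'
    have key : pairK q d k l u v i p' RatFunc.X *
        (RatFunc.C (boxDen q d k l u v i x).1 - RatFunc.C (boxDen q d k l u v i x).2 * RatFunc.X) =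
        (RatFunc.C (bloc q d u v x) - RatFunc.C (boxNum q d k l i x) * RatFunc.X) *
          pairK q d k l u v i p RatFunc.X := by
      have H := pairK_ratio (k := k) (l := l) (u := u) (v := v) D.hn D.hq D.hd i h' X_ne_C
      unfold boxDen boxNum
      split_ifs with hA
      · rw [H.2 hA]; simp only [map_zero, zero_mul, sub_zero]; ring
      · linear_combination H.1
    rw [h2, Finset.prod_insert h1, Finset.prod_insert h1, ← mul_assoc, key, mul_assoc, ih]
    ring

theorem boxDen_ne_zero (i : ZMod n) (x : PBox) : (boxDen q d k l u v i x).1 ≠ 0 := by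
  unfold boxDen
  split_ifs
  · exact D.bloc_ne x
  · exact mul_ne_zero (zpow_ne_zero _ D.hq) (D.bloc_ne x)

/-- The evaluation point lies one diagonal step before x₀. A numerator that vanishes there belongs
to a box displaced from x₀ by (-2, -2), (0, -1) or (-1, 0). -/
theorem box_of_num_zero {x₀ x : PBox}
    (h : bloc q d u v x - boxNum q d k l (bcolor k l x₀) x * (q ^ 2 * bloc q d u v x₀) = 0) :
    siteX a x + siteY b x < siteX a x₀ + siteY b x₀ := by
  have hq := D.hq
  have hd := D.hd
  unfold boxNum at h
  split_ifs at h with hA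
  · rw [zero_mul, sub_zero] at h
    exact absurd h (D.bloc_ne x)
  · have hS : StepLoc q d (bcolor k l x) (bcolor k l x₀) (q ^ 2 * bloc q d u v x₀) (bloc q d u v x) := by
      refine stepLoc_of_eq D.hn hq hd (by rwa [cartanA_comm]) ?_
      rw [cartanA_comm, skewM_comm D.hn, zpow_neg, sub_eq_zero.1 h]
      have := zpow_ne_zero (skewM (bcolor k l x₀) (bcolor k l x)) hd
      field_simp
    rcases hS with ⟨h1, h2⟩ | ⟨h1, h2⟩ | ⟨h1, h2⟩
    · have := D.site_step (x := x₀) (y := x) (-2) (-2) (by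
        rw [h2, show (-2 : ℤ) = -((2 : ℕ) : ℤ) by rfl, zpow_neg, zpow_neg, zpow_natCast, zpow_natCast]
        field_simp) (by rw [h1]; ring)
      omega
    · have := D.site_step (x := x₀) (y := x) 0 (-1) (by
        rw [h2, zpow_neg_one, zpow_zero]; field_simp) (by rw [h1]; push_cast; ring)
      omega
    · have := D.site_step (x := x₀) (y := x) (-1) 0 (by
        rw [h2, zpow_neg_one, zpow_zero]; field_simp) (by rw [h1]; push_cast; ring)
      omega

/-- A vanishing denominator belongs to a box on the site of x₀ or displaced from it by (-2, -1) or
(-1, -2). -/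
theorem box_of_den_zero {x₀ x : PBox}
    (h : (boxDen q d k l u v (bcolor k l x₀) x).1 -
      (boxDen q d k l u v (bcolor k l x₀) x).2 * (q ^ 2 * bloc q d u v x₀) = 0) :
    siteX a x + siteY b x < siteX a x₀ + siteY b x₀ ∨
      (x₀.1 = x.1 ∨ L) ∧ siteX a x = siteX a x₀ ∧ siteY b x = siteY b x₀ := by
  have hq := D.hq
  have hd := D.hd
  unfold boxDen at h
  split_ifs at h with hA
  · dsimp only at h
    rw [zero_mul, sub_zero] at h
    exact absurd h (D.bloc_ne x)
  · rcases stepLoc_of_eq D.hn hq hd hA (sub_eq_zero.1 h) with ⟨h1, h2⟩ | ⟨h1, h2⟩ | ⟨h1, h2⟩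
    · exact Or.inr (D.site_eq (mul_left_cancel₀ (pow_ne_zero 2 hq) h2).symm h1.symm)
    · have := D.site_step (x := x₀) (y := x) (-2) (-1) (by
        have h3 : bloc q d u v x = (d / q)⁻¹ * (q ^ 2 * bloc q d u v x₀) := by rw [h2]; field_simp
        rw [h3, show (-2 : ℤ) = -((2 : ℕ) : ℤ) by rfl, zpow_neg, zpow_neg_one, zpow_natCast]
        field_simp) (by rw [h1]; push_cast; ring)
      omega
    · have := D.site_step (x := x₀) (y := x) (-1) (-2) (by
        have h3 : bloc q d u v x = (1 / (d * q))⁻¹ * (q ^ 2 * bloc q d u v x₀) := by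
          rw [h2]; field_simp
        rw [h3, zpow_neg_one, show (-2 : ℤ) = -((2 : ℕ) : ℤ) by rfl, zpow_neg, zpow_natCast]
        field_simp) (by rw [h1]; push_cast; ring)
      omega

omit D in
theorem mem_of_same_site {p : Partn × Partn} (hp : p ∈ pairSet L a b) {x y : PBox} (hL : x.1 = y.1 ∨ L)
    (hX : siteX a x = siteX a y) (hY : siteY b x = siteY b y)
    (hx : x ∈ pairCells p) : y.1 = x.1 ∨ y.1 = false → y ∈ pairCells p := by
  rw [mem_pairCells] at hx ⊢
  unfold siteX at hX
  unfold siteY at hY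
  intro hl
  rcases eq_or_ne x.1 y.1 with h | h
  · rw [h] at hX hY hx
    have e1 : y.2.2 = x.2.2 := by omega
    have e2 : y.2.1 = x.2.1 := by omega
    rwa [e1, e2]
  · have hy : y.1 = false := hl.resolve_left (Ne.symm h)
    have hxt : x.1 = true := by
      cases hx1 : x.1
      · exact absurd (hx1.trans hy.symm) h
      · rfl
    rw [hy, hxt] at hX hY
    rw [hxt] at hx
    rw [hy]
    simp only [cond_true, cond_false] at hX hY
    exact lt_part_of_interlacing (hp (hL.resolve_left h)) hx (by omega) (by omega)

/-- Equal eigenvalues give an identity between the products over the two set differences. At q²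
times the location of x₀ one side vanishes because of x₀, and minimality of x₀ prevents the other
from vanishing. -/
theorem pairK_ne_of_min {p p' : pairSet L a b} {x₀ : PBox} (h0 : x₀ ∈ pairCells p.1)
    (h0' : x₀ ∉ pairCells p'.1)
    (hmin : ∀ x, x ∈ pairCells p.1 ∧ x ∉ pairCells p'.1 ∨ x ∈ pairCells p'.1 ∧ x ∉ pairCells p.1 →
      siteX a x₀ + siteY b x₀ ≤ siteX a x + siteY b x) :
    pairK q d k l u v (bcolor k l x₀) p RatFunc.X ≠ pairK q d k l u v (bcolor k l x₀) p' RatFunc.X := by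
  classical
  intro hK
  set i := bcolor k l x₀ with hi
  set N : PBox → RatFunc ℂ := fun x =>
    RatFunc.C (bloc q d u v x) - RatFunc.C (boxNum q d k l i x) * RatFunc.X with hN
  set E : PBox → RatFunc ℂ := fun x =>
    RatFunc.C (boxDen q d k l u v i x).1 - RatFunc.C (boxDen q d k l u v i x).2 * RatFunc.X with hE
  have hN0 : ∀ s : Finset PBox, ∏ x ∈ s, N x ≠ 0 := fun s =>
    Finset.prod_ne_zero_iff.2 fun x _ => sub_linear_ne_zero _ (D.bloc_ne x)
  have hE0 : ∀ s : Finset PBox, ∏ x ∈ s, E x ≠ 0 := fun s =>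
    Finset.prod_ne_zero_iff.2 fun x _ => sub_linear_ne_zero _ (D.boxDen_ne_zero i x)
  have e1 := D.pairK_mul_boxDen i p
  have e2 := D.pairK_mul_boxDen i p'
  rw [← hK] at e2
  have hv := pairK_ne_zero (k := k) (l := l) (u := u) (v := v) D.hn D.hq D.hd i (pairLattice L a b).vac.1
  have e3 : (∏ x ∈ pairCells p.1, N x) * ∏ x ∈ pairCells p'.1, E x =
      (∏ x ∈ pairCells p'.1, N x) * ∏ x ∈ pairCells p.1, E x := by
    apply mul_left_cancel₀ hv
    rw [← mul_assoc, ← mul_assoc, ← e1, ← e2]; ring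
  have hs : ∀ (g : PBox → RatFunc ℂ) (s t : Finset PBox),
      ∏ x ∈ s, g x = (∏ x ∈ s \ t, g x) * ∏ x ∈ s ∩ t, g x := fun g s t => by
    rw [← Finset.prod_union (Finset.disjoint_sdiff_inter s t), Finset.sdiff_union_inter]
  have e4 : (∏ x ∈ pairCells p.1 \ pairCells p'.1, N x) * ∏ x ∈ pairCells p'.1 \ pairCells p.1, E x =
      (∏ x ∈ pairCells p'.1 \ pairCells p.1, N x) * ∏ x ∈ pairCells p.1 \ pairCells p'.1, E x := by
    rw [hs N (pairCells p.1) (pairCells p'.1), hs E (pairCells p'.1) (pairCells p.1),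
      hs N (pairCells p'.1) (pairCells p.1), hs E (pairCells p.1) (pairCells p'.1),
      Finset.inter_comm (pairCells p'.1)] at e3
    apply mul_right_cancel₀ (mul_ne_zero (hN0 (pairCells p.1 ∩ pairCells p'.1))
      (hE0 (pairCells p.1 ∩ pairCells p'.1)))
    linear_combination e3
  have v1 := (HasVal.prod (pairCells p.1 \ pairCells p'.1) fun x _ =>
    hasVal_sub_linear (q ^ 2 * bloc q d u v x₀) (boxNum q d k l i x) (bloc q d u v x)).mul
    (HasVal.prod (pairCells p'.1 \ pairCells p.1) fun x _ =>
    hasVal_sub_linear (q ^ 2 * bloc q d u v x₀) (boxDen q d k l u v i x).2 (boxDen q d k l u v i x).1)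
  have v2 := (HasVal.prod (pairCells p'.1 \ pairCells p.1) fun x _ =>
    hasVal_sub_linear (q ^ 2 * bloc q d u v x₀) (boxNum q d k l i x) (bloc q d u v x)).mul
    (HasVal.prod (pairCells p.1 \ pairCells p'.1) fun x _ =>
    hasVal_sub_linear (q ^ 2 * bloc q d u v x₀) (boxDen q d k l u v i x).2 (boxDen q d k l u v i x).1)
  rw [← e4] at v2
  have e5 := v1.unique v2
  rw [Finset.prod_eq_zero (s := pairCells p.1 \ pairCells p'.1) (i := x₀)
    (f := fun x => (boxDen q d k l u v i x).1 - (boxDen q d k l u v i x).2 * (q ^ 2 * bloc q d u v x₀))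
    (Finset.mem_sdiff.2 ⟨h0, h0'⟩), mul_zero, mul_eq_zero] at e5
  swap
  · rw [boxDen, if_neg]
    · rw [hi, BoxModel.cartanA_self, BoxModel.skewM_self D.hn, zpow_zero, one_mul, zpow_ofNat, sub_self]
    · rw [hi, BoxModel.cartanA_self]; norm_num
  rcases e5 with e5 | e5
  · obtain ⟨x, hx, hx0⟩ := Finset.prod_eq_zero_iff.1 e5
    have h1 := D.box_of_num_zero hx0
    have h2 := hmin x (Or.inl (Finset.mem_sdiff.1 hx))
    omega
  · obtain ⟨x, hx, hx0⟩ := Finset.prod_eq_zero_iff.1 e5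
    obtain ⟨hx1, hx2⟩ := Finset.mem_sdiff.1 hx
    rcases D.box_of_den_zero hx0 with h1 | ⟨h1, h2, h3⟩
    · have h2 := hmin x (Or.inr ⟨hx1, hx2⟩)
      omega
    -- A box on the site of x₀ is left to exclude. A second-layer box forces the first-layer box on
    -- its site, so it would make x₀ belong to `p'` or x belong to `p`.
    · rcases eq_or_ne x₀.1 x.1 with hl | hl
      · exact h0' (mem_of_same_site p'.2 (Or.inl hl.symm) h2 h3 hx1 (Or.inl hl))
      · cases hx01 : x₀.1
        · exact h0' (mem_of_same_site p'.2 (h1.imp_left Eq.symm) h2 h3 hx1 (Or.inr hx01))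
        · have hxf : x.1 = false := by
            cases hxx : x.1
            · rfl
            · exact absurd (hx01.trans hxx.symm) hl
          exact hx2 (mem_of_same_site p.2 h1 h2.symm h3.symm h0 (Or.inr hxf))

theorem weight_inj (p p' : pairSet L a b)
    (h : ∀ ε i r, deltaK q d k l u v ε i r p.1 = deltaK q d k l u v ε i r p'.1) : p = p' := by
  classical
  have hK : ∀ i, pairK q d k l u v i p RatFunc.X = pairK q d k l u v i p' RatFunc.X := by
    intro i
    have hL : ((pairK q d k l u v i p RatFunc.X : RatFunc ℂ) : LaurentSeries ℂ) =
        (pairK q d k l u v i p' RatFunc.X : RatFunc ℂ) := by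
      refine HahnSeries.ext (funext fun r => ?_)
      -- The expansion at z = 0 already determines the rational function.
      have := h false i (-r)
      unfold deltaK at this
      simp only [neg_neg] at this
      exact this
    exact RingHom.injective _ hL
  by_contra hne
  have hcells : pairCells p.1 ≠ pairCells p'.1 := fun hc =>
    hne (Subtype.ext (pairCells_injective hc))
  have hnonempty : ((pairCells p.1 \ pairCells p'.1) ∪ (pairCells p'.1 \ pairCells p.1)).Nonempty := by
    rw [Finset.nonempty_iff_ne_empty]
    intro he
    rw [Finset.union_eq_empty, Finset.sdiff_eq_empty_iff_subset, Finset.sdiff_eq_empty_iff_subset] at he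
    exact hcells (he.1.antisymm he.2)
  obtain ⟨x₀, hx₀, hmin⟩ := Finset.exists_min_image _ (fun x => siteX a x + siteY b x) hnonempty
  simp only [Finset.mem_union, Finset.mem_sdiff] at hx₀ hmin
  rcases hx₀ with ⟨h1, h2⟩ | ⟨h1, h2⟩
  · exact D.pairK_ne_of_min h1 h2 hmin (hK _)
  · exact D.pairK_ne_of_min h1 h2 (fun x hx => hmin x hx.symm) (hK _).symm

end TensorData

end WeightInj

/-! ## The box model of the tensor product -/

section Model

variable {n : ℕ} {q d : ℂ} {k l : ZMod n} {u v : ℂ} {L : Prop} {a b : ℕ}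

open Classical in
/-- The box model of the tensor product of two Fock modules. -/
def TensorData.model (D : TensorData q d k l u v L a b) : BoxModel n q d (pairSet L a b) PBox where
  toBoxLattice := pairLattice L a b
  loc := bloc q d u v
  loc_ne := D.bloc_ne
  col := bcolor k l
  e p x := pairE q d k l u v p x
  f p x := pairF q d k l u v p x
  e_ne {p x p'} h h0 := (D.pairE_eq_zero_iff p.2 (pairLattice_cov.1 h)).1 h0 p'.2
  f_ne {p x p'} h h0 := (D.pairF_eq_zero_iff p'.2 (pairLattice_cov.1 h)).1 h0 p.2
  e_f_comm {p pa pb s x y} hxy h1 h2 h3 h4 :=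
    D.pairE_mul_pairF_comm p.2 pa.2 pb.2 hxy (pairLattice_cov.1 h1) (pairLattice_cov.1 h2)
      (pairLattice_cov.1 h3) (pairLattice_cov.1 h4)
  Kc ε i p r := deltaK q d k l u v ε i r p
  Kc_true_neg i p r := (D.deltaK_expansion i r).1
  Kc_false_pos i p r := (D.deltaK_expansion i r).2.1
  Kc_zero_mul i p := (D.deltaK_expansion i 0).2.2.1
  Kc_cov {p x p'} h ε i r := by
    have h' := pairLattice_cov.1 h
    cases ε
    · exact (coeff_of_isKRatio r).2 (pairK_ratio (u := u) (v := v) D.hn D.hq D.hd i h' X_ne_C)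
    · exact (coeff_of_isKRatio r).1 (pairK_ratio (u := u) (v := v) D.hn D.hq D.hd i h' X_inv_ne_C)
  Kc_cov_comm {p x p'} h ε i r hA := by
    have h' := pairLattice_cov.1 h
    have h1 := (pairK_ratio (u := u) (v := v) D.hn D.hq D.hd i h' X_ne_C).2 hA
    have h2 := (pairK_ratio (u := u) (v := v) D.hn D.hq D.hd i h' X_inv_ne_C).2 hA
    cases ε
    · exact congrArg (fun g : RatFunc ℂ => (g : LaurentSeries ℂ).coeff (-r)) h1
    · exact congrArg (fun g : RatFunc ℂ => (g : LaurentSeries ℂ).coeff r) h2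
  Kc_sub i p r := by
    convert (D.deltaK_expansion i r).2.2.2.2
  corner_inj p x y hx hy := by
    have key : ∀ x, x ∈ (pairLattice L a b).adds p ∪ (pairLattice L a b).rems p →
        x.2 ∈ (part p.1 x.1).addBoxes ∨ x.2 ∈ (part p.1 x.1).remBoxes := by
      intro x hx
      rcases Finset.mem_union.1 hx with h | h
      · obtain ⟨p', hp'⟩ := mem_pairLattice_adds.1 h
        exact Or.inl hp'.mem_addBoxes
      · obtain ⟨p', hp'⟩ := mem_pairLattice_rems.1 h
        exact Or.inr hp'.mem_remBoxes
    exact D.corner_inj p.2 (key x hx) (key y hy)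
  corner_forced {p pa s x y} h1 h2 h3 c hc :=
    D.corner_forced p.2 s.2 (pairLattice_cov.1 h1) (pairLattice_cov.1 h2)
      (fun h => h3 (mem_pairLattice_adds.2 h))
      ((Finset.mem_union.1 hc).imp mem_pairLattice_adds.1 mem_pairLattice_rems.1)
  wheel p s x y z h1 h2 h3 h4 h5 h6 := D.wheel p.2 s.2 h1 h2 h3 h4 h5 h6
  weight_inj := D.weight_inj

/-- The corners of the vacuum are the first boxes of the two layers, both addable, and each
contributes one factor q. -/
theorem TensorData.level [NeZero n] (D : TensorData q d k l u v L a b) :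
    ∏ i : ZMod n, D.model.Kc false i D.model.vac 0 = q ^ 2 := by
  classical
  have hmem : ∀ (i : ZMod n) (x : PBox), x ∈ pairCorners k l i (pairLattice L a b).vac.1 ↔
      x ∈ ({(false, 0, 0), (true, 0, 0)} : Finset PBox) ∧ bcolor k l x = i := by
    rintro i ⟨c, j, m⟩
    have hpart : part (pairLattice L a b).vac.1 c = Partn.empty := by cases c <;> rfl
    rw [mem_pairCorners]
    dsimp only
    rw [hpart, Partn.mem_addBoxes, Partn.mem_remBoxes]
    refine and_congr_left fun _ => ?_
    simp only [Finset.mem_insert, Finset.mem_singleton, Prod.mk.injEq, Partn.empty_apply]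
    constructor
    · rintro (⟨h1, h2⟩ | ⟨h1, h2⟩)
      · have : j = 0 := by
          by_contra hj
          exact absurd (h1 (Nat.pos_of_ne_zero hj)) (Nat.lt_irrefl 0)
        cases c <;> simp [this, h2]
      · omega
    · intro h
      have : j = 0 ∧ m = 0 := by tauto
      rw [this.1, this.2]
      exact Or.inl ⟨Partn.addRow_zero _, rfl⟩
  have h1 : ∀ i : ZMod n, D.model.Kc false i D.model.vac 0 =
      ∏ x ∈ ({(false, 0, 0), (true, 0, 0)} : Finset PBox), if bcolor k l x = i then q else 1 := by
    intro i
    refine ((D.deltaK_expansion (p := (pairLattice L a b).vac) i 0).2.2.2.1).trans ?_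
    rw [← Finset.prod_filter]
    refine Finset.prod_congr ?_ fun x hx => ?_
    · ext x
      rw [hmem, Finset.mem_filter]
    · have hx' := (hmem i x).1 (by rw [hmem]; exact Finset.mem_filter.1 hx)
      rw [if_pos]
      have hpart : part (pairLattice L a b).vac.1 x.1 = Partn.empty := by cases x.1 <;> rfl
      rw [hpart, Partn.mem_addBoxes]
      have : x.2 = (0, 0) := by
        have := hx'.1
        simp only [Finset.mem_insert, Finset.mem_singleton] at this
        rcases this with rfl | rfl <;> rfl
      rw [this]
      exact ⟨Partn.addRow_zero _, rfl⟩
  rw [Finset.prod_congr rfl fun i _ => h1 i, Finset.prod_comm]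
  simp only [Finset.prod_ite_eq, Finset.mem_univ, if_true]
  rw [Finset.prod_const]
  rfl

end Model

/-! ## The basis of the span of a set of basis vectors -/

section KetBasis

theorem finsuppTensorFinsupp_ket (p : Partn × Partn) :
    finsuppTensorFinsupp' ℂ Partn Partn (ket p) = Finsupp.single p 1 := by
  rw [ket, finsuppTensorFinsupp'_single_tmul_single, mul_one]

open Classical in
theorem bra_ket (p' p : Partn × Partn) : bra p' (ket p) = if p = p' then 1 else 0 := by
  rw [bra, finsuppTensorFinsupp_ket, Finsupp.single_apply]

theorem bra_sum {ι : Type*} (p' : Partn × Partn) (s : Finset ι) (c : ι → ℂ)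
    (x : ι → FockSpace ⊗[ℂ] FockSpace) :
    bra p' (∑ j ∈ s, c j • x j) = ∑ j ∈ s, c j * bra p' (x j) := by
  simp only [bra, map_sum, map_smul, Finsupp.coe_finsetSum, Finset.sum_apply, Finsupp.smul_apply,
    smul_eq_mul]

theorem linearIndependent_ketIn (S : Set (Partn × Partn)) : LinearIndependent ℂ (ketIn S) := by
  apply LinearIndependent.of_comp ((finsuppTensorFinsupp' ℂ Partn Partn).toLinearMap ∘ₗ (ketSpan S).subtype)
  have h := (Finsupp.basisSingleOne (R := ℂ) (ι := Partn × Partn)).linearIndependent.comp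
    (Subtype.val : S → Partn × Partn) Subtype.val_injective
  have h' : (Finsupp.basisSingleOne (R := ℂ) (ι := Partn × Partn) ∘ (Subtype.val : S → Partn × Partn)) =
      ((finsuppTensorFinsupp' ℂ Partn Partn).toLinearMap ∘ₗ (ketSpan S).subtype) ∘ ketIn S := by
    funext p
    simp only [Function.comp_apply, Finsupp.coe_basisSingleOne]
    exact (finsuppTensorFinsupp_ket p).symm
  rw [h'] at h
  exact h

theorem span_ketIn (S : Set (Partn × Partn)) : ⊤ ≤ Submodule.span ℂ (Set.range (ketIn S)) := by
  rintro ⟨x, hx⟩ -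
  induction hx using Submodule.span_induction with
  | mem x h =>
    obtain ⟨p, hp, rfl⟩ := h
    exact Submodule.subset_span ⟨⟨p, hp⟩, rfl⟩
  | zero => exact Submodule.zero_mem _
  | add x y _ _ h1 h2 => exact Submodule.add_mem _ h1 h2
  | smul c x _ h => exact Submodule.smul_mem _ c h

/-- Negation is supplied by the scalar -1, which keeps the additive and linear structure used in the
theorem. -/
instance (S : Set (Partn × Partn)) : AddCommGroup (ketSpan S) :=
  Module.addCommMonoidToAddCommGroup ℂ

/-- The basis of the vectors `|λ⟩ ⊗ |μ⟩`. -/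
def ketBasis (S : Set (Partn × Partn)) : Module.Basis S ℂ (ketSpan S) :=
  Module.Basis.mk (linearIndependent_ketIn S) (span_ketIn S)

theorem ketBasis_apply (S : Set (Partn × Partn)) (p : S) : ketBasis S p = ketIn S p :=
  Module.Basis.mk_apply ..

end KetBasis

/-! ## The matrix coefficients of the comultiplication -/

section Delta

variable {n : ℕ} {q d : ℂ} {k l : ZMod n} {u v : ℂ}

theorem deltaE_eq_zero (i : ZMod n) (r : ℤ) {p p' : Partn × Partn} (h : ∀ x, ¬ PairCov p x p') :
    deltaE q d k l u v i r p' p = 0 := by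
  unfold deltaE
  have h1 : p'.2 = p.2 → fockE q d k u i p'.1 p.1 = 0 := fun h2 =>
    fockE_eq_zero i fun j hj => h (false, j, p.1.1 j) ⟨hj, rfl, h2⟩
  have h2 : p'.1 = p.1 → fockE q d l v i p'.2 p.2 = 0 := fun h2 =>
    fockE_eq_zero i fun j hj => h (true, j, p.2.1 j) ⟨hj, rfl, h2⟩
  split_ifs with h3 h4 h4
  · rw [h1 h3, h2 h4, deltaCoeff_zero, mulCoeff_zero, add_zero]
  · rw [h1 h3, deltaCoeff_zero, add_zero]
  · rw [h2 h4, mulCoeff_zero, add_zero]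
  · rw [add_zero]

theorem deltaF_eq_zero (i : ZMod n) (r : ℤ) {p p' : Partn × Partn} (h : ∀ x, ¬ PairCov p' x p) :
    deltaF q d k l u v i r p' p = 0 := by
  unfold deltaF
  have h1 : p'.2 = p.2 → fockF q d k u i p'.1 p.1 = 0 := fun h2 =>
    fockF_eq_zero i fun j hj => h (false, j, p'.1.1 j) ⟨hj, rfl, h2.symm⟩
  have h2 : p'.1 = p.1 → fockF q d l v i p'.2 p.2 = 0 := fun h2 =>
    fockF_eq_zero i fun j hj => h (true, j, p'.2.1 j) ⟨hj, rfl, h2.symm⟩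
  split_ifs with h3 h4 h4
  · rw [h1 h3, h2 h4, deltaCoeff_zero, mulCoeff_zero, add_zero]
  · rw [h1 h3, mulCoeff_zero, add_zero]
  · rw [h2 h4, deltaCoeff_zero, add_zero]
  · rw [add_zero]

theorem AddBox.ne {lam lam' : Partn} {j : ℕ} (h : AddBox lam lam' j) : lam' ≠ lam := by
  rintro rfl
  have := h.self
  omega

theorem PairCov.unique {p p' : Partn × Partn} {x y : PBox} (h : PairCov p x p') (h' : PairCov p y p') :
    x = y := by
  have h1 := pairCov_iff.1 h
  have h2 := pairCov_iff.1 h'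
  have : x ∈ insert y (pairCells p) := by rw [← h2.2, h1.2]; exact Finset.mem_insert_self _ _
  exact (Finset.mem_insert.1 this).resolve_right h1.1

variable {L : Prop} {a b : ℕ} (D : TensorData q d k l u v L a b)
include D

namespace TensorData

theorem deltaE_of_cov (i : ZMod n) (r : ℤ) {p p' : Partn × Partn} {x : PBox} (h : PairCov p x p') :
    deltaE q d k l u v i r p' p = D.model.mode i r x * pairE q d k l u v p x := by
  obtain ⟨c, j, m⟩ := x
  obtain ⟨h1, h2, h3⟩ := h
  dsimp only at h1 h2 h3
  subst h2
  have hmode : D.model.mode i r (c, j, (part p c).1 j) = open Classical in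
      if bcol (lcol k l c) ((part p c).1 j) j = i then
        xloc q d (lpar u v c) ((part p c).1 j) j ^ r else 0 := by
    unfold BoxModel.mode; congr
  rw [hmode]
  unfold deltaE pairE
  cases c
  · rw [if_pos (show p'.2 = p.2 from h3), if_neg (show p'.1 ≠ p.1 from h1.ne), add_zero,
      fockE_of_addBox D.hq D.hd D.hu i (show AddBox p.1 p'.1 j from h1)]
    simp only [cond_false, one_mul]
    change deltaCoeff (if bcol k (p.1.1 j) j = i then _ else _) r =
      (if bcol k (p.1.1 j) j = i then _ else _) * _
    split_ifs
    · rw [deltaCoeff_single, mul_comm]; rfl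
    · rw [deltaCoeff_zero, zero_mul]
  · rw [if_pos (show p'.1 = p.1 from h3), if_neg (show p'.2 ≠ p.2 from h1.ne), zero_add,
      fockE_of_addBox D.hq D.hd D.hv i (show AddBox p.2 p'.2 j from h1)]
    simp only [cond_true]
    change mulCoeff _ (if bcol l (p.2.1 j) j = i then _ else _) r =
      (if bcol l (p.2.1 j) j = i then _ else _) * _
    split_ifs with hi
    · subst hi
      rw [mulCoeff_single, mul_comm]; rfl
    · rw [mulCoeff_zero, zero_mul]

theorem deltaF_of_cov (i : ZMod n) (r : ℤ) {p p' : Partn × Partn} {x : PBox} (h : PairCov p x p') :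
    deltaF q d k l u v i r p p' = D.model.mode i r x * pairF q d k l u v p x := by
  obtain ⟨c, j, m⟩ := x
  obtain ⟨h1, h2, h3⟩ := h
  dsimp only at h1 h2 h3
  subst h2
  have hmode : D.model.mode i r (c, j, (part p c).1 j) = open Classical in
      if bcol (lcol k l c) ((part p c).1 j) j = i then
        xloc q d (lpar u v c) ((part p c).1 j) j ^ r else 0 := by
    unfold BoxModel.mode; congr
  rw [hmode]
  unfold deltaF pairF
  cases c
  · have h4 : p'.2 = p.2 := h3
    rw [if_pos h4.symm, if_neg (show p.1 ≠ p'.1 from h1.ne.symm), add_zero,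
      fockF_of_addBox D.hq D.hd D.hu i (show AddBox p.1 p'.1 j from h1)]
    simp only [cond_false]
    change mulCoeff _ (if bcol k (p.1.1 j) j = i then _ else _) r =
      (if bcol k (p.1.1 j) j = i then _ else _) * _
    split_ifs with hi
    · subst hi
      rw [mulCoeff_single, mul_comm, h4]; rfl
    · rw [mulCoeff_zero, zero_mul]
  · have h4 : p'.1 = p.1 := h3
    rw [if_pos h4.symm, if_neg (show p.2 ≠ p'.2 from h1.ne.symm), zero_add,
      fockF_of_addBox D.hq D.hd D.hv i (show AddBox p.2 p'.2 j from h1)]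
    simp only [cond_true, one_mul]
    change deltaCoeff (if bcol l (p.2.1 j) j = i then _ else _) r =
      (if bcol l (p.2.1 j) j = i then _ else _) * _
    split_ifs
    · rw [deltaCoeff_single, mul_comm]; rfl
    · rw [deltaCoeff_zero, zero_mul]

/-- The coproduct also has terms that lead out of the set, but their coefficients vanish, so it
agrees with the operator of the model. -/
theorem bra_opE (i : ZMod n) (r : ℤ) (p : pairSet L a b) (p' : Partn × Partn) :
    bra p' (D.model.opE (ketBasis (pairSet L a b)) i r (ketBasis _ p) : ketSpan (pairSet L a b)) = deltaE q d k l u v i r p' p := by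
  classical
  have h1 : ((D.model.opE (ketBasis (pairSet L a b)) i r (ketBasis _ p) : ketSpan (pairSet L a b)) :
      FockSpace ⊗[ℂ] FockSpace) = ∑ x ∈ (pairLattice L a b).adds p,
      (D.model.mode i r x * pairE q d k l u v p x) • ket ((pairLattice L a b).up p x) := by
    rw [BoxModel.opE_apply, AddSubmonoidClass.coe_finsetSum]
    refine Finset.sum_congr rfl fun x hx => ?_
    obtain ⟨s, hs⟩ := mem_pairLattice_adds.1 hx
    have hc : (pairLattice L a b).Cov p x s := pairLattice_cov.2 hs
    rw [D.model.eps_cov _ hc, hc.up_eq, smul_smul, ketBasis_apply]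
    rfl
  rw [h1, bra_sum]
  simp only [bra_ket]
  by_cases h : ∃ x, PairCov p x p'
  · obtain ⟨x, hx⟩ := h
    rw [D.deltaE_of_cov i r hx]
    by_cases hp' : p' ∈ pairSet L a b
    · have hc : (pairLattice L a b).Cov p x ⟨p', hp'⟩ := pairLattice_cov.2 hx
      rw [Finset.sum_eq_single x]
      · rw [hc.up_eq, if_pos rfl, mul_one]
      · intro y hy hyx
        obtain ⟨s, hs⟩ := mem_pairLattice_adds.1 hy
        rw [(pairLattice_cov.2 hs).up_eq, if_neg, mul_zero]
        rintro rfl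
        exact hyx (hs.unique hx)
      · exact fun hn => absurd (mem_pairLattice_adds.2 ⟨⟨p', hp'⟩, hx⟩) hn
    · rw [(D.pairE_eq_zero_iff p.2 hx).2 hp', mul_zero]
      refine Finset.sum_eq_zero fun y _ => ?_
      rw [if_neg, mul_zero]
      intro he
      exact hp' (he ▸ ((pairLattice L a b).up p y).2)
  · push Not at h
    rw [deltaE_eq_zero i r h]
    refine Finset.sum_eq_zero fun y hy => ?_
    obtain ⟨s, hs⟩ := mem_pairLattice_adds.1 hy
    rw [(pairLattice_cov.2 hs).up_eq, if_neg, mul_zero]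
    rintro rfl
    exact h y hs

theorem bra_opF (i : ZMod n) (r : ℤ) (p : pairSet L a b) (p' : Partn × Partn) :
    bra p' (D.model.opF (ketBasis (pairSet L a b)) i r (ketBasis _ p) : ketSpan (pairSet L a b)) = deltaF q d k l u v i r p' p := by
  classical
  have h1 : ((D.model.opF (ketBasis (pairSet L a b)) i r (ketBasis _ p) : ketSpan (pairSet L a b)) :
      FockSpace ⊗[ℂ] FockSpace) = ∑ x ∈ (pairLattice L a b).rems p,
      (D.model.mode i r x * pairF q d k l u v ((pairLattice L a b).dn p x) x) •
        ket ((pairLattice L a b).dn p x) := by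
    rw [BoxModel.opF_apply, AddSubmonoidClass.coe_finsetSum]
    refine Finset.sum_congr rfl fun x hx => ?_
    obtain ⟨s, hs⟩ := mem_pairLattice_rems.1 hx
    have hc : (pairLattice L a b).Cov s x p := pairLattice_cov.2 hs
    rw [D.model.phi_cov _ hc, hc.dn_eq, smul_smul, ketBasis_apply]
    rfl
  rw [h1, bra_sum]
  simp only [bra_ket]
  by_cases h : ∃ x, PairCov p' x p
  · obtain ⟨x, hx⟩ := h
    rw [D.deltaF_of_cov i r hx]
    by_cases hp' : p' ∈ pairSet L a b
    · have hc : (pairLattice L a b).Cov ⟨p', hp'⟩ x p := pairLattice_cov.2 hx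
      rw [Finset.sum_eq_single x]
      · rw [hc.dn_eq, if_pos rfl, mul_one]
      · intro y hy hyx
        obtain ⟨s, hs⟩ := mem_pairLattice_rems.1 hy
        rw [(pairLattice_cov.2 hs).dn_eq, if_neg, mul_zero]
        rintro rfl
        exact hyx (hs.unique hx)
      · exact fun hn => absurd (mem_pairLattice_rems.2 ⟨⟨p', hp'⟩, hx⟩) hn
    · rw [(D.pairF_eq_zero_iff p.2 hx).2 hp', mul_zero]
      refine Finset.sum_eq_zero fun y _ => ?_
      rw [if_neg, mul_zero]
      intro he
      exact hp' (he ▸ ((pairLattice L a b).dn p y).2)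
  · push Not at h
    rw [deltaF_eq_zero i r h]
    refine Finset.sum_eq_zero fun y hy => ?_
    obtain ⟨s, hs⟩ := mem_pairLattice_rems.1 hy
    rw [(pairLattice_cov.2 hs).dn_eq, if_neg, mul_zero]
    rintro rfl
    exact h y hs

/-- The delta functions are supported at corners of one layer, where the eigenvalue on the other
layer is regular by `hasVal_partK`. -/
theorem wellDefined : DeltaWellDefinedOn q d k l u v (pairSet L a b) := by
  classical
  intro p hp i
  constructor
  · intro mu' x hx
    by_cases h : ∃ j, AddBox p.2 mu' j
    · obtain ⟨j, hj⟩ := h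
      rw [fockE_of_addBox D.hq D.hd D.hv i hj] at hx
      split_ifs at hx with hi
      · rw [Finset.mem_singleton.1 (Finsupp.support_single_subset hx), ← hi]
        exact (D.hasVal_partK hp (x := (true, j, p.2.1 j))
          (Or.inl (Partn.mem_addBoxes.2 ⟨hj.addRow, rfl⟩))).1
      · simp at hx
    · push Not at h
      rw [fockE_eq_zero i h] at hx
      simp at hx
  · intro lam' x hx
    by_cases h : ∃ j, AddBox lam' p.1 j
    · obtain ⟨j, hj⟩ := h
      rw [fockF_of_addBox D.hq D.hd D.hu i hj] at hx
      split_ifs at hx with hi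
      · rw [Finset.mem_singleton.1 (Finsupp.support_single_subset hx), ← hi]
        exact (D.hasVal_partK hp (x := (false, j, lam'.1 j))
          (Or.inr (Partn.mem_remBoxes.2 ⟨hj.remRow, hj.self.symm⟩))).1
      · simp at hx
    · push Not at h
      rw [fockF_eq_zero i h] at hx
      simp at hx

/-- The action of the quantum toroidal algebra by the comultiplication. -/
theorem exists_rep {S : Set (Partn × Partn)} (hS : pairSet L a b = S) :
    DeltaWellDefinedOn q d k l u v S ∧
      ∃ ρ : QToroidal n q d →ₐ[ℂ] Module.End ℂ (ketSpan S),
        ActsByDelta q d k l u v S ρ ∧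
        IsIrreducibleRep ρ ∧ IsQuasiFinite ρ ∧ IsTame ρ ∧ IsLowestWeight ρ ∧
        HasLevel ρ (q ^ 2) := by
  subst hS
  have hn := D.hn
  have : NeZero n := ⟨by omega⟩
  refine ⟨D.wellDefined, D.model.rep (ketBasis _) D.hn D.hq D.hd (D.hgen.q_four), ?_,
    D.model.rep_isIrreducible _ _ _ _ _, D.model.rep_isQuasiFinite _ _ _ _ _,
    D.model.rep_isTame _ _ _ _ _, D.model.rep_isLowestWeight _ _ _ _ _, ?_⟩
  · intro p i r
    rw [← ketBasis_apply]
    refine ⟨fun p' => ⟨?_, ?_⟩, fun ε => ?_⟩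
    · rw [BoxModel.rep_E, D.bra_opE]
    · rw [BoxModel.rep_F, D.bra_opF]
    · rw [BoxModel.rep_Kcur, BoxModel.diag_apply]; rfl
  · rw [← D.level]
    exact D.model.rep_hasLevel _ _ _ _ _

end TensorData

end Delta

/-! ## Resonances -/

section Resonances

variable {n : ℕ} {q d : ℂ} {k l : ZMod n} {u v : ℂ}

theorem pairSet_false (a b : ℕ) : pairSet False a b = Set.univ :=
  Set.eq_univ_of_forall fun _ h => h.elim

theorem pairSet_true (a b : ℕ) : pairSet True a b = interlacing a b :=
  Set.ext fun _ => ⟨fun h => h trivial, fun h _ => h⟩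

/-- A partition with an addable box in a given place. -/
theorem Partn.exists_addRow (j m : ℕ) : ∃ lam : Partn, lam.AddRow j ∧ lam.1 j = m := by
  let f : ℕ → ℕ := fun s => if s < j then m + 1 else if s = j then m else 0
  have hf : ∀ s, f s ≠ 0 → s ∈ Finset.range (j + 1) := by
    intro s hs
    rw [Finset.mem_range]
    by_contra h
    exact hs (by simp only [f]; rw [if_neg (by omega), if_neg (by omega)])
  refine ⟨⟨Finsupp.onFinset _ f hf, fun s t h => ?_⟩, fun hj => ?_, ?_⟩
  · simp only [Finsupp.onFinset_apply, f]
    split_ifs <;> omega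
  · simp only [Finsupp.onFinset_apply, f]
    split_ifs <;> omega
  · simp [f]

/-- An addable box of λ and one of μ are placed at the same location with the same colour: K has a
pole with nonzero residue on λ exactly where E adds a box to μ. -/
theorem not_wellDefined_of_resonance (hn : 3 ≤ n) (hq : q ≠ 0) (hd : d ≠ 0) (hu : u ≠ 0) (hv : v ≠ 0)
    (hgen : GenericParams q d) {a b : ℤ} (h : Resonance q d k l u v a b) :
    ¬ DeltaWellDefinedOn q d k l u v Set.univ := by
  classical
  intro hW
  obtain ⟨h1, h2⟩ := (resonance_iff hq hd a b).1 h
  -- Rows and columns are the positive parts of ±(b + 1) and ±(a + 1): they are nonnegative and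
  -- differ by the displacement of the two layers, whatever the signs of a and b.
  obtain ⟨lam, hlam, hm⟩ := Partn.exists_addRow (-b - 1).toNat (-a - 1).toNat
  obtain ⟨mu, hmu, hm'⟩ := Partn.exists_addRow (b + 1).toNat (a + 1).toNat
  obtain ⟨mu', hmu'⟩ := hmu.exists_addBox
  have hloc : xloc q d v (mu.1 (b + 1).toNat) (b + 1).toNat =
      xloc q d u (lam.1 (-b - 1).toNat) (-b - 1).toNat := by
    rw [h1, xloc_add hq hd, hm, hm']
    congr 1 <;> omega
  have hcol : bcol l (mu.1 (b + 1).toNat) (b + 1).toNat =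
      bcol k (lam.1 (-b - 1).toNat) (-b - 1).toNat := by
    rw [h2, hm, hm']
    unfold bcol
    have e1 : ((-b - 1).toNat : ℤ) = (b + 1).toNat + (-b - 1) := by omega
    have e2 : ((-a - 1).toNat : ℤ) = (a + 1).toNat + (-a - 1) := by omega
    rw [e1, e2, Int.cast_add, Int.cast_add]
    ring
  have h3 := (hW (lam, mu) trivial (bcol l (mu.1 (b + 1).toNat) (b + 1).toNat)).1 mu'
    (xloc q d v (mu.1 (b + 1).toNat) (b + 1).toNat)
  rw [fockE_of_addBox hq hd hv _ hmu', if_pos rfl, Finsupp.mem_support_iff, Finsupp.single_eq_same] at h3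
  refine h3 (fe_ne_zero hq hd hv hgen hmu) ?_
  rw [hloc, hcol]
  refine denom_eval_eq_zero_of_hasVal (hasVal_fockK_add hn hq hd hu hgen hlam) ?_
  refine mul_ne_zero (mul_ne_zero ?_ (xloc_ne_zero hq hd hu _ _))
    (mul_ne_zero (fe_ne_zero hq hd hu hgen hlam) (ff_ne_zero hq hd hu hgen hlam))
  rw [← neg_sub, neg_ne_zero]
  exact BoxModel.q_sub_inv_ne hq (hgen.q_four)

end Resonances

theorem mainTheorem7 (n : ℕ) (hn : 3 ≤ n) (q d : ℂ) (hq : q ≠ 0) (hd : d ≠ 0)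
    (hgen : GenericParams q d) (k l : ZMod n) (u v : ℂ) (hu : u ≠ 0) (hv : v ≠ 0) :
    (¬ DeltaWellDefinedOn q d k l u v Set.univ ↔ ∃ a b : ℤ, Resonance q d k l u v a b) ∧
    (DeltaWellDefinedOn q d k l u v Set.univ →
      ∃ ρ : QToroidal n q d →ₐ[ℂ] Module.End ℂ (ketSpan Set.univ),
        ActsByDelta q d k l u v Set.univ ρ ∧
        IsIrreducibleRep ρ ∧ IsQuasiFinite ρ ∧ IsLowestWeight ρ ∧ HasLevel ρ (q ^ 2)) ∧
    (∀ a b : ℕ, Resonance q d k l u v (a : ℤ) (b : ℤ) →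
      DeltaWellDefinedOn q d k l u v (interlacing a b) ∧
      ∃ ρ : QToroidal n q d →ₐ[ℂ] Module.End ℂ (ketSpan (interlacing a b)),
        ActsByDelta q d k l u v (interlacing a b) ρ ∧
        IsIrreducibleRep ρ ∧ IsQuasiFinite ρ ∧ IsTame ρ ∧ IsLowestWeight ρ ∧
        HasLevel ρ (q ^ 2)) := by
  -- Without a resonance no interlacing is imposed, and the shifts 0, 0 are mere placeholders.
  have hfree : (¬ ∃ a b : ℤ, Resonance q d k l u v a b) → TensorData q d k l u v False 0 0 := fun h =>
    ⟨hn, hq, hd, hu, hv, hgen, False.elim, fun _ a b hab => h ⟨a, b, hab⟩⟩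
  have hnot : (∃ a b : ℤ, Resonance q d k l u v a b) → ¬ DeltaWellDefinedOn q d k l u v Set.univ := by
    rintro ⟨a, b, h⟩
    exact not_wellDefined_of_resonance hn hq hd hu hv hgen h
  refine ⟨⟨fun h => ?_, hnot⟩, fun h => ?_, fun a b h => ?_⟩
  · by_contra hr
    exact h ((hfree hr).exists_rep (pairSet_false 0 0)).1
  · obtain ⟨-, ρ, h1, h2, h3, -, h4, h5⟩ :=
      (hfree fun hr => hnot hr h).exists_rep (pairSet_false 0 0)
    exact ⟨ρ, h1, h2, h3, h4, h5⟩
  · exact TensorData.exists_rep (L := True) ⟨hn, hq, hd, hu, hv, hgen, fun _ => h, fun h' => absurd trivial h'⟩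
      (pairSet_true a b)

end
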